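/- Let $F$ be a number field, $\overline{\mathbf Q}$ an algebraic closure of $\mathbf Q$ containing $F$, and $f=[U:V]$ an endomorphism of degree $d\ge 2$ of $\mathbf P^1$ over $F$, where $U,V\in F[X,Y]$ are homogeneous of degree $d$ without common zero in $\overline{\mathbf Q}^2$ other than $(0,0)$. Let $h$ be the absolute logarithmic Weil height on $\mathbf P^1(\overline{\mathbf Q})$ and let $\hat h(P)=\lim_{n\to\infty} d^{-n}h(f^n(P))$ be the normalized height of $f$; it is well defined, and it is the unique function on $\mathbf P^1(\overline{\mathbf Q})$ such that $\hat h-h$ is bounded and $\hat h\circ f=d\,\hat h$. A place $v$ of $F$ is an absolute value of $F$ extending the usual absolute value of $\mathbf Q$ (put $p_v=\infty$, $\mathbf C_v=\mathbf C$) or the $p$-adic one normalized by $|p|_p=1/p$ (put $p_v=p$, $\mathbf C_v=\mathbf C_p$). Let $\varepsilon_v$ be the number of embeddings of $F$ in $\mathbf C_v$ inducing $v$, and fix, for each $v$, an embedding of $\overline{\mathbf Q}$ in $\mathbf C_v$ inducing $v$ on $F$. Let $(U_n,V_n)$ be the $n$-th iterate of $(U,V)$. For $(x,y)\in\mathbf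 C_v^2\setminus\{(0,0)\}$ put $$\Lambda_v(x,y)=\lim_{n\to\infty} d^{-n}\log\max(|U_n(x,y)|_v,|V_n(x,y)|_v),$$ and for distinct points $P_1=[x_1:y_1]$, $P_2=[x_2:y_2]$ of $\mathbf P^1(\mathbf C_v)$ put $$G_v(P_1,P_2)=-\log|x_1y_2-x_2y_1|_v+\Lambda_v(x_1,y_1)+\Lambda_v(x_2,y_2)-\frac1{d(d-1)}\log|\mathrm{Res}(U,V)|_v .$$ For $P\in\mathbf P^1(\overline{\mathbf Q})$ not in $\mathbf P^1(F)$, with conjugates $P_1,\dots,P_n$ over $F$ ($n\ge 2$ is the degree of $P$ over $F$), the $v$-adic discrepancy of $P$ is $$D_v(P)=\frac1{n(n-1)}\sum_{i\ne j}G_v(P_i,P_j).$$ (1) For every $P\in\mathbf P^1(\overline{\mathbf Q})$ not in $\mathbf P^1(F)$, only finitely many of the $\varepsilon_vD_v(P)$ are nonzero, and $$\hat h(P)=\frac1{[F:\mathbf Q]}\cdot\frac12\sum_{v}\varepsilon_v D_v(P),$$ the sum being over all places $v$ of $F$. (2) Let $(P_n)_{n\ge 0}$ be a sequence of pairwise distinct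 points of $\mathbf P^1(\overline{\mathbf Q})$ such that $\hat h(P_n)\to 0$. Then $P_n\notin\mathbf P^1(F)$ for all large $n$, and $D_v(P_n)\to 0$ for every place $v$ of $F$. -/

import Mathlib

open Filter Topology
open scoped LinearAlgebra.Projectivization

namespace ArithDyn

/-! ### The projective line -/

/-- The set `ℙ¹(K)` of `K`-points of the projective line. -/
abbrev P1 (K : Type*) [Field K] : Type _ := ℙ K (Fin 2 → K)

/-- The map `ℙ¹(K) → ℙ¹(L)`, `[x : y] ↦ [σ x : σ y]`, induced by a field homomorphism `σ`. -/
def P1.map {K L : Type*} [Field K] [Field L] (σ : K →+* L) : P1 K → P1 L :=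
  Projectivization.map (σ := σ)
    { toFun := fun x i => σ (x i)
      map_add' := fun x y => by ext i; simp
      map_smul' := fun c x => by ext i; simp }
    (fun x y h => funext fun i => σ.injective (congrFun h i))

/-! ### Places of a number field, the fields `ℂ_v`, and the integers `ε_v` -/

/-- The places `p ≤ ∞` of `ℚ`. -/
inductive RatPlace : Type
  | infinite : RatPlace
  | finite (p : Nat.Primes) : RatPlace

/-- The usual absolute value of `ℚ`, or the `p`-adic one with `|p|_p = 1 / p`. -/
noncomputable def RatPlace.abv : RatPlace → AbsoluteValue ℚ ℝ
  | .infinite => Rat.AbsoluteValue.real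
  | .finite p => haveI : Fact (p : ℕ).Prime := ⟨p.2⟩; Rat.AbsoluteValue.padic p

/-- The field `ℂ_p`; it is `ℂ` if `p = ∞`. -/
def RatPlace.C : RatPlace → Type
  | .infinite => ℂ
  | .finite p => haveI : Fact (p : ℕ).Prime := ⟨p.2⟩; PadicComplex p

/-- The standard absolute value of `ℂ_p`, extending the one of `ℚ`. -/
noncomputable instance RatPlace.instNormedFieldC : (p : RatPlace) → NormedField p.C
  | .infinite => inferInstanceAs (NormedField ℂ)
  | .finite p => haveI : Fact (p : ℕ).Prime := ⟨p.2⟩; inferInstanceAs (NormedField (PadicComplex p))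

/-- The set `M_F` of places of `F`: a place is an absolute value of `F` that extends the `p`-adic
absolute value of `ℚ`, for a prime number `p` or for `p = ∞`. As `p` is determined by the absolute
value, keeping it as a field does not duplicate any place. -/
structure Place (F : Type*) [Field F] [NumberField F] where
  abv : AbsoluteValue F ℝ
  under : RatPlace
  extends_abv : ∀ q : ℚ, abv (algebraMap ℚ F q) = under.abv q

section places

variable {F : Type*} [Field F] [NumberField F]

/-- The field `ℂ_v`, which is `ℂ` or `ℂ_p`. -/
abbrev Place.C (v : Place F) : Type := v.under.C

/-- The number `ε_v` of embeddings of `F` in `ℂ_v` which induce the absolute value `v` on `F`. -/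
noncomputable def Place.ε (v : Place F) : ℕ :=
  Nat.card {σ : F →+* v.C // ∀ x : F, ‖σ x‖ = v.abv x}

/-- The embeddings in `ℂ_v` of an extension `E` of `F` that induce the absolute value `v` on `F`. -/
abbrev Place.Embedding (v : Place F) (E : Type*) [Field E] [Algebra F E] : Type _ :=
  {τ : E →+* v.C // ∀ x : F, ‖τ (algebraMap F E x)‖ = v.abv x}

end places

/-! ### Homogeneous Green functions over a valued field -/

section Green

variable {K : Type*} [NormedField K]

/-- The map `(x, y) ↦ (U(x, y), V(x, y))` on `K²`. -/
noncomputable def evalPair {K : Type*} [Field K] (U V : MvPolynomial (Fin 2) K) (x : Fin 2 → K) :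
    Fin 2 → K :=
  ![MvPolynomial.eval x U, MvPolynomial.eval x V]

/-- The homogeneous resultant of two binary forms `U`, `V` of degree `d`: the determinant of their
Sylvester matrix of size `2 d` (leading coefficients are allowed to vanish). -/
noncomputable def homResultant {K : Type*} [Field K] (d : ℕ) (U V : MvPolynomial (Fin 2) K) : K :=
  Polynomial.resultant (MvPolynomial.aeval ![Polynomial.X, 1] U)
    (MvPolynomial.aeval ![Polynomial.X, 1] V) d d

/-- `Λ(x, y) = lim d⁻ⁿ log max(|U_n(x, y)|, |V_n(x, y)|)`, where `(U_n, V_n)` is the `n`-th iterate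
of `(U, V)`. -/
noncomputable def greenHom (d : ℕ) (U V : MvPolynomial (Fin 2) K) (x : Fin 2 → K) : ℝ :=
  limUnder atTop fun n : ℕ =>
    Real.log (max ‖((evalPair U V)^[n] x) 0‖ ‖((evalPair U V)^[n] x) 1‖) / (d : ℝ) ^ n

/-- The Green function
`G(P₁, P₂) = - log |x₁ y₂ - x₂ y₁| + Λ(x₁, y₁) + Λ(x₂, y₂) - log |Res(U, V)| / (d (d - 1))`
for distinct points `P₁ = [x₁ : y₁]` and `P₂ = [x₂ : y₂]`; it does not depend on the choice of the
homogeneous coordinates. -/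
noncomputable def greenDiag (d : ℕ) (U V : MvPolynomial (Fin 2) K) (P₁ P₂ : P1 K) : ℝ :=
  -Real.log ‖P₁.rep 0 * P₂.rep 1 - P₂.rep 0 * P₁.rep 1‖
    + greenHom d U V P₁.rep + greenHom d U V P₂.rep
    - 1 / ((d : ℝ) * ((d : ℝ) - 1)) * Real.log ‖homResultant d U V‖

end Green

/-! ### The absolute height -/

/-- The absolute logarithmic Weil height of `P = [x₀ : x₁]`, where `x₀` and `x₁` are algebraic
numbers: `[K : ℚ]⁻¹` times the (relative) height over the number field `K = ℚ(x₀, x₁)`. -/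
noncomputable def height {Qbar : Type*} [Field Qbar] [CharZero Qbar] [Algebra.IsAlgebraic ℚ Qbar]
    (P : P1 Qbar) : ℝ :=
  let K : IntermediateField ℚ Qbar := IntermediateField.adjoin ℚ (Set.range P.rep)
  haveI : FiniteDimensional ℚ K :=
    IntermediateField.finiteDimensional_adjoin fun x _ => Algebra.IsIntegral.isIntegral x
  haveI : NumberField K := {}
  Height.logHeight (fun i : Fin 2 =>
      (⟨P.rep i, IntermediateField.subset_adjoin ℚ _ ⟨i, rfl⟩⟩ : K)) / Module.finrank ℚ K

/-! ### Endomorphisms of the projective line over a number field -/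

/-- An endomorphism of degree `d` of the projective line over `F`, given by two binary forms of
degree `d` with coefficients in `F`, without common zero in `Qbar²` other than `(0, 0)`. Here `Qbar`
is an algebraically closed extension of `F`. -/
structure Endo (F Qbar : Type*) [Field F] [Field Qbar] [Algebra F Qbar] (d : ℕ) where
  U : MvPolynomial (Fin 2) F
  V : MvPolynomial (Fin 2) F
  homogeneous_U : U.IsHomogeneous d
  homogeneous_V : V.IsHomogeneous d
  eq_zero_of_common_zero : ∀ x : Fin 2 → Qbar,
    MvPolynomial.aeval x U = 0 → MvPolynomial.aeval x V = 0 → x = 0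

section Endo

variable {F Qbar : Type*} [Field F] [Field Qbar] [Algebra F Qbar] {d : ℕ}

/-- The action of an endomorphism on `ℙ¹(Qbar)`. -/
noncomputable def Endo.toFun (f : Endo F Qbar d) (P : P1 Qbar) : P1 Qbar :=
  Projectivization.mk Qbar
    (evalPair (f.U.map (algebraMap F Qbar)) (f.V.map (algebraMap F Qbar)) P.rep)
    (fun h => P.rep_nonzero (f.eq_zero_of_common_zero _
      (by simpa [evalPair, MvPolynomial.eval_map, MvPolynomial.aeval_def] using congrFun h 0)
      (by simpa [evalPair, MvPolynomial.eval_map, MvPolynomial.aeval_def] using congrFun h 1)))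

/-- The normalized height `ĥ(P) = lim d⁻ⁿ h(fⁿ(P))` of `f`. -/
noncomputable def Endo.normalizedHeight [CharZero Qbar] [Algebra.IsAlgebraic ℚ Qbar]
    (f : Endo F Qbar d) (P : P1 Qbar) : ℝ :=
  limUnder atTop fun n : ℕ => height (f.toFun^[n] P) / (d : ℝ) ^ n

/-- The characteristic property of the normalized height of `f`: it is a height relative to `𝒪(1)`
which is multiplied by `d` under `f`. -/
def Endo.IsNormalizedHeight [CharZero Qbar] [Algebra.IsAlgebraic ℚ Qbar]
    (f : Endo F Qbar d) (hhat : P1 Qbar → ℝ) : Prop :=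
  (∃ C : ℝ, ∀ P, |hhat P - height P| ≤ C) ∧ ∀ P, hhat (f.toFun P) = d * hhat P

variable (F) in
/-- The set of conjugates of `P` over `F`; if `Qbar` is an algebraic closure of `F` (perfect), its
cardinality is the degree of `P` over `F`. -/
def conjugates (P : P1 Qbar) : Set (P1 Qbar) :=
  Set.range fun g : Qbar ≃ₐ[F] Qbar => P1.map (g : Qbar →+* Qbar) P

variable [NumberField F]

/-- The Green function `G_v` of `f` on pairs of points of `ℙ¹(ℂ_v)`, with respect to an embedding of
`Qbar` in `ℂ_v` inducing the place `v` on `F`. -/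
noncomputable def Endo.green (f : Endo F Qbar d) {v : Place F} (τ : v.Embedding Qbar)
    (P₁ P₂ : P1 v.C) : ℝ :=
  greenDiag d (f.U.map (τ.1.comp (algebraMap F Qbar))) (f.V.map (τ.1.comp (algebraMap F Qbar)))
    P₁ P₂

/-- The `v`-adic discrepancy `D_v(P) = (n (n - 1))⁻¹ ∑_{i ≠ j} G_v(P_i, P_j)`, where `P_1, …, P_n` are
the conjugates of `P` over `F`, seen in `ℙ¹(ℂ_v)`. It is meaningful for `n ≥ 2`, that is, when `P` is
not in `ℙ¹(F)`. -/
noncomputable def Endo.discrepancy (f : Endo F Qbar d) {v : Place F} (τ : v.Embedding Qbar)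
    (P : P1 Qbar) : ℝ :=
  1 / (((conjugates F P).ncard : ℝ) * (((conjugates F P).ncard : ℝ) - 1)) *
    ∑ᶠ z ∈ (conjugates F P).offDiag, f.green τ (P1.map τ.1 z.1) (P1.map τ.1 z.2)

end Endo

end ArithDyn

namespace ArithDyn

/-! ### The fields `ℂ_v` -/

namespace RatPlace

/-! Places are replaced by embeddings. Exactly `ε_v` embeddings of `F` in `ℂ_v` induce `v`, so a sum
over places with weights `ε_v` is a sum over all embeddings of `F` in `ℂ` and in the `ℂ_p`
(`embSum`). In an extension of number fields such sums are multiplied by the degree, they satisfy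
the product formula (`embSum_log_norm`), and they compute the Weil height (`logHeight_eq_embSum`).
Tate's telescoping, with local errors that vanish at almost all places, then writes the normalized
height as a normalized sum of local functions `Λ` (`Endo.normalizedHeight_mk`).

For (1), sum `G(P_i, P_j)` over all embeddings of a number field that contains the coordinates. By
the product formula the terms in `x₁ y₂ - x₂ y₁` and in the resultant disappear, and what remains is
the sum of the normalized heights of `P_i` and `P_j` (`localPair_sum`), which are equal. The sum
over all pairs of conjugates is Galois invariant, hence depends only on the place induced on `F`;
this permits the descent to `F` (`Endo.exists_greenSum_descent`).

For (2), Northcott's theorem (`finite_setOf_height_le`) forces the degrees to infinity. Baker's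
lower bound (`exists_sum_greenDiag_ge`) then makes the limit inferior of each discrepancy
nonnegative, while at places of good reduction discrepancies are nonnegative outright. The weighted
sum of the discrepancies tends to `0` by (1), only a fixed finite set of terms can be negative, and
these are small. Hence every term tends to `0`.

Baker's bound comes from a determinant. For `n = d ^ k` there are `n` binary forms of degree `n -
1`, products of monomials of degree `d - 1` in the iterates of index `i < k`
(`exists_adapted_forms`). The determinant of their values at `n` points is, in absolute value, a
power of the resultant times a Vandermonde product of the terms `x_i y_j - x_j y_i`. The logarithm
of the row at `z_i` is at most `(n - 1) Λ(z_i) + O(k)`, and the exponent of the resultant agrees to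
leading order with the constant `1 / (d (d - 1))` of the Green function. So the sum over pairs is at
least `-O(k n)`, which is negligible against `n ^ 2`. Averaging over subsets extends this to all
larger sets (`sum_offDiag_ge_of_card`). -/

instance instCharZeroC : (q : RatPlace) → CharZero q.C
  | .infinite => inferInstanceAs (CharZero ℂ)
  | .finite p => haveI : Fact (p : ℕ).Prime := ⟨p.2⟩; inferInstanceAs (CharZero (PadicComplex p))

instance instIsAlgClosedC : (q : RatPlace) → IsAlgClosed q.C
  | .infinite => inferInstanceAs (IsAlgClosed ℂ)
  | .finite p => haveI : Fact (p : ℕ).Prime := ⟨p.2⟩; inferInstanceAs (IsAlgClosed (PadicComplex p))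

instance instIsUltrametricDistC (p : Nat.Primes) : IsUltrametricDist (RatPlace.finite p).C :=
  have : Fact (p : ℕ).Prime := ⟨p.2⟩
  IsUltrametricDist.isUltrametricDist_of_forall_norm_add_le_max_norm fun x y =>
    PadicComplex.isNonarchimedean p x y

lemma infinite_abv (r : ℚ) : RatPlace.infinite.abv r = |(r : ℝ)| := by
  simp [RatPlace.abv, Rat.AbsoluteValue.real_eq_abs]

lemma finite_abv (p : Nat.Primes) (r : ℚ) : (RatPlace.finite p).abv r = padicNorm p r := by
  have : Fact (p : ℕ).Prime := ⟨p.2⟩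
  simp [RatPlace.abv, Rat.AbsoluteValue.padic_eq_padicNorm]

lemma norm_ratCast (q : RatPlace) (r : ℚ) : ‖(r : q.C)‖ = q.abv r := by
  cases q with
  | infinite =>
    rw [infinite_abv]
    exact Complex.norm_ratCast r
  | finite p =>
    have : Fact (p : ℕ).Prime := ⟨p.2⟩
    have h : ‖(r : PadicComplex p)‖ = padicNorm p r := by
      have h1 : (r : PadicComplex p) = algebraMap ℚ_[p] (PadicComplex p) (r : ℚ_[p]) := by simp
      rw [h1, ← Padic.eq_padicNorm]
      exact PadicComplex.norm_extends' p _
    rw [finite_abv]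
    exact h

lemma finite_injective : Function.Injective RatPlace.finite := fun _ _ h => by cases h; rfl

/-- A property of all but finitely many primes is a property of all but finitely many places
of `ℚ`. -/
lemma eventually_cofinite_of_finite {Q : RatPlace → Prop} (s : Set Nat.Primes) (hs : s.Finite)
    (h : ∀ p ∉ s, Q (.finite p)) : ∀ᶠ q in cofinite, Q q := by
  refine Set.Finite.subset ((hs.image RatPlace.finite).insert .infinite) fun q hq => ?_
  cases q with
  | infinite => simp
  | finite p =>
    right
    by_contra hp
    exact hq (h p fun hps => hp ⟨p, hps, rfl⟩)

lemma finite_primes_dvd {n : ℕ} (hn : n ≠ 0) : {p : Nat.Primes | (p : ℕ) ∣ n}.Finite := by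
  refine Set.Finite.of_finite_image (f := fun p : Nat.Primes => (p : ℕ))
    ((n.divisors.finite_toSet).subset ?_) (fun _ _ _ _ h => Subtype.ext h)
  rintro _ ⟨p, hp, rfl⟩
  simpa using ⟨hp, hn⟩

end RatPlace

/-- If `‖x‖ > 1`, the leading term of an integral equation strictly dominates the others. -/
lemma norm_le_one_of_isIntegral {K : Type*} [NormedField K] [IsUltrametricDist K] {x : K}
    (hx : IsIntegral ℤ x) : ‖x‖ ≤ 1 := by
  obtain ⟨f, hf, hfx⟩ := hx
  by_contra! h
  rw [Polynomial.eval₂_eq_sum_range, Finset.sum_range_succ, hf.coeff_natDegree] at hfx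
  have h1 : x ^ f.natDegree =
      -∑ i ∈ Finset.range f.natDegree, algebraMap ℤ K (f.coeff i) * x ^ i := by
    rw [eq_neg_iff_add_eq_zero, add_comm]; simpa using hfx
  rcases Nat.eq_zero_or_pos f.natDegree with h0 | h0
  · simp [h0] at h1
  have h2 : ‖x‖ ^ f.natDegree ≤ ‖x‖ ^ (f.natDegree - 1) := by
    rw [← norm_pow, h1, norm_neg]
    refine IsUltrametricDist.norm_sum_le_of_forall_le_of_nonneg (by positivity) fun i hi => ?_
    rw [norm_mul, norm_pow]
    have h3 : ‖algebraMap ℤ K (f.coeff i)‖ ≤ 1 := by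
      simpa using IsUltrametricDist.norm_intCast_le_one K (f.coeff i)
    calc _ ≤ 1 * ‖x‖ ^ i := by gcongr
      _ ≤ _ := by
        rw [one_mul]
        exact pow_le_pow_right₀ h.le (by have := Finset.mem_range.1 hi; omega)
  exact absurd h2 (not_le.2 (pow_lt_pow_right₀ h (by omega)))

section embeddings

variable {A : Type*} [Field A] [CharZero A] [Algebra.IsAlgebraic ℚ A]

/-- A nonzero integer multiple `n • α` is integral, and `n` is a unit away from its prime divisors.
The exceptional set is the same for all `σ`. -/
lemma eventually_norm_embedding_le_one (α : A) :
    ∀ᶠ q : RatPlace in cofinite, ∀ σ : A →+* q.C, ‖σ α‖ ≤ 1 := by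
  have halg : IsAlgebraic ℤ α :=
    (IsFractionRing.isAlgebraic_iff ℤ ℚ A).2 (Algebra.IsAlgebraic.isAlgebraic α)
  obtain ⟨n, hn, hint⟩ := halg.exists_integral_multiple
  refine RatPlace.eventually_cofinite_of_finite _
    (RatPlace.finite_primes_dvd (n := n.natAbs) (by simpa using hn)) fun p hp σ => ?_
  have : Fact (p : ℕ).Prime := ⟨p.2⟩
  have h1 : ‖σ (n • α)‖ ≤ 1 := by
    apply norm_le_one_of_isIntegral
    exact hint.map (σ.toIntAlgHom)
  have h2 : ‖(n : (RatPlace.finite p).C)‖ = 1 := by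
    have := RatPlace.norm_ratCast (.finite p) (n : ℚ)
    rw [Rat.cast_intCast] at this
    rw [this, RatPlace.finite_abv]
    norm_cast
    rw [padicNorm.int_eq_one_iff]
    intro h
    exact hp (Int.natCast_dvd.1 h)
  rw [zsmul_eq_mul, map_mul, map_intCast, norm_mul, h2, one_mul] at h1
  exact h1

lemma eventually_norm_embedding_eq_one {α : A} (hα : α ≠ 0) :
    ∀ᶠ q : RatPlace in cofinite, ∀ σ : A →+* q.C, ‖σ α‖ = 1 := by
  filter_upwards [eventually_norm_embedding_le_one α, eventually_norm_embedding_le_one α⁻¹]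
    with q h1 h2 σ
  have := h2 σ
  rw [map_inv₀, norm_inv] at this
  have h0 : 0 < ‖σ α‖ := by simpa using hα
  exact le_antisymm (h1 σ) ((inv_le_one₀ h0).1 this)

end embeddings

/-! ### Embeddings which induce the same place -/

section isometry

variable {F : Type*} [Field F] [NumberField F]

/-- For a primitive element `a` and a polynomial `m` over `ℚ`, the values of `m` at `σ a` and `σ' a`
have the same norm. By density this persists over `ℚ_p`, so `σ a` and `σ' a` have the same minimal
polynomial over `ℚ_p` and are conjugate. -/
lemma exists_algEquiv_padicAlgCl (p : ℕ) [Fact p.Prime] (σ σ' : F →+* PadicAlgCl p)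
    (h : ∀ x, ‖σ x‖ = ‖σ' x‖) :
    ∃ g : PadicAlgCl p ≃ₐ[ℚ_[p]] PadicAlgCl p, ∀ x, g (σ x) = σ' x := by
  obtain ⟨a, ha⟩ := Field.exists_primitive_element ℚ F
  have hval : ∀ m : Polynomial ℚ_[p], Polynomial.aeval (σ a) m = 0 →
      Polynomial.aeval (σ' a) m = 0 := by
    intro m hm
    -- evaluation at a rational approximation of the coefficients
    let ev (b : PadicAlgCl p) (c : ℕ → ℚ_[p]) : PadicAlgCl p :=
      ∑ i ∈ Finset.range (m.natDegree + 1), algebraMap ℚ_[p] (PadicAlgCl p) (c i) * b ^ i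
    have hev : ∀ b, Continuous (ev b) := fun b => by
      refine continuous_finsetSum _ fun i _ => ?_
      exact ((algebraMapCLM ℚ_[p] (PadicAlgCl p)).continuous.comp (continuous_apply i)).mul
        continuous_const
    have hm' : ∀ b, ev b m.coeff = Polynomial.aeval b m := fun b => by
      rw [Polynomial.aeval_eq_sum_range]
      exact Finset.sum_congr rfl fun i _ => (Algebra.smul_def _ _).symm
    -- Only the coefficients of index at most `m.natDegree` enter `ev`, but using all sequences
    -- allows the density of a product of dense maps.
    have hdense : Dense (Set.range fun (c : ℕ → ℚ) (i : ℕ) => ((c i : ℚ) : ℚ_[p])) :=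
      DenseRange.piMap (fun _ => Padic.denseRange_ratCast p)
    have heq : ∀ c, ‖ev (σ a) c‖ = ‖ev (σ' a) c‖ := by
      intro c
      refine hdense.induction (P := fun c => ‖ev (σ a) c‖ = ‖ev (σ' a) c‖) ?_ ?_ c
      · rintro _ ⟨c, rfl⟩
        have key : ∀ s : F →+* PadicAlgCl p, ev (s a) (fun i => ((c i : ℚ) : ℚ_[p])) =
            s (∑ i ∈ Finset.range (m.natDegree + 1), (c i : F) * a ^ i) := fun s => by
          simp [ev]
        dsimp only
        rw [key, key, h]
      · exact isClosed_eq (hev _).norm (hev _).norm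
    have := heq m.coeff
    rw [hm', hm', hm, norm_zero] at this
    exact norm_eq_zero.1 this.symm
  have hint : IsIntegral ℚ_[p] (σ a) := Algebra.IsIntegral.isIntegral _
  have hmin : minpoly ℚ_[p] (σ a) = minpoly ℚ_[p] (σ' a) :=
    minpoly.eq_of_irreducible_of_monic (minpoly.irreducible hint)
      (hval _ (minpoly.aeval _ _)) (minpoly.monic hint)
  obtain ⟨g, hg⟩ := (Normal.minpoly_eq_iff_mem_orbit (F := ℚ_[p]) (PadicAlgCl p)).1 hmin.symm
  refine ⟨g, fun x => ?_⟩
  have := AlgHom.ext_of_adjoin_eq_top (IntermediateField.adjoin_eq_top_iff.1 ha)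
    (φ₁ := ((g : PadicAlgCl p →+* PadicAlgCl p).comp σ).toRatAlgHom) (φ₂ := σ'.toRatAlgHom)
    (by rintro _ rfl; exact hg)
  exact DFunLike.congr_fun this x

/-- An embedding in `ℂ_p` of an algebraic extension of `ℚ` takes values in the algebraic closure
of `ℚ_p`. -/
lemma exists_padicAlgCl_lift {A : Type*} [Field A] [CharZero A] [Algebra.IsAlgebraic ℚ A] (p : ℕ)
    [Fact p.Prime] (τ : A →+* PadicComplex p) :
    ∃ τ₀ : A →+* PadicAlgCl p, ∀ x, algebraMap (PadicAlgCl p) (PadicComplex p) (τ₀ x) = τ x := by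
  have h : ∀ x, ∃ y, algebraMap (PadicAlgCl p) (PadicComplex p) y = τ x := by
    intro x
    have hint : IsIntegral ℚ x := Algebra.IsIntegral.isIntegral x
    have hx : Polynomial.aeval (τ x) (minpoly ℚ x) = 0 := by
      have := congrArg τ.toRatAlgHom (minpoly.aeval ℚ x)
      rw [map_zero, ← Polynomial.aeval_algHom_apply] at this
      exact this
    -- The minimal polynomial already splits over `PadicAlgCl p`, so it acquires no new root in
    -- `ℂ_p`.
    have hs : ((minpoly ℚ x).map (algebraMap ℚ (PadicAlgCl p))).Splits :=
      IsAlgClosed.splits _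
    have := hs.image_rootSet (algebraMap (PadicAlgCl p) (PadicComplex p)).toRatAlgHom
    have hmem : τ x ∈ (minpoly ℚ x).rootSet (PadicComplex p) :=
      Polynomial.mem_rootSet.2 ⟨minpoly.ne_zero hint, hx⟩
    rw [← this] at hmem
    obtain ⟨y, -, hy⟩ := hmem
    exact ⟨y, hy⟩
  choose t ht using h
  have inj := (algebraMap (PadicAlgCl p) (PadicComplex p)).injective
  exact ⟨{ toFun := t
           map_one' := inj (by simp [ht])
           map_zero' := inj (by simp [ht])
           map_mul' := fun x y => inj (by simp [ht])
           map_add' := fun x y => inj (by simp [ht]) }, ht⟩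

variable {Qbar : Type*} [Field Qbar] [CharZero Qbar] [Algebra.IsAlgebraic ℚ Qbar] [Algebra F Qbar]

/-- If `τ` and `σ` induce the same absolute value on `F`, they differ there by an isometric
automorphism: the identity or complex conjugation at infinity, an automorphism over `ℚ_p` at `p`.
Composing `τ` with it changes no norm. This is what makes the choice of the embedding of `Qbar`
harmless. -/
lemma exists_isometric_embedding (q : RatPlace) (σ : F →+* q.C) (τ : Qbar →+* q.C)
    (h : ∀ x, ‖τ (algebraMap F Qbar x)‖ = ‖σ x‖) :
    ∃ τ' : Qbar →+* q.C, (∀ x, τ' (algebraMap F Qbar x) = σ x) ∧ ∀ x, ‖τ' x‖ = ‖τ x‖ := by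
  cases q with
  | infinite =>
    let τc : Qbar →+* ℂ := τ
    let σc : F →+* ℂ := σ
    have h1 : NumberField.InfinitePlace.mk (τc.comp (algebraMap F Qbar)) =
        NumberField.InfinitePlace.mk σc := by
      ext x
      exact h x
    rcases NumberField.InfinitePlace.mk_eq_iff.1 h1 with h2 | h2
    · exact ⟨τ, fun x => DFunLike.congr_fun h2 x, fun x => rfl⟩
    · exact ⟨(starRingEnd ℂ).comp τc, fun x => DFunLike.congr_fun h2 x,
        fun x => Complex.norm_conj (τc x)⟩
  | finite p =>
    have : Fact (p : ℕ).Prime := ⟨p.2⟩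
    obtain ⟨τ₀, hτ₀⟩ := exists_padicAlgCl_lift p (A := Qbar) τ
    obtain ⟨σ₀, hσ₀⟩ := exists_padicAlgCl_lift p (A := F) σ
    have hn : ∀ y : PadicAlgCl p, ‖algebraMap (PadicAlgCl p) (PadicComplex p) y‖ = ‖y‖ :=
      PadicComplex.norm_extends p
    obtain ⟨g, hg⟩ := exists_algEquiv_padicAlgCl p (τ₀.comp (algebraMap F Qbar)) σ₀ (fun x => by
      rw [RingHom.comp_apply, ← hn, ← hn, hτ₀, hσ₀]
      exact h x)
    refine ⟨(algebraMap (PadicAlgCl p) (PadicComplex p)).comp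
      ((g : PadicAlgCl p →+* PadicAlgCl p).comp τ₀), fun x => ?_, fun x => ?_⟩
    · exact (congrArg _ (hg x)).trans (hσ₀ x)
    · have h3 : ‖g (τ₀ x)‖ = ‖τ₀ x‖ := (spectralNorm_eq_of_equiv g (τ₀ x)).symm
      have h4 : ‖algebraMap (PadicAlgCl p) (PadicComplex p) (g (τ₀ x))‖ =
          ‖(τ x : PadicComplex p)‖ := by
        rw [hn, h3, ← hn, hτ₀]
        rfl
      exact h4

end isometry

/-! ### Sums over the embeddings of a number field in the fields `ℂ_v` -/

/-- The sum of a function over all embeddings of `K` in the fields `ℂ` and `ℂ_p`. -/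
noncomputable def embSum (K : Type*) [Field K] [NumberField K]
    (φ : (q : RatPlace) → (K →+* q.C) → ℝ) : ℝ :=
  ∑ᶠ q : RatPlace, ∑ σ : K →+* q.C, φ q σ

/-- The function `φ` vanishes on the embeddings in `ℂ_p` for all but finitely many `p`. -/
def AlmostZero {K : Type*} [Field K] (φ : (q : RatPlace) → (K →+* q.C) → ℝ) : Prop :=
  ∀ᶠ q in cofinite, ∀ σ, φ q σ = 0

section embSum

variable {K : Type*} [Field K] [NumberField K] {φ ψ : (q : RatPlace) → (K →+* q.C) → ℝ}

lemma AlmostZero.finite_support (h : AlmostZero φ) :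
    (Function.support fun q : RatPlace => ∑ σ : K →+* q.C, φ q σ).Finite := by
  refine Set.Finite.subset h fun q hq hq' => hq ?_
  exact Finset.sum_eq_zero fun σ _ => hq' σ

omit [NumberField K] in
lemma AlmostZero.add (h : AlmostZero φ) (h' : AlmostZero ψ) :
    AlmostZero fun q σ => φ q σ + ψ q σ := by
  filter_upwards [h, h'] with q h1 h2 σ
  rw [h1, h2, add_zero]

omit [NumberField K] in
lemma AlmostZero.const_mul (h : AlmostZero φ) (c : ℝ) : AlmostZero fun q σ => c * φ q σ := by
  filter_upwards [h] with q h1 σ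
  rw [h1, mul_zero]

omit [NumberField K] in
lemma AlmostZero.sum {ι : Type*} (s : Finset ι) {φ : ι → (q : RatPlace) → (K →+* q.C) → ℝ}
    (h : ∀ i ∈ s, AlmostZero (φ i)) : AlmostZero fun q σ => ∑ i ∈ s, φ i q σ := by
  have := (Filter.eventually_all_finset s).2 h
  filter_upwards [this] with q h1 σ
  exact Finset.sum_eq_zero fun i hi => h1 i hi σ

lemma embSum_add (h : AlmostZero φ) (h' : AlmostZero ψ) :
    embSum K (fun q σ => φ q σ + ψ q σ) = embSum K φ + embSum K ψ := by
  rw [embSum, embSum, embSum, ← finsum_add_distrib h.finite_support h'.finite_support]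
  simp only [Finset.sum_add_distrib]

lemma embSum_const_mul (φ : (q : RatPlace) → (K →+* q.C) → ℝ) (c : ℝ) :
    embSum K (fun q σ => c * φ q σ) = c * embSum K φ := by
  simp only [embSum, ← Finset.mul_sum]
  exact (mul_finsum _ _).symm

lemma embSum_sum {ι : Type*} (s : Finset ι) {φ : ι → (q : RatPlace) → (K →+* q.C) → ℝ}
    (h : ∀ i ∈ s, AlmostZero (φ i)) :
    embSum K (fun q σ => ∑ i ∈ s, φ i q σ) = ∑ i ∈ s, embSum K (φ i) := by
  classical
  induction s using Finset.induction_on with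
  | empty => simp [embSum]
  | insert a s ha ih =>
    simp only [Finset.sum_insert ha]
    rw [embSum_add (h a (by simp)) (AlmostZero.sum s fun i hi => h i (by simp [hi])),
      ih fun i hi => h i (by simp [hi])]

lemma embSum_mono (h : AlmostZero φ) (h' : AlmostZero ψ) (hle : ∀ q σ, φ q σ ≤ ψ q σ) :
    embSum K φ ≤ embSum K ψ :=
  finsum_le_finsum' h.finite_support h'.finite_support fun q => Finset.sum_le_sum fun σ _ => hle q σ

lemma embSum_const (c : RatPlace → ℝ) :
    embSum K (fun q _ => c q) = Module.finrank ℚ K * ∑ᶠ q, c q := by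
  simp only [embSum, Finset.sum_const, Finset.card_univ, NumberField.Embeddings.card, nsmul_eq_mul]
  exact (mul_finsum _ _).symm

/-- Every embedding of `K` in an algebraically closed field of characteristic zero has exactly `[L :
K]` extensions to `L`. -/
lemma embSum_comp_algebraMap {L : Type*} [Field L] [NumberField L] [Algebra K L] :
    embSum L (fun q ρ => φ q (ρ.comp (algebraMap K L))) = Module.finrank K L * embSum K φ := by
  classical
  rw [embSum, embSum, mul_finsum]
  refine finsum_congr fun q => ?_
  rw [← Finset.sum_fiberwise_of_maps_to (s := Finset.univ) (t := Finset.univ)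
    (g := fun ρ : L →+* q.C => ρ.comp (algebraMap K L)) (fun _ _ => Finset.mem_univ _),
    Finset.mul_sum]
  refine Finset.sum_congr rfl fun σ _ => ?_
  rw [Finset.sum_congr rfl (g := fun _ => φ q σ)
    (fun ρ hρ => by rw [(Finset.mem_filter.1 hρ).2]), Finset.sum_const, nsmul_eq_mul]
  congr 2
  let : Algebra K q.C := σ.toAlgebra
  rw [← AlgHom.card_of_splits K L q.C fun x => IsAlgClosed.splits _, ← Fintype.card_coe]
  refine Fintype.card_congr
    ⟨fun ρ => ⟨ρ.1, fun x => DFunLike.congr_fun (Finset.mem_filter.1 ρ.2).2 x⟩,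
      fun ρ => ⟨ρ, Finset.mem_filter.2 ⟨Finset.mem_univ _, RingHom.ext fun x => ρ.commutes x⟩⟩,
      fun ρ => rfl, fun ρ => rfl⟩

lemma embSum_eq_add (h : AlmostZero φ) :
    embSum K φ = ∑ σ : K →+* RatPlace.infinite.C, φ .infinite σ +
      ∑ᶠ p : Nat.Primes, ∑ σ : K →+* (RatPlace.finite p).C, φ (.finite p) σ := by
  let e : Option Nat.Primes ≃ RatPlace :=
    ⟨fun o => o.elim .infinite .finite, fun q => q.casesOn none some,
      fun o => by cases o <;> rfl, fun q => by cases q <;> rfl⟩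
  rw [embSum, ← finsum_comp_equiv e, finsum_option]
  · rfl
  · exact Set.Finite.preimage (fun _ _ _ _ h => RatPlace.finite_injective h) h.finite_support

end embSum

/-! ### The product formula. -/

section productFormula

lemma log_padicNorm_finsum_nat {n : ℕ} (hn : n ≠ 0) :
    (∑ᶠ p : Nat.Primes, Real.log ((RatPlace.finite p).abv n)) = -Real.log n := by
  have h1 : ∀ p : Nat.Primes, Real.log ((RatPlace.finite p).abv n) =
      (fun p : ℕ => -(n.factorization p * Real.log p)) p := fun p => by
    have : Fact (p : ℕ).Prime := ⟨p.2⟩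
    rw [RatPlace.finite_abv, padicNorm.eq_zpow_of_nonzero (by exact_mod_cast hn)]
    simp [Nat.factorization_def n p.2]
  simp only [h1]
  rw [Real.log_nat_eq_sum_factorization, Finsupp.sum, ← Finset.sum_neg_distrib,
    ← finsum_mem_range (f := fun p : ℕ => -(n.factorization p * Real.log p))
      (g := fun p : Nat.Primes => (p : ℕ)) (fun _ _ h => Subtype.ext h)]
  rw [finsum_mem_eq_sum_of_inter_support_eq (t := n.factorization.support)]
  ext p
  simp only [Set.mem_inter_iff, Set.mem_range, Function.mem_support, Finset.mem_coe,
    Finsupp.mem_support_iff]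
  constructor
  · rintro ⟨⟨p, rfl⟩, h⟩
    refine ⟨fun h0 => h (by simp [h0]), h⟩
  · rintro ⟨h0, h⟩
    refine ⟨⟨⟨p, ?_⟩, rfl⟩, h⟩
    by_contra hp
    exact h0 (Nat.factorization_eq_zero_of_not_prime _ hp)

lemma eventually_abv_eq_one {r : ℚ} (hr : r ≠ 0) : ∀ᶠ q : RatPlace in cofinite, q.abv r = 1 := by
  filter_upwards [eventually_norm_embedding_eq_one hr] with q h
  simpa [RatPlace.norm_ratCast] using h (algebraMap ℚ q.C)

lemma log_abv_finsum {r : ℚ} (hr : r ≠ 0) :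
    (∑ᶠ p : Nat.Primes, Real.log ((RatPlace.finite p).abv r)) = -Real.log |(r : ℝ)| := by
  have hfin : ∀ {r : ℚ}, r ≠ 0 →
      (Function.support fun p : Nat.Primes => Real.log ((RatPlace.finite p).abv r)).Finite := by
    intro r hr
    refine Set.Finite.subset (Set.Finite.preimage (f := RatPlace.finite)
      (fun _ _ _ _ h => RatPlace.finite_injective h) (eventually_abv_eq_one hr)) fun p hp h => hp ?_
    have h : (RatPlace.finite p).abv r = 1 := h
    simp only [h, Real.log_one]
  have hnum : (r.num.natAbs : ℚ) ≠ 0 := by simpa using hr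
  have hden : (r.den : ℚ) ≠ 0 := by simp
  have h1 : ∀ p : Nat.Primes, Real.log ((RatPlace.finite p).abv r) =
      Real.log ((RatPlace.finite p).abv (r.num.natAbs : ℚ)) -
        Real.log ((RatPlace.finite p).abv (r.den : ℚ)) := fun p => by
    rw [← Real.log_div (by simpa using hr) (by simp), ← map_div₀]
    congr 1
    conv_lhs => rw [← Rat.num_div_den r]
    rw [map_div₀, map_div₀]
    congr 1
    rcases Int.natAbs_eq r.num with h | h
    · conv_lhs => rw [h]
      simp
    · conv_lhs => rw [h]
      simp
  simp only [h1]
  rw [finsum_sub_distrib (hfin hnum) (hfin hden), log_padicNorm_finsum_nat (by simpa using hr),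
    log_padicNorm_finsum_nat (by simp)]
  have h2 : |(r : ℝ)| = (r.num.natAbs : ℝ) / r.den := by
    conv_lhs => rw [← Rat.num_div_den r]
    rw [Rat.cast_div, abs_div]
    simp [Nat.cast_natAbs]
  rw [h2, Real.log_div (by simpa using hr) (by simp)]
  ring

variable {K : Type*} [Field K] [NumberField K]

lemma almostZero_log_norm (x : K) : AlmostZero fun q (σ : K →+* q.C) => Real.log ‖σ x‖ := by
  rcases eq_or_ne x 0 with rfl | hx
  · exact Eventually.of_forall fun q σ => by simp
  filter_upwards [eventually_norm_embedding_eq_one hx] with q h σ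
  rw [h, Real.log_one]

/-- The norm is the product of the conjugates; this reduces the product formula for `K` to that of
`ℚ`. -/
lemma sum_log_norm_embedding (q : RatPlace) {x : K} (hx : x ≠ 0) :
    ∑ σ : K →+* q.C, Real.log ‖σ x‖ = Real.log (q.abv (Algebra.norm ℚ x)) := by
  rw [← Real.log_prod (fun σ _ => by simpa using hx), ← norm_prod, ← RatPlace.norm_ratCast]
  have := Algebra.norm_eq_prod_embeddings ℚ q.C x
  rw [eq_ratCast] at this
  rw [this]
  congr 2
  exact Fintype.prod_equiv (RingHom.equivRatAlgHom K _) _ _ (by simp [RingHom.equivRatAlgHom])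

lemma finsum_log_norm_finite {x : K} (hx : x ≠ 0) :
    (∑ᶠ p : Nat.Primes, ∑ σ : K →+* (RatPlace.finite p).C, Real.log ‖σ x‖) =
      -Real.log |(Algebra.norm ℚ x : ℝ)| := by
  simp only [sum_log_norm_embedding _ hx]
  exact log_abv_finsum (by simpa using (Algebra.norm_ne_zero_iff (R := ℚ)).2 hx)

/-- The product formula. -/
lemma embSum_log_norm (x : K) : embSum K (fun _ σ => Real.log ‖σ x‖) = 0 := by
  rcases eq_or_ne x 0 with rfl | hx
  · simp [embSum]
  rw [embSum_eq_add (almostZero_log_norm x), finsum_log_norm_finite hx,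
    sum_log_norm_embedding _ hx, RatPlace.infinite_abv, add_neg_cancel]

end productFormula

/-! ### The logarithmic height as a sum over embeddings -/

section localHeight

lemma norm_fin_two {C : Type*} [SeminormedAddCommGroup C] (z : Fin 2 → C) :
    ‖z‖ = max ‖z 0‖ ‖z 1‖ := by
  refine le_antisymm ((pi_norm_le_iff_of_nonneg (by positivity)).2 fun i => ?_)
    (max_le (norm_le_pi_norm z 0) (norm_le_pi_norm z 1))
  fin_cases i <;> simp

lemma iSup_fin_two (g : Fin 2 → ℝ) : ⨆ i, g i = max (g 0) (g 1) := by
  refine le_antisymm (ciSup_le fun i => ?_) (max_le (le_ciSup (Set.finite_range g).bddAbove 0)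
    (le_ciSup (Set.finite_range g).bddAbove 1))
  fin_cases i <;> simp

variable {K : Type*} [Field K] [NumberField K]

open NumberField

/-- The absolute value on `K` induced by an embedding in a normed field. -/
noncomputable def embAbv {C : Type*} [NormedField C] (σ : K →+* C) : AbsoluteValue K ℝ where
  toFun x := ‖σ x‖
  map_mul' x y := by simp
  nonneg' x := norm_nonneg _
  eq_zero' x := by simp
  add_le' x y := by simpa using norm_add_le (σ x) (σ y)

/-- The integers `a` with `‖σ a‖ < 1` form a nonzero prime ideal. Its absolute value is equivalent
to that of `σ`, and equivalent absolute values are powers of each other. -/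
lemma exists_finitePlace (p : Nat.Primes) (σ : K →+* (RatPlace.finite p).C) :
    ∃ (w : FinitePlace K) (c : ℝ), 0 < c ∧ ∀ x, ‖σ x‖ = w x ^ c := by
  have hint : ∀ a : 𝓞 K, ‖σ a‖ ≤ 1 := fun a =>
    norm_le_one_of_isIntegral ((a.isIntegral_coe).map σ.toIntAlgHom)
  let P : Ideal (𝓞 K) :=
    { carrier := {a | ‖σ a‖ < 1}
      add_mem' := fun {a b} (ha : ‖σ a‖ < 1) (hb : ‖σ b‖ < 1) => by
        refine lt_of_le_of_lt ?_ (max_lt ha hb)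
        simpa using IsUltrametricDist.norm_add_le_max (σ a) (σ b)
      zero_mem' := by simp
      smul_mem' := fun a b hb => by
        have hb : ‖σ b‖ < 1 := hb
        change ‖σ (a • b : 𝓞 K)‖ < 1
        simp only [smul_eq_mul, map_mul, norm_mul]
        exact (mul_le_of_le_one_left (norm_nonneg _) (hint a)).trans_lt hb }
  have hmem : ∀ a, a ∈ P ↔ ‖σ a‖ < 1 := fun a => Iff.rfl
  have hprime : P.IsPrime := by
    refine ⟨fun h => ?_, fun {a b} hab => ?_⟩
    · have := (hmem 1).1 (h ▸ trivial)
      simp at this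
    · by_contra! h
      rw [hmem, hmem, not_lt, not_lt] at h
      rw [hmem] at hab
      simp only [map_mul, norm_mul] at hab
      exact absurd hab (not_lt.2 (one_le_mul_of_one_le_of_one_le h.1 h.2))
  have hp : ((p : ℕ) : 𝓞 K) ∈ P := by
    rw [hmem]
    have : Fact (p : ℕ).Prime := ⟨p.2⟩
    have h := RatPlace.norm_ratCast (.finite p) ((p : ℕ) : ℚ)
    rw [RatPlace.finite_abv, padicNorm.padicNorm_p_of_prime] at h
    simp only [map_natCast, Rat.cast_natCast] at h ⊢
    rw [h]
    push_cast
    exact inv_lt_one_of_one_lt₀ (by exact_mod_cast p.2.one_lt)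
  have hbot : P ≠ ⊥ := by
    intro h
    rw [h, Ideal.mem_bot] at hp
    exact p.2.ne_zero (by exact_mod_cast hp)
  let v : IsDedekindDomain.HeightOneSpectrum (𝓞 K) := ⟨P, hprime, hbot⟩
  let w : FinitePlace K := FinitePlace.mk v
  have hwlt : ∀ a : 𝓞 K, w a < 1 ↔ a ∈ P := fun a => FinitePlace.norm_lt_one_iff_mem K v a
  have hweq : ∀ a : 𝓞 K, w a = 1 ↔ a ∉ P := fun a => FinitePlace.norm_eq_one_iff_notMem K v a
  -- One inclusion of open unit balls suffices, `p` witnessing nontriviality. Up to inversion `x` is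
  -- a fraction of integers with denominator prime to `P`, and the inverted case contradicts `w x <
  -- 1`.
  have hequiv : w.val.IsEquiv (embAbv σ) := by
    refine AbsoluteValue.isEquiv_of_lt_one_imp ⟨((p : ℕ) : 𝓞 K), ?_, ?_⟩ fun x hx => ?_
    · simpa using p.2.ne_zero
    · exact ((hwlt _).2 hp).ne
    · have hx : w x < 1 := hx
      change ‖σ x‖ < 1
      obtain ⟨n, ⟨d, hd⟩, h | h⟩ := v.exists_primeCompl_mul_eq_or_mul_eq x
      · have hd' : d ∉ P := hd
        have h1 := congrArg w h
        rw [map_mul, (hweq d).2 hd', mul_one] at h1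
        have h2 : ‖σ n‖ < 1 := (hmem n).1 ((hwlt n).1 (h1 ▸ hx))
        have h3 := congrArg (fun y => ‖σ y‖) h
        rw [hmem, not_lt] at hd'
        simp only [map_mul, norm_mul] at h3
        have h4 : ‖σ d‖ = 1 := le_antisymm (hint d) hd'
        have h5 : ‖σ x‖ * ‖σ d‖ = ‖σ n‖ := h3
        rw [h4, mul_one] at h5
        rw [h5]
        exact h2
      · have hd' : d ∉ P := hd
        have h1 := congrArg w h
        have h2 : w (algebraMap (𝓞 K) K d) = 1 := (hweq d).2 hd'
        have h3 : w (algebraMap (𝓞 K) K n) ≤ 1 := FinitePlace.norm_le_one K v n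
        rw [map_mul, h2] at h1
        have : w x * w (algebraMap (𝓞 K) K n) < 1 :=
          (mul_le_of_le_one_right (apply_nonneg w x) h3).trans_lt hx
        exact absurd h1 this.ne
  obtain ⟨c, hc0, hc⟩ := AbsoluteValue.isEquiv_iff_exists_rpow_eq.1 hequiv
  exact ⟨w, c, hc0, fun x => (congrFun hc x).symm⟩

/-- A power of the prime ideal is principal because the class group is finite; a generator is a unit
at all other primes. Such an element isolates one place in the product formula. -/
lemma exists_generator_pow (w : FinitePlace K) :
    ∃ x : K, x ≠ 0 ∧ w x < 1 ∧ ∀ w' : FinitePlace K, w' ≠ w → w' x = 1 := by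
  let v := w.maximalIdeal
  let P := v.asIdeal
  have hP : P ∈ nonZeroDivisors (Ideal (𝓞 K)) := mem_nonZeroDivisors_of_ne_zero v.ne_bot
  have h1 : ClassGroup.mk0 (⟨P, hP⟩ ^ Fintype.card (ClassGroup (𝓞 K))) = 1 := by
    rw [map_pow, pow_card_eq_one]
  rw [ClassGroup.mk0_eq_one_iff] at h1
  obtain ⟨x, hx⟩ := h1
  set h := Fintype.card (ClassGroup (𝓞 K))
  have hh : h ≠ 0 := Fintype.card_ne_zero
  have hx : P ^ h = Ideal.span {x} := hx
  have hx0 : x ≠ 0 := by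
    rintro rfl
    rw [Ideal.span_singleton_eq_bot.2 rfl] at hx
    exact v.ne_bot (pow_eq_zero_iff hh |>.1 hx)
  have hwx : ∀ w' : FinitePlace K, ∀ a, w' a = ‖FinitePlace.embedding w'.maximalIdeal a‖ :=
    fun w' a => (FinitePlace.norm_embedding_eq w' a).symm
  have hxP : x ∈ P := Ideal.pow_le_self hh (hx ▸ Ideal.mem_span_singleton_self x)
  refine ⟨x, by simpa using hx0, ?_, fun w' hw' => ?_⟩
  · rw [hwx]
    exact (FinitePlace.norm_lt_one_iff_mem K v x).2 hxP
  · rw [hwx]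
    refine (FinitePlace.norm_eq_one_iff_notMem K w'.maximalIdeal x).2 fun hmem => hw' ?_
    have h2 : P ^ h ≤ w'.maximalIdeal.asIdeal := by
      rw [hx, Ideal.span_singleton_le_iff_mem]
      exact hmem
    have h3 : P ≤ w'.maximalIdeal.asIdeal := w'.maximalIdeal.isPrime.le_of_pow_le h2
    have h4 := v.isMaximal.eq_of_le w'.maximalIdeal.isPrime.ne_top h3
    exact FinitePlace.maximalIdeal_injective
      (IsDedekindDomain.HeightOneSpectrum.ext h4.symm)

lemma log_finprod {ι : Type*} {g : ι → ℝ} (hg : ∀ i, 0 < g i) (hf : g.HasFiniteMulSupport) :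
    Real.log (∏ᶠ i, g i) = ∑ᶠ i, Real.log (g i) := by
  rw [finprod_eq_prod g hf, Real.log_prod fun i _ => (hg i).ne']
  symm
  refine finsum_eq_sum_of_support_subset _ fun i hi => ?_
  refine Finset.mem_coe.2 ((Set.Finite.mem_toFinset hf).2 fun h => ?_)
  simp [h] at hi

/-- Every finite place of `K` is accounted for exactly once by the embeddings of `K` in the
fields `ℂ_p`. -/
lemma exists_finitePlace_weights :
    ∃ (w : (p : Nat.Primes) → (K →+* (RatPlace.finite p).C) → FinitePlace K)
      (c : (p : Nat.Primes) → (K →+* (RatPlace.finite p).C) → ℝ),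
      (∀ p σ, 0 < c p σ) ∧ (∀ p σ x, ‖σ x‖ = w p σ x ^ c p σ) ∧
      ∀ m : FinitePlace K → ℝ, (Function.support m).Finite →
        ∑ᶠ p, ∑ σ, c p σ * m (w p σ) = ∑ᶠ v, m v := by
  classical
  choose w c hc hwc using exists_finitePlace (K := K)
  refine ⟨w, c, hc, hwc, fun m hm => ?_⟩
  -- The exponents `c` of the embeddings above `v` add up to `1`: compare, for an `x` supported at
  -- `v` only, the product formula over embeddings with the one over normalized finite places.
  have key : ∀ v : FinitePlace K,
      (Function.support fun p => ∑ σ, if w p σ = v then c p σ else 0).Finite ∧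
      ∑ᶠ p, ∑ σ, (if w p σ = v then c p σ else 0) = 1 := by
    intro v
    obtain ⟨x, hx0, hx1, hx⟩ := exists_generator_pow v
    have hvpos : 0 < v x := FinitePlace.pos_iff.2 hx0
    have hlog : Real.log (v x) ≠ 0 := (Real.log_neg hvpos hx1).ne
    have h1 : ∀ p, ∑ σ : K →+* (RatPlace.finite p).C, Real.log ‖σ x‖ =
        (∑ σ, if w p σ = v then c p σ else 0) * Real.log (v x) := by
      intro p
      rw [Finset.sum_mul]
      refine Finset.sum_congr rfl fun σ _ => ?_
      rw [hwc p σ x, Real.log_rpow (FinitePlace.pos_iff.2 hx0)]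
      split_ifs with h
      · rw [h]
      · rw [hx _ h, Real.log_one, mul_zero, zero_mul]
    have h2 := finsum_log_norm_finite hx0
    simp only [h1] at h2
    rw [← finsum_mul] at h2
    have h3 := FinitePlace.prod_eq_inv_abs_norm hx0
    rw [finprod_eq_single _ v hx] at h3
    have h4 : Real.log (v x) = -Real.log |(Algebra.norm ℚ x : ℝ)| := by
      rw [h3, ← Real.log_inv]
      push_cast
      rfl
    refine ⟨?_, ?_⟩
    · refine Set.Finite.subset (Set.Finite.preimage (f := RatPlace.finite)
        (fun _ _ _ _ h => RatPlace.finite_injective h)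
        (almostZero_log_norm x).finite_support) fun p hp hp' => hp ?_
      have := (h1 p).symm.trans hp'
      exact (mul_eq_zero.1 this).resolve_right hlog
    · rw [← h4] at h2
      exact mul_right_cancel₀ hlog (by rw [h2, one_mul])
  have h5 : ∀ p, ∑ σ, c p σ * m (w p σ) =
      ∑ v ∈ hm.toFinset, m v * ∑ σ, (if w p σ = v then c p σ else 0) := by
    intro p
    simp only [Finset.mul_sum]
    rw [Finset.sum_comm]
    refine Finset.sum_congr rfl fun σ _ => ?_
    simp only [mul_ite, mul_zero]
    rw [Finset.sum_ite_eq]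
    split_ifs with h
    · rw [mul_comm]
    · have : m (w p σ) = 0 := by simpa using h
      rw [this, mul_zero]
  simp only [h5]
  rw [finsum_sum_comm]
  · simp only [← mul_finsum, (key _).2, mul_one]
    exact (finsum_eq_sum _ hm).symm
  · intro v _
    exact (key v).1.subset fun p hp h => hp (by simp [h])

lemma sum_infinitePlace_mult (g : InfinitePlace K → ℝ) :
    ∑ v : InfinitePlace K, v.mult * g v = ∑ φ : K →+* ℂ, g (InfinitePlace.mk φ) := by
  classical
  rw [← Finset.sum_fiberwise_of_maps_to (s := Finset.univ) (t := Finset.univ)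
    (g := fun φ : K →+* ℂ => InfinitePlace.mk φ) (fun _ _ => Finset.mem_univ _)]
  refine Finset.sum_congr rfl fun v _ => ?_
  rw [Finset.sum_congr rfl (g := fun _ => g v)
    (fun φ hφ => by rw [(Finset.mem_filter.1 hφ).2]), Finset.sum_const, nsmul_eq_mul,
    InfinitePlace.card_filter_mk_eq]

-- At almost all places both coordinates are integral and a fixed nonzero one is a unit.
omit [NumberField K] in
lemma almostZero_log_norm_pair [CharZero K] [Algebra.IsAlgebraic ℚ K] {x : Fin 2 → K} (hx : x ≠ 0) :
    AlmostZero fun q (σ : K →+* q.C) => Real.log ‖fun i => σ (x i)‖ := by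
  obtain ⟨j, hj⟩ := Function.ne_iff.1 hx
  filter_upwards [eventually_norm_embedding_le_one (x 0), eventually_norm_embedding_le_one (x 1),
    eventually_norm_embedding_eq_one hj] with q h0 h1 h2 σ
  have : ‖fun i => σ (x i)‖ = 1 := by
    refine le_antisymm ?_ ?_
    · rw [norm_fin_two]
      exact max_le (h0 σ) (h1 σ)
    · rw [← h2 σ]
      exact norm_le_pi_norm (fun i => σ (x i)) j
  rw [this, Real.log_one]

/-- At infinity the multiplicity of a place counts its embeddings; at finite places the weights of
`exists_finitePlace_weights` play this role. -/
lemma logHeight_eq_embSum {x : Fin 2 → K} (hx : x ≠ 0) :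
    Height.logHeight x = embSum K fun _ σ => Real.log ‖fun i => σ (x i)‖ := by
  have hpos : ∀ (v : AbsoluteValue K ℝ), 0 < ⨆ i, v (x i) := fun v => by
    obtain ⟨j, hj⟩ := Function.ne_iff.1 hx
    exact (v.pos hj).trans_le (le_ciSup (Set.finite_range fun i => v (x i)).bddAbove j)
  have hfin : (fun v : FinitePlace K => ⨆ i, v (x i)).HasFiniteMulSupport := by
    simp only [iSup_fin_two]
    by_cases h0 : x 0 = 0
    · have h1 : x 1 ≠ 0 := fun h1 => hx (by ext i; fin_cases i <;> simp [h0, h1])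
      refine (FinitePlace.hasFiniteMulSupport h1).subset fun v hv h => hv ?_
      simp [h0, h]
    by_cases h1 : x 1 = 0
    · refine (FinitePlace.hasFiniteMulSupport h0).subset fun v hv h => hv ?_
      simp [h1, h]
    refine ((FinitePlace.hasFiniteMulSupport h0).union
      (FinitePlace.hasFiniteMulSupport h1)).subset fun v hv => ?_
    by_contra h
    simp only [Set.mem_union, Function.mem_mulSupport, not_or, not_not] at h
    exact hv (by simp [h.1, h.2])
  rw [Height.logHeight_eq_log_mulHeight, mulHeight_eq hx, Real.log_mul, Real.log_prod,
    log_finprod (g := fun v : FinitePlace K => ⨆ i, v (x i)) (fun v => hpos v.val) hfin,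
    embSum_eq_add (almostZero_log_norm_pair hx)]
  rotate_left
  · exact fun v _ => pow_ne_zero _ (hpos v.val).ne'
  · exact Finset.prod_ne_zero_iff.2 fun v _ => pow_ne_zero _ (hpos v.val).ne'
  · exact (finprod_induction (fun y : ℝ => 0 < y) one_pos (fun _ _ => mul_pos)
      fun v : FinitePlace K => hpos v.val).ne'
  congr 1
  · simp only [Real.log_pow]
    rw [sum_infinitePlace_mult fun v => Real.log (⨆ i, v (x i))]
    refine Finset.sum_congr rfl fun φ _ => ?_
    rw [iSup_fin_two, norm_fin_two]
    rfl
  · obtain ⟨w, c, hc, hwc, hsum⟩ := exists_finitePlace_weights (K := K)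
    rw [← hsum]
    · refine finsum_congr fun p => Finset.sum_congr rfl fun σ _ => ?_
      have hp : 0 < ⨆ i, w p σ (x i) := hpos (w p σ).val
      rw [norm_fin_two, hwc, hwc, ← Real.log_rpow hp, iSup_fin_two]
      have h0 := apply_nonneg (w p σ) (x 0)
      have h1 := apply_nonneg (w p σ) (x 1)
      congr 1
      rcases le_total (w p σ (x 0)) (w p σ (x 1)) with h | h
      · rw [max_eq_right h, max_eq_right (Real.rpow_le_rpow h0 h (hc p σ).le)]
      · rw [max_eq_left h, max_eq_left (Real.rpow_le_rpow h1 h (hc p σ).le)]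
    · refine hfin.subset fun v hv h => hv ?_
      have h : ⨆ i, v (x i) = 1 := h
      simp only [h, Real.log_one]

end localHeight

/-! ### Binary forms and resultants -/

section forms

variable {K : Type*} [Field K]

/-- The monomial `x ^ c * y ^ (n - 1 - c)` at the point `z = (x, y)`. -/
def formMon (n : ℕ) (z : Fin 2 → K) (c : Fin n) : K := z 0 ^ (c : ℕ) * z 1 ^ (c.rev : ℕ)

/-- The value at `z` of the binary form of degree `n` which corresponds to the polynomial `p`. -/
noncomputable def formEval (n : ℕ) (p : Polynomial K) (z : Fin 2 → K) : K :=
  MvPolynomial.eval z (p.homogenize n)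

lemma formEval_eq_sum (n : ℕ) (p : Polynomial K) (z : Fin 2 → K) :
    formEval n p z = ∑ i ∈ Finset.range (n + 1), p.coeff i * (z 0 ^ i * z 1 ^ (n - i)) := by
  rw [formEval, Polynomial.homogenize, map_sum,
    Finset.Nat.sum_antidiagonal_eq_sum_range_succ_mk]
  refine Finset.sum_congr rfl fun i _ => ?_
  rw [MvPolynomial.eval_monomial, Finsupp.prod_fintype _ _ (by simp), Fin.prod_univ_two]
  simp

lemma formEval_mul {p q : Polynomial K} {m n : ℕ} (hm : p.natDegree ≤ m) (hn : q.natDegree ≤ n)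
    (z : Fin 2 → K) : formEval (m + n) (p * q) z = formEval m p z * formEval n q z := by
  rw [formEval, Polynomial.homogenize_mul p q hm hn, map_mul, formEval, formEval]

lemma formEval_pow {p : Polynomial K} {m : ℕ} (hm : p.natDegree ≤ m) (N : ℕ) (z : Fin 2 → K) :
    formEval (m * N) (p ^ N) z = formEval m p z ^ N := by
  induction N with
  | zero => simp [formEval]
  | succ N ih =>
    rw [pow_succ, pow_succ, mul_add, mul_one, formEval_mul _ hm, ih]
    exact (Polynomial.natDegree_pow_le_of_le N hm).trans (mul_comm _ _).le

/-- The dehomogenization of a polynomial in two variables. -/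
noncomputable def dehom (U : MvPolynomial (Fin 2) K) : Polynomial K :=
  MvPolynomial.aeval ![Polynomial.X, 1] U

lemma formEval_dehom {d : ℕ} {U : MvPolynomial (Fin 2) K} (hU : U.IsHomogeneous d)
    (z : Fin 2 → K) : formEval d (dehom U) z = MvPolynomial.eval z U := by
  rw [formEval, Polynomial.homogenize_eq_of_isHomogeneous hU (p := dehom U) rfl]

lemma natDegree_dehom_le {d : ℕ} {U : MvPolynomial (Fin 2) K} (hU : U.IsHomogeneous d) :
    (dehom U).natDegree ≤ d := by
  rw [dehom, U.as_sum, map_sum]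
  refine Polynomial.natDegree_sum_le_of_forall_le _ _ fun m hm => ?_
  rw [MvPolynomial.aeval_monomial, Finsupp.prod_fintype _ _ (by simp), Fin.prod_univ_two]
  have h : m.weight 1 = d := hU (by simpa using hm)
  have h' : m 0 ≤ d := by
    rw [← h]
    simp [Finsupp.weight_apply, Finsupp.sum_fintype, Fin.sum_univ_two]
  simp only [Matrix.cons_val_zero, Matrix.cons_val_one, one_pow, mul_one]
  exact (Polynomial.natDegree_C_mul_X_pow_le _ _).trans h'

/-- Raising the formal degree of the left argument by `k` multiplies the resultant by the `k`-th
power of a factor depending only on `g` and `n`, so the case of exact degrees suffices. For a zero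
factor `n ≠ 0` is needed. -/
lemma resultant_mul_left_of_le {f₁ f₂ g : Polynomial K} {m₁ m₂ n : ℕ} (hn : n ≠ 0)
    (h₁ : f₁.natDegree ≤ m₁) (h₂ : f₂.natDegree ≤ m₂) (hg : g.natDegree ≤ n) :
    Polynomial.resultant (f₁ * f₂) g (m₁ + m₂) n =
      Polynomial.resultant f₁ g m₁ n * Polynomial.resultant f₂ g m₂ n := by
  rcases eq_or_ne f₁ 0 with rfl | hf₁
  · rw [zero_mul, Polynomial.resultant_zero_left, Polynomial.resultant_zero_left]
    simp [hn]
  rcases eq_or_ne f₂ 0 with rfl | hf₂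
  · rw [mul_zero, Polynomial.resultant_zero_left, Polynomial.resultant_zero_left]
    simp [hn]
  obtain ⟨k₁, rfl⟩ := Nat.exists_eq_add_of_le h₁
  obtain ⟨k₂, rfl⟩ := Nat.exists_eq_add_of_le h₂
  have h := Polynomial.resultant_mul_left f₁ f₂ g n hg
  rw [show f₁.natDegree + k₁ + (f₂.natDegree + k₂) = f₁.natDegree + f₂.natDegree + (k₁ + k₂) by ring,
    Polynomial.resultant_add_left_deg _ _ _ _ _ (Polynomial.natDegree_mul_le), h,
    Polynomial.resultant_add_left_deg _ _ _ _ _ le_rfl,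
    Polynomial.resultant_add_left_deg _ _ _ _ _ le_rfl]
  ring

lemma resultant_pow_left_of_le {f g : Polynomial K} {m n : ℕ} (hn : n ≠ 0)
    (hf : f.natDegree ≤ m) (hg : g.natDegree ≤ n) (N : ℕ) :
    Polynomial.resultant (f ^ N) g (m * N) n = Polynomial.resultant f g m n ^ N := by
  induction N with
  | zero => simp
  | succ N ih =>
    rw [pow_succ, pow_succ, mul_add, mul_one, resultant_mul_left_of_le hn _ hf hg, ih]
    exact (Polynomial.natDegree_pow_le_of_le N hf).trans (mul_comm _ _).le

/-- The rows of the Sylvester matrix are the coefficients of the products of `p` and `q` by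
monomials. -/
lemma sylvester_vecMul (p q : Polynomial K) (m n : ℕ) (z : Fin 2 → K) (j : Fin m ⊕ Fin n) :
    ∑ c, p.sylvester q m n c (finSumFinEquiv j) * formMon (m + n) z c =
      Sum.elim (fun a => formMon m z a * formEval n q z)
        (fun b => formMon n z b * formEval m p z) j := by
  -- Coefficients of `r` shifted by `a`, with all other entries zero, are those of `r` times a
  -- monomial. Every column of the Sylvester matrix has this shape.
  have key : ∀ (a n' : ℕ) (r : Polynomial K) (N : ℕ) (h : a + n' < N) ,
      ∑ c : Fin N, (if (c : ℕ) ∈ Set.Icc a (a + n') then r.coeff (c - a) else 0) * formMon N z c =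
        (z 0 ^ a * z 1 ^ (N - 1 - n' - a)) * formEval n' r z := by
    intro a n' r N h
    have h1 : ∀ c : Fin N, (if (c : ℕ) ∈ Set.Icc a (a + n') then r.coeff (c - a) else 0) *
        formMon N z c = (fun c : ℕ => (if c ∈ Set.Icc a (a + n') then r.coeff (c - a) else 0) *
          (z 0 ^ c * z 1 ^ (N - 1 - c))) c := fun c => by
      simp only [formMon, Fin.val_rev]
      congr 3
      omega
    rw [Fintype.sum_congr _ _ h1]
    refine (Fin.sum_univ_eq_sum_range (fun c : ℕ => (if c ∈ Set.Icc a (a + n')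
      then r.coeff (c - a) else 0) * (z 0 ^ c * z 1 ^ (N - 1 - c))) N).trans ?_
    rw [← Finset.sum_subset (s₁ := (Finset.range (n' + 1)).map (addLeftEmbedding a)),
      Finset.sum_map, formEval_eq_sum, Finset.mul_sum]
    · refine Finset.sum_congr rfl fun i hi => ?_
      rw [Finset.mem_range] at hi
      simp only [addLeftEmbedding_apply]
      rw [if_pos (by constructor <;> omega), Nat.add_sub_cancel_left,
        show N - 1 - (a + i) = (N - 1 - n' - a) + (n' - i) by omega, pow_add, pow_add]
      ring
    · intro i hi
      simp only [Finset.mem_map, Finset.mem_range, addLeftEmbedding_apply] at hi ⊢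
      omega
    · intro i _ hi
      simp only [Finset.mem_map, Finset.mem_range, addLeftEmbedding_apply, not_exists,
        not_and] at hi
      rw [if_neg, zero_mul]
      intro hi'
      exact hi (i - a) (by have := hi'.2; omega) (by have := hi'.1; omega)
  rcases j with a | b
  · have := key a n q (m + n) (by omega)
    simp only [Polynomial.sylvester, Matrix.of_apply, finSumFinEquiv_apply_left, Fin.addCases_left,
      Sum.elim_inl]
    rw [this, formMon, Fin.val_rev]
    congr 3
    omega
  · have := key b m p (m + n) (by omega)
    simp only [Polynomial.sylvester, Matrix.of_apply, finSumFinEquiv_apply_right,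
      Fin.addCases_right, Sum.elim_inr]
    rw [this, formMon, Fin.val_rev]
    congr 3
    omega

end forms

/-! ### Families of binary forms whose coefficient determinant is known -/

section frames

variable {K : Type*} [NormedField K]

/-- The `n` functions `g j` are binary forms of degree `n - 1`, and the determinant of the matrix
of their coefficients has absolute value `δ`. -/
def HasCoeffDet {ι : Type*} [Fintype ι] [DecidableEq ι] (n : ℕ) (g : ι → (Fin 2 → K) → K)
    (δ : ℝ) : Prop :=
  ∃ (B : Matrix ι (Fin n) K) (e : ι ≃ Fin n), ‖(B.submatrix id e).det‖ = δ ∧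
    ∀ z j, g j z = ∑ c, B j c * formMon n z c

section

variable {ι κ : Type*} [Fintype ι] [DecidableEq ι] [Fintype κ] [DecidableEq κ] {n : ℕ}
  {g : ι → (Fin 2 → K) → K} {δ : ℝ}

lemma HasCoeffDet.formMon (n : ℕ) : HasCoeffDet n (fun (c : Fin n) (z : Fin 2 → K) =>
    formMon n z c) 1 := by
  refine ⟨1, Equiv.refl _, by simp, fun z j => ?_⟩
  simp [Matrix.one_apply]

lemma HasCoeffDet.reindex (h : HasCoeffDet n g δ) (f : κ ≃ ι) :
    HasCoeffDet n (fun k => g (f k)) δ := by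
  obtain ⟨B, e, h1, h2⟩ := h
  refine ⟨B.submatrix f id, f.trans e, ?_, fun z j => h2 z (f j)⟩
  rw [← h1, ← Matrix.det_submatrix_equiv_self f (B.submatrix id e)]
  rfl

lemma HasCoeffDet.trans (h : HasCoeffDet n g δ) (A : Matrix κ ι K) (f : κ ≃ ι) :
    HasCoeffDet n (fun k z => ∑ i, A k i * g i z) (‖(A.submatrix id f).det‖ * δ) := by
  obtain ⟨B, e, h1, h2⟩ := h
  refine ⟨A * B, f.trans e, ?_, fun z k => ?_⟩
  · rw [← h1, ← norm_mul, ← Matrix.det_submatrix_equiv_self f (B.submatrix id e), ← Matrix.det_mul]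
    congr 2
    rw [Matrix.submatrix_submatrix]
    exact (Matrix.submatrix_mul_equiv A B id f (f.trans e)).symm
  · simp only [h2, Matrix.mul_apply, Finset.mul_sum, Finset.sum_mul]
    rw [Finset.sum_comm]
    simp only [mul_assoc]

lemma HasCoeffDet.congr (h : HasCoeffDet n g δ) {g' : ι → (Fin 2 → K) → K} {δ' : ℝ}
    (hg : ∀ i z, g' i z = g i z) (hδ : δ' = δ) : HasCoeffDet n g' δ' := by
  obtain rfl : g' = g := funext fun i => funext fun z => hg i z
  rwa [hδ]

end

lemma hasCoeffDet_sylvester (p q : Polynomial K) (m n : ℕ) :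
    HasCoeffDet (m + n) (Sum.elim (fun (a : Fin m) z => formMon m z a * formEval n q z)
      (fun (b : Fin n) z => formMon n z b * formEval m p z)) ‖Polynomial.resultant p q m n‖ := by
  refine ⟨(p.sylvester q m n).transpose.submatrix finSumFinEquiv id, finSumFinEquiv, ?_,
    fun z j => ?_⟩
  · rw [Matrix.submatrix_submatrix, Polynomial.resultant, ← Matrix.det_transpose,
      ← Matrix.det_submatrix_equiv_self finSumFinEquiv]
    rfl
  · have := sylvester_vecMul p q m n z j
    rw [Matrix.submatrix]
    simp only [Matrix.of_apply, Matrix.transpose_apply, id]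
    rw [this]
    cases j <;> rfl

variable {d : ℕ} {U V : MvPolynomial (Fin 2) K}

lemma homResultant_eq {K : Type*} [Field K] (d : ℕ) (U V : MvPolynomial (Fin 2) K) :
    homResultant d U V = Polynomial.resultant (dehom U) (dehom V) d d := rfl

/-- The forms `x ^ a y ^ (d - 1 - a) U ^ m V ^ (N - 1 - m)` of degree `d N - 1`. -/
lemma hasCoeffDet_powers (hd : d ≠ 0) (hU : U.IsHomogeneous d) (hV : V.IsHomogeneous d) (N : ℕ) :
    HasCoeffDet (d * N) (fun (j : Fin N × Fin d) z => formMon d z j.2 *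
      formMon N (evalPair U V z) j.1) (‖homResultant d U V‖ ^ (N * (N - 1) / 2)) := by
  induction N with
  | zero =>
    have : IsEmpty (Fin (d * 0)) := by rw [mul_zero]; infer_instance
    exact ⟨fun j => j.1.elim0, Equiv.equivOfIsEmpty _ _, by simp, fun z j => j.1.elim0⟩
  | succ N ih =>
    obtain ⟨B, e, h1, h2⟩ := ih
    -- The Sylvester matrix of `U ^ N` and `V` handles the products (monomial) `V` and (monomial) `U
    -- ^ N`. By induction the block `B` replaces the monomials of the first family by the forms of
    -- level `N`, and the resultant of `U ^ N` and `V` raises the exponent by `N`.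
    have hs := hasCoeffDet_sylvester (dehom U ^ N) (dehom V) (d * N) d
    have ht := (hs.trans (Matrix.fromBlocks B 0 0 (1 : Matrix (Fin d) (Fin d) K))
      (e.sumCongr (Equiv.refl _)))
    let f : Fin (N + 1) × Fin d ≃ (Fin N × Fin d) ⊕ Fin d :=
      ((finSumFinEquiv (m := N) (n := 1)).symm.prodCongr (Equiv.refl _)).trans
        ((Equiv.sumProdDistrib _ _ _).trans ((Equiv.refl _).sumCongr (Equiv.uniqueProd _ _)))
    have hf₁ : ∀ m a, f.symm (.inl (m, a)) = (Fin.castAdd 1 m, a) := fun m a => rfl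
    have hf₂ : ∀ a, f.symm (.inr a) = (Fin.last N, a) := fun a => rfl
    refine (ht.reindex f).congr (fun j z => ?_) ?_
    · obtain ⟨i, rfl⟩ := f.symm.surjective j
      rw [Equiv.apply_symm_apply]
      rcases i with ⟨m, a⟩ | a
      · rw [hf₁, Fintype.sum_sum_type]
        simp only [Matrix.fromBlocks_apply₁₁, Matrix.fromBlocks_apply₁₂, Matrix.zero_apply, zero_mul,
          Finset.sum_const_zero, add_zero, Sum.elim_inl, ← mul_assoc]
        rw [← Finset.sum_mul, ← h2, formEval_dehom hV, mul_assoc]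
        congr 1
        simp only [formMon, Fin.val_rev, Fin.val_castAdd, evalPair, Matrix.cons_val_zero,
          Matrix.cons_val_one]
        rw [mul_assoc, ← pow_succ]
        congr 2
        omega
      · rw [hf₂, Fintype.sum_sum_type]
        simp only [Matrix.fromBlocks_apply₂₁, Matrix.fromBlocks_apply₂₂, Matrix.zero_apply, zero_mul,
          Finset.sum_const_zero, zero_add, Sum.elim_inr, Matrix.one_apply, ite_mul, one_mul,
          Finset.sum_ite_eq, Finset.mem_univ, if_true]
        rw [formEval_pow (natDegree_dehom_le hU), formEval_dehom hU]
        simp [formMon, evalPair]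
    · have h3 : (Matrix.fromBlocks B 0 0 (1 : Matrix (Fin d) (Fin d) K)).submatrix id
          (e.sumCongr (Equiv.refl _)) = Matrix.fromBlocks (B.submatrix id e) 0 0 1 := by
        ext i j
        rcases i with i | i <;> rcases j with j | j <;> rfl
      rw [h3, Matrix.det_fromBlocks_zero₂₁, Matrix.det_one, mul_one, h1,
        resultant_pow_left_of_le hd (natDegree_dehom_le hU) (natDegree_dehom_le hV), norm_pow,
        homResultant_eq, ← pow_add]
      congr 1
      rw [← Finset.sum_range_id, ← Finset.sum_range_id, Finset.sum_range_succ]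

/-- The new forms are linear combinations of those of `hasCoeffDet_powers` with matrix `B ⊗ 1`,
whose determinant is the `d`-th power of that of `B`. -/
lemma hasCoeffDet_comp (hd : d ≠ 0) (hU : U.IsHomogeneous d) (hV : V.IsHomogeneous d) {N : ℕ}
    {ι : Type*} [Fintype ι] [DecidableEq ι] {g : ι → (Fin 2 → K) → K} {δ : ℝ}
    (h : HasCoeffDet N g δ) :
    HasCoeffDet (d * N) (fun (j : ι × Fin d) z => formMon d z j.2 * g j.1 (evalPair U V z))
      (δ ^ d * ‖homResultant d U V‖ ^ (N * (N - 1) / 2)) := by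
  obtain ⟨B, e, h1, h2⟩ := h
  refine ((hasCoeffDet_powers hd hU hV N).trans
    (Matrix.kroneckerMap (· * ·) B (1 : Matrix (Fin d) (Fin d) K)) (e.prodCongr (Equiv.refl _))).congr
    (fun j z => ?_) ?_
  · obtain ⟨i, a⟩ := j
    rw [Fintype.sum_prod_type, h2, Finset.mul_sum]
    refine Finset.sum_congr rfl fun m _ => ?_
    simp only [Matrix.kroneckerMap_apply, Matrix.one_apply, mul_ite, mul_one,
      mul_zero, ite_mul, zero_mul, Finset.sum_ite_eq, Finset.mem_univ, if_true]
    ring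
  · have h3 : (Matrix.kroneckerMap (· * ·) B (1 : Matrix (Fin d) (Fin d) K)).submatrix id
        (e.prodCongr (Equiv.refl _)) = Matrix.kroneckerMap (· * ·) (B.submatrix id e) 1 := by
      ext i j
      rfl
    rw [h3, Matrix.det_kronecker, Matrix.det_one, one_pow, mul_one, norm_pow, h1, Fintype.card_fin]

/-- The exponent of the resultant in the coefficient determinant of the forms of degree
`d ^ k - 1` built from the iterates. -/
def resExponent (d : ℕ) : ℕ → ℕ
  | 0 => 0
  | k + 1 => resExponent d k * d + d ^ k * (d ^ k - 1) / 2

/-- With `n = d ^ k`, twice the exponent is `n (n - 1) / (d (d - 1)) - k n / d`: the main term is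
the one subtracted in the Green functions, and the rest is an admissible error. -/
lemma resExponent_eq (d : ℕ) (k : ℕ) :
    2 * (d - 1 : ℝ) * d * resExponent d k = d ^ k * (d ^ k - 1) - k * d ^ k * (d - 1) := by
  induction k with
  | zero => simp [resExponent]
  | succ k ih =>
    have h : ((d ^ k * (d ^ k - 1) / 2 : ℕ) : ℝ) = d ^ k * (d ^ k - 1) / 2 := by
      rcases Nat.eq_zero_or_pos (d ^ k) with h0 | h0
      · have : (d : ℝ) ^ k = 0 := by exact_mod_cast h0
        rw [h0, this]; simp
      rw [Nat.cast_div (Nat.even_mul_pred_self _).two_dvd (by norm_num)]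
      push_cast [Nat.cast_sub h0]
      rfl
    rw [resExponent]
    push_cast
    rw [h]
    linear_combination d * ih

lemma formMon_norm_le (n : ℕ) (z : Fin 2 → K) (c : Fin n) : ‖formMon n z c‖ ≤ ‖z‖ ^ (n - 1) := by
  rw [formMon, norm_mul, norm_pow, norm_pow]
  calc _ ≤ ‖z‖ ^ (c : ℕ) * ‖z‖ ^ (c.rev : ℕ) := by
        gcongr
        · exact norm_le_pi_norm z 0
        · exact norm_le_pi_norm z 1
    _ = _ := by
        rw [← pow_add, Fin.val_rev]
        congr 1
        omega

/-- Forms of degree `d ^ k - 1` which are adapted to the iterates of `(U, V)`. -/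
lemma exists_adapted_forms (hd : d ≠ 0) (hU : U.IsHomogeneous d) (hV : V.IsHomogeneous d)
    (k : ℕ) : ∃ g : Fin (d ^ k) → (Fin 2 → K) → K,
      HasCoeffDet (d ^ k) g (‖homResultant d U V‖ ^ resExponent d k) ∧
      ∀ z j, ‖g j z‖ ≤ ∏ i ∈ Finset.range k, ‖(evalPair U V)^[i] z‖ ^ (d - 1) := by
  -- With a variable `n`, the type `Fin (d ^ (k + 1))` can be replaced by `Fin (d * d ^ k)`.
  suffices h : ∀ n, n = d ^ k → ∃ g : Fin n → (Fin 2 → K) → K,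
      HasCoeffDet n g (‖homResultant d U V‖ ^ resExponent d k) ∧
      ∀ z j, ‖g j z‖ ≤ ∏ i ∈ Finset.range k, ‖(evalPair U V)^[i] z‖ ^ (d - 1) from h _ rfl
  induction k with
  | zero =>
    rintro n hn
    rw [pow_zero] at hn
    subst hn
    refine ⟨_, (HasCoeffDet.formMon 1).congr (fun _ _ => rfl) (by simp [resExponent]), fun z j => ?_⟩
    simpa using formMon_norm_le 1 z j
  | succ k ih =>
    intro n hn
    rw [pow_succ'] at hn
    subst hn
    obtain ⟨g, hg, hle⟩ := ih _ rfl
    -- Level `k + 1` consists of the products of a monomial of degree `d - 1` at `z` and a form of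
    -- level `k` at `(U, V)(z)`.
    have := hasCoeffDet_comp hd hU hV hg
    have e : Fin (d * d ^ k) ≃ Fin (d ^ k) × Fin d :=
      (finCongr (mul_comm _ _)).trans finProdFinEquiv.symm
    refine ⟨_, (this.reindex e).congr (fun _ _ => rfl) ?_, fun z j => ?_⟩
    · rw [resExponent, pow_add, pow_mul]
    · rw [norm_mul, Finset.prod_range_succ', mul_comm]
      refine mul_le_mul ?_ (by simpa using formMon_norm_le d z _) (norm_nonneg _) (by positivity)
      simpa only [Function.iterate_succ_apply] using hle (evalPair U V z) (e j).1

/-- The Leibniz expansion. The loss of a factorial, of logarithm `O(n log n)`, is harmless for the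
lower bound. -/
lemma norm_det_le {ι : Type*} [Fintype ι] [DecidableEq ι] (A : Matrix ι ι K) (M : ι → ℝ)
    (h : ∀ i j, ‖A i j‖ ≤ M i) : ‖A.det‖ ≤ (Fintype.card ι).factorial * ∏ i, M i := by
  rw [Matrix.det_apply]
  refine (norm_sum_le _ _).trans ?_
  rw [← Fintype.card_perm, ← Finset.card_univ, ← nsmul_eq_mul]
  refine Finset.sum_le_card_nsmul _ _ _ fun σ _ => ?_
  rw [← Equiv.prod_comp σ M]
  rcases Int.units_eq_one_or (Equiv.Perm.sign σ) with hs | hs <;> rw [hs] <;>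
  simp only [one_smul, Units.neg_smul, norm_neg, norm_prod] <;>
  exact Finset.prod_le_prod (fun _ _ => norm_nonneg _) fun i _ => h _ _

/-- The matrix of values is a projective Vandermonde matrix times the transposed matrix of
coefficients. -/
lemma HasCoeffDet.norm_det_eval {n : ℕ} {g : Fin n → (Fin 2 → K) → K} {δ : ℝ}
    (h : HasCoeffDet n g δ) (z : Fin n → Fin 2 → K) :
    ‖(Matrix.of fun i j => g j (z i)).det‖ =
      δ * ∏ i, ∏ j ∈ Finset.Ioi i, ‖z j 0 * z i 1 - z i 0 * z j 1‖ := by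
  obtain ⟨B, e, h1, h2⟩ := h
  have h3 : (Matrix.of fun i j => g j (z i)) =
      Matrix.projVandermonde (fun i => z i 0) (fun i => z i 1) * B.transpose := by
    ext i j
    rw [Matrix.of_apply, h2, Matrix.mul_apply]
    refine Finset.sum_congr rfl fun c _ => ?_
    rw [mul_comm]
    rfl
  have h4 : ‖B.det‖ = δ := by
    rw [← h1]
    have : B.submatrix id e = (B.submatrix id e).submatrix id id := rfl
    rw [show B.submatrix id e = B.submatrix id (e : Equiv.Perm (Fin n)) from rfl,
      Matrix.det_permute', norm_mul]
    rcases Int.units_eq_one_or (Equiv.Perm.sign e) with hs | hs <;> simp [hs]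
  rw [h3, Matrix.det_mul, Matrix.det_transpose, Matrix.det_projVandermonde, norm_mul, h4, mul_comm]
  simp only [norm_prod]

end frames

/-! ### Local estimates and homogeneous Green functions -/

section localBound

variable {K : Type*} [NormedField K] {d : ℕ} {U V : MvPolynomial (Fin 2) K}

lemma norm_formEval_le (n : ℕ) (p : Polynomial K) (z : Fin 2 → K) :
    ‖formEval n p z‖ ≤ (∑ i ∈ Finset.range (n + 1), ‖p.coeff i‖) * ‖z‖ ^ n := by
  rw [formEval_eq_sum, Finset.sum_mul]
  refine (norm_sum_le _ _).trans (Finset.sum_le_sum fun i hi => ?_)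
  rw [norm_mul]
  gcongr
  have := formMon_norm_le (n + 1) z ⟨i, Finset.mem_range.1 hi⟩
  simpa [formMon, Fin.val_rev] using this

lemma norm_formEval_le_of_ultrametric [IsUltrametricDist K] (n : ℕ) {p : Polynomial K}
    (hp : ∀ i, ‖p.coeff i‖ ≤ 1) (z : Fin 2 → K) : ‖formEval n p z‖ ≤ ‖z‖ ^ n := by
  rw [formEval_eq_sum]
  refine IsUltrametricDist.norm_sum_le_of_forall_le_of_nonneg (by positivity) fun i hi => ?_
  rw [norm_mul]
  have := formMon_norm_le (n + 1) z ⟨i, Finset.mem_range.1 hi⟩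
  have h2 : ‖z 0 ^ i * z 1 ^ (n - i)‖ ≤ ‖z‖ ^ n := by simpa [formMon, Fin.val_rev] using this
  calc _ ≤ 1 * ‖z‖ ^ n := by gcongr; exact hp i
    _ = _ := one_mul _

lemma norm_evalPair (hU : U.IsHomogeneous d) (hV : V.IsHomogeneous d) (z : Fin 2 → K) :
    ‖evalPair U V z‖ = max ‖formEval d (dehom U) z‖ ‖formEval d (dehom V) z‖ := by
  rw [norm_fin_two, formEval_dehom hU, formEval_dehom hV]
  rfl

/-- Multiplying by the adjugate of the Sylvester matrix expresses `Res(U, V)` times any monomial of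
degree `2 d - 1` by the products of monomials of degree `d - 1` with `U` and `V`. The bound `A` on
the adjugate is left open, to be `1` in the case of good reduction. -/
lemma norm_resultant_mul_le (hd : 0 < d) (hU : U.IsHomogeneous d) (hV : V.IsHomogeneous d)
    {A : ℝ}
    (hA : ∀ (w : Fin (d + d) → K) (W : ℝ), 0 ≤ W → (∀ i, ‖w i‖ ≤ W) → ∀ c,
      ‖((((dehom U).sylvester (dehom V) d d).transpose.adjugate).mulVec w) c‖ ≤ A * W)
    (z : Fin 2 → K) :
    ‖homResultant d U V‖ * ‖z‖ ^ (2 * d - 1) ≤ A * (‖z‖ ^ (d - 1) * ‖evalPair U V z‖) := by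
  set M := ((dehom U).sylvester (dehom V) d d).transpose with hM
  have h1 : ∀ i, ‖(M.mulVec (formMon (d + d) z)) i‖ ≤ ‖z‖ ^ (d - 1) * ‖evalPair U V z‖ := by
    intro i
    obtain ⟨j, rfl⟩ := finSumFinEquiv.surjective i
    have : (M.mulVec (formMon (d + d) z)) (finSumFinEquiv j) = _ :=
      sylvester_vecMul (dehom U) (dehom V) d d z j
    rw [this, norm_evalPair hU hV]
    rcases j with j | j
    · rw [Sum.elim_inl, norm_mul]
      exact mul_le_mul (formMon_norm_le d z j) (le_max_right _ _) (norm_nonneg _) (by positivity)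
    · rw [Sum.elim_inr, norm_mul]
      exact mul_le_mul (formMon_norm_le d z j) (le_max_left _ _) (norm_nonneg _) (by positivity)
  have h2 : ∀ c, ‖homResultant d U V‖ * ‖formMon (d + d) z c‖ ≤
      A * (‖z‖ ^ (d - 1) * ‖evalPair U V z‖) := by
    intro c
    have h3 := hA _ _ (by positivity) h1 c
    rw [Matrix.mulVec_mulVec, Matrix.adjugate_mul, Matrix.smul_mulVec, Matrix.one_mulVec,
      Pi.smul_apply, smul_eq_mul, norm_mul, hM, Matrix.det_transpose] at h3
    exact h3
  -- The pure powers of `z 1` and of `z 0`; the larger has norm `‖z‖ ^ (2 * d - 1)`.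
  have h0 := h2 ⟨0, by omega⟩
  have hl := h2 ⟨d + d - 1, by omega⟩
  simp only [formMon, Fin.val_rev, norm_mul, norm_pow, pow_zero, one_mul] at h0 hl
  rw [show d + d - (d + d - 1 + 1) = 0 by omega, pow_zero, mul_one] at hl
  rw [show d + d - (0 + 1) = 2 * d - 1 by omega] at h0
  rw [show d + d - 1 = 2 * d - 1 by omega] at hl
  rw [norm_fin_two z]
  rcases le_total ‖z 0‖ ‖z 1‖ with h | h
  · rw [max_eq_right h]
    rwa [norm_fin_two z, max_eq_right h] at h0
  · rw [max_eq_left h]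
    rwa [norm_fin_two z, max_eq_left h] at hl

/-- The constant `C` bounds `log ‖(U, V)(z)‖ - d log ‖z‖`. -/
def LocalBound (d : ℕ) (U V : MvPolynomial (Fin 2) K) (C : ℝ) : Prop :=
  ∀ z, z ≠ 0 → evalPair U V z ≠ 0 ∧ |Real.log ‖evalPair U V z‖ - d * Real.log ‖z‖| ≤ C

lemma localBound_of_le {a b C : ℝ} (ha : 0 < a) (hb : 0 < b) (hCa : -C ≤ Real.log a)
    (hCb : Real.log b ≤ C) (h1 : ∀ z, a * ‖z‖ ^ d ≤ ‖evalPair U V z‖)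
    (h2 : ∀ z, ‖evalPair U V z‖ ≤ b * ‖z‖ ^ d) : LocalBound d U V C := by
  intro z hz
  have hz' : 0 < ‖z‖ ^ d := pow_pos (norm_pos_iff.2 hz) _
  have h3 : 0 < ‖evalPair U V z‖ := (mul_pos ha hz').trans_le (h1 z)
  refine ⟨norm_pos_iff.1 h3, abs_le.2 ⟨?_, ?_⟩⟩
  · have := Real.log_le_log (mul_pos ha hz') (h1 z)
    rw [Real.log_mul ha.ne' hz'.ne', Real.log_pow] at this
    linarith
  · have := Real.log_le_log h3 (h2 z)
    rw [Real.log_mul hb.ne' hz'.ne', Real.log_pow] at this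
    linarith

lemma le_norm_evalPair (hd : 0 < d) {A : ℝ} (hA : 0 < A)
    (h : ∀ z : Fin 2 → K, ‖homResultant d U V‖ * ‖z‖ ^ (2 * d - 1) ≤
      A * (‖z‖ ^ (d - 1) * ‖evalPair U V z‖)) (z : Fin 2 → K) :
    ‖homResultant d U V‖ / A * ‖z‖ ^ d ≤ ‖evalPair U V z‖ := by
  rcases eq_or_ne z 0 with rfl | hz
  · simp [hd.ne']
  have hz' : 0 < ‖z‖ ^ (d - 1) := pow_pos (norm_pos_iff.2 hz) _
  have h1 := h z
  rw [show 2 * d - 1 = d + (d - 1) by omega, pow_add, ← mul_assoc] at h1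
  have h2 : ‖homResultant d U V‖ * ‖z‖ ^ d ≤ A * ‖evalPair U V z‖ := by
    refine le_of_mul_le_mul_right (h1.trans (le_of_eq ?_)) hz'
    ring
  rw [div_mul_eq_mul_div, div_le_iff₀ hA]
  linarith

lemma exists_localBound (hd : 0 < d) (hU : U.IsHomogeneous d) (hV : V.IsHomogeneous d)
    (hres : homResultant d U V ≠ 0) : ∃ C, 0 ≤ C ∧ LocalBound d U V C := by
  set M := ((dehom U).sylvester (dehom V) d d).transpose.adjugate with hM
  let A : ℝ := 1 + ∑ i, ∑ j, ‖M i j‖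
  have hA : 0 < A := by positivity
  let b : ℝ := 1 + (∑ i ∈ Finset.range (d + 1), ‖(dehom U).coeff i‖) +
    ∑ i ∈ Finset.range (d + 1), ‖(dehom V).coeff i‖
  have hb : 0 < b := by positivity
  have ha : 0 < ‖homResultant d U V‖ / A := div_pos (norm_pos_iff.2 hres) hA
  refine ⟨max |Real.log (‖homResultant d U V‖ / A)| |Real.log b|, by positivity,
    localBound_of_le ha hb ?_ ((le_abs_self _).trans (le_max_right _ _))
      (le_norm_evalPair hd hA (norm_resultant_mul_le hd hU hV ?_)) fun z => ?_⟩
  · exact neg_le.1 ((neg_le_abs _).trans (le_max_left _ _))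
  · intro w W hW hw c
    calc _ ≤ ∑ j, ‖M c j * w j‖ := norm_sum_le _ _
      _ ≤ ∑ j, ‖M c j‖ * W := by
        refine Finset.sum_le_sum fun j _ => ?_
        rw [norm_mul]
        gcongr
        exact hw j
      _ = (∑ j, ‖M c j‖) * W := by rw [Finset.sum_mul]
      _ ≤ A * W := by
        gcongr
        have := Finset.single_le_sum (f := fun i => ∑ j, ‖M i j‖)
          (fun i _ => Finset.sum_nonneg fun j _ => norm_nonneg _) (Finset.mem_univ c)
        exact this.trans (by simp [A])
  · rw [norm_evalPair hU hV]
    refine max_le ((norm_formEval_le _ _ _).trans ?_) ((norm_formEval_le _ _ _).trans ?_)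
    · gcongr
      have : 0 ≤ ∑ i ∈ Finset.range (d + 1), ‖(dehom V).coeff i‖ := by positivity
      simp only [b]; linarith
    · gcongr
      have : 0 ≤ ∑ i ∈ Finset.range (d + 1), ‖(dehom U).coeff i‖ := by positivity
      simp only [b]; linarith

lemma norm_det_le_one [IsUltrametricDist K] {ι : Type*} [Fintype ι] [DecidableEq ι]
    {A : Matrix ι ι K} (h : ∀ i j, ‖A i j‖ ≤ 1) : ‖A.det‖ ≤ 1 := by
  rw [Matrix.det_apply]
  refine IsUltrametricDist.norm_sum_le_of_forall_le_of_nonneg zero_le_one fun σ _ => ?_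
  rcases Int.units_eq_one_or (Equiv.Perm.sign σ) with hs | hs <;> rw [hs] <;>
  simp only [one_smul, Units.neg_smul, norm_neg, norm_prod] <;>
  exact Finset.prod_le_one (fun _ _ => norm_nonneg _) fun i _ => h _ _

/-- The case of good reduction. -/
lemma localBound_zero [IsUltrametricDist K] (hd : 0 < d) (hU : U.IsHomogeneous d)
    (hV : V.IsHomogeneous d) (hU₁ : ∀ i, ‖(dehom U).coeff i‖ ≤ 1)
    (hV₁ : ∀ i, ‖(dehom V).coeff i‖ ≤ 1) (hres : ‖homResultant d U V‖ = 1) :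
    LocalBound d U V 0 := by
  have hM : ∀ i j, ‖((dehom U).sylvester (dehom V) d d).transpose i j‖ ≤ 1 := by
    intro i j
    obtain ⟨i, rfl⟩ := finSumFinEquiv.surjective i
    rw [Matrix.transpose_apply]
    rcases i with i | i
    · simp only [Polynomial.sylvester, Matrix.of_apply, finSumFinEquiv_apply_left,
        Fin.addCases_left]
      split_ifs
      exacts [hV₁ _, by simp]
    · simp only [Polynomial.sylvester, Matrix.of_apply, finSumFinEquiv_apply_right,
        Fin.addCases_right]
      split_ifs
      exacts [hU₁ _, by simp]
  have h := le_norm_evalPair (U := U) (V := V) hd one_pos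
    (norm_resultant_mul_le hd hU hV fun w W hW hw c => by
      rw [one_mul, Matrix.mulVec, dotProduct]
      refine IsUltrametricDist.norm_sum_le_of_forall_le_of_nonneg hW fun j _ => ?_
      rw [norm_mul]
      have : ‖(((dehom U).sylvester (dehom V) d d).transpose.adjugate) c j‖ ≤ 1 := by
        rw [Matrix.adjugate_apply]
        refine norm_det_le_one (K := K) fun i i' => ?_
        rw [Matrix.updateRow_apply]
        split_ifs
        · rw [Pi.single_apply]
          split_ifs <;> simp
        · exact hM _ _
      calc _ ≤ 1 * W := mul_le_mul this (hw j) (norm_nonneg _) zero_le_one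
        _ = W := one_mul W)
  rw [hres] at h
  refine localBound_of_le (a := 1) (b := 1) one_pos one_pos (by simp) (by simp)
    (by simpa using h) fun z => ?_
  rw [norm_evalPair hU hV, one_mul]
  exact max_le (norm_formEval_le_of_ultrametric d hU₁ z) (norm_formEval_le_of_ultrametric d hV₁ z)

end localBound

/-! ### Convergence, functional equation and homogeneity of `Λ`. -/

section greenHom

/-- Tate's telescoping argument. -/
lemma exists_tendsto_div_pow {d : ℕ} (hd : 2 ≤ d) {a : ℕ → ℝ} {C : ℝ}
    (h : ∀ n, |a (n + 1) - d * a n| ≤ C) :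
    ∃ l, Tendsto (fun n => a n / (d : ℝ) ^ n) atTop (𝓝 l) ∧ |l - a 0| ≤ C := by
  have hd' : (2 : ℝ) ≤ d := by exact_mod_cast hd
  have hC : 0 ≤ C := (abs_nonneg _).trans (h 0)
  -- The difference is at most `C / d ^ (n + 1) ≤ C / 2 ^ (n + 1)`, and these bounds add up to `C`.
  have h1 : ∀ n, dist (a n / (d : ℝ) ^ n) (a (n + 1) / (d : ℝ) ^ (n + 1)) ≤ C / 2 / 2 ^ n := by
    intro n
    rw [dist_comm, Real.dist_eq]
    have : a (n + 1) / (d : ℝ) ^ (n + 1) - a n / (d : ℝ) ^ n =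
        (a (n + 1) - d * a n) / (d : ℝ) ^ (n + 1) := by
      field_simp
      ring
    rw [this, abs_div, abs_of_pos (by positivity : (0 : ℝ) < (d : ℝ) ^ (n + 1)), div_div,
      ← pow_succ']
    exact div_le_div₀ hC (h n) (by positivity) (pow_le_pow_left₀ (by norm_num) hd' _)
  obtain ⟨l, hl⟩ := cauchySeq_tendsto_of_complete (cauchySeq_of_le_geometric_two h1)
  refine ⟨l, hl, ?_⟩
  have := dist_le_of_le_geometric_two_of_tendsto₀ h1 hl
  rw [dist_comm, Real.dist_eq] at this
  simpa using this

variable {K : Type*} [NormedField K] {d : ℕ} {U V : MvPolynomial (Fin 2) K} {C : ℝ}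

lemma evalPair_iterate_ne_zero (h : LocalBound d U V C) {z : Fin 2 → K} (hz : z ≠ 0) (n : ℕ) :
    (evalPair U V)^[n] z ≠ 0 := by
  induction n with
  | zero => exact hz
  | succ n ih =>
    rw [Function.iterate_succ_apply']
    exact (h _ ih).1

lemma tendsto_greenHom_and (hd : 2 ≤ d) (h : LocalBound d U V C) {z : Fin 2 → K} (hz : z ≠ 0) :
    Tendsto (fun n => Real.log ‖(evalPair U V)^[n] z‖ / (d : ℝ) ^ n) atTop
      (𝓝 (greenHom d U V z)) ∧ |greenHom d U V z - Real.log ‖z‖| ≤ C := by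
  obtain ⟨l, hl, hC⟩ := exists_tendsto_div_pow hd (a := fun n => Real.log ‖(evalPair U V)^[n] z‖)
    (C := C) fun n => by
      simp only [Function.iterate_succ_apply']
      exact (h _ (evalPair_iterate_ne_zero h hz n)).2
  have : greenHom d U V z = l := by
    simp only [greenHom, ← norm_fin_two]
    exact hl.limUnder_eq
  rw [this]
  exact ⟨hl, hC⟩

lemma tendsto_greenHom (hd : 2 ≤ d) (h : LocalBound d U V C) {z : Fin 2 → K} (hz : z ≠ 0) :
    Tendsto (fun n => Real.log ‖(evalPair U V)^[n] z‖ / (d : ℝ) ^ n) atTop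
      (𝓝 (greenHom d U V z)) := (tendsto_greenHom_and hd h hz).1

lemma abs_greenHom_sub_le (hd : 2 ≤ d) (h : LocalBound d U V C) {z : Fin 2 → K} (hz : z ≠ 0) :
    |greenHom d U V z - Real.log ‖z‖| ≤ C := (tendsto_greenHom_and hd h hz).2

lemma greenHom_evalPair (hd : 2 ≤ d) (h : LocalBound d U V C) {z : Fin 2 → K} (hz : z ≠ 0) :
    greenHom d U V (evalPair U V z) = d * greenHom d U V z := by
  have h1 := tendsto_greenHom hd h (h z hz).1
  have h2 := ((tendsto_greenHom hd h hz).comp (tendsto_add_atTop_nat 1)).const_mul (d : ℝ)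
  refine tendsto_nhds_unique h1 (h2.congr fun n => ?_)
  have hd' : (d : ℝ) ≠ 0 := by positivity
  simp only [Function.comp_apply, Function.iterate_succ_apply]
  rw [pow_succ]
  field_simp

/-- By the functional equation of `Λ`, this is the bound for `n = 0` at the `n`-th iterate; hence a
constant independent of `n`. -/
lemma abs_log_iterate_sub_le (hd : 2 ≤ d) (h : LocalBound d U V C) {z : Fin 2 → K} (hz : z ≠ 0)
    (n : ℕ) : |d ^ n * greenHom d U V z - Real.log ‖(evalPair U V)^[n] z‖| ≤ C := by
  have h1 : greenHom d U V ((evalPair U V)^[n] z) = d ^ n * greenHom d U V z := by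
    induction n with
    | zero => simp
    | succ n ih =>
      rw [Function.iterate_succ_apply', greenHom_evalPair hd h (evalPair_iterate_ne_zero h hz n), ih]
      ring
  rw [← h1]
  exact abs_greenHom_sub_le hd h (evalPair_iterate_ne_zero h hz n)

lemma formEval_smul {K : Type*} [Field K] (n : ℕ) (p : Polynomial K) (c : K) (z : Fin 2 → K) :
    formEval n p (c • z) = c ^ n * formEval n p z := by
  rw [formEval_eq_sum, formEval_eq_sum, Finset.mul_sum]
  refine Finset.sum_congr rfl fun i hi => ?_
  have : c ^ n = c ^ i * c ^ (n - i) := by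
    rw [← pow_add, Nat.add_sub_of_le (Finset.mem_range_succ_iff.1 hi)]
  rw [this]
  simp only [Pi.smul_apply, smul_eq_mul, mul_pow]
  ring

lemma evalPair_smul {K : Type*} [Field K] {U V : MvPolynomial (Fin 2) K}
    (hU : U.IsHomogeneous d) (hV : V.IsHomogeneous d) (c : K) (z : Fin 2 → K) :
    evalPair U V (c • z) = c ^ d • evalPair U V z := by
  ext i
  fin_cases i
  · have := formEval_smul d (dehom U) c z
    rw [formEval_dehom hU, formEval_dehom hU] at this
    exact this
  · have := formEval_smul d (dehom V) c z
    rw [formEval_dehom hV, formEval_dehom hV] at this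
    exact this

lemma greenHom_smul (hd : 2 ≤ d) (hU : U.IsHomogeneous d) (hV : V.IsHomogeneous d)
    (h : LocalBound d U V C) {c : K} (hc : c ≠ 0) {z : Fin 2 → K} (hz : z ≠ 0) :
    greenHom d U V (c • z) = Real.log ‖c‖ + greenHom d U V z := by
  have h1 : ∀ n, (evalPair U V)^[n] (c • z) = c ^ (d ^ n) • (evalPair U V)^[n] z := by
    intro n
    induction n with
    | zero => simp
    | succ n ih =>
      rw [Function.iterate_succ_apply', ih, evalPair_smul hU hV, Function.iterate_succ_apply',
        ← pow_mul, ← pow_succ]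
  have h2 := tendsto_greenHom hd h (smul_ne_zero hc hz)
  refine tendsto_nhds_unique h2 (((tendsto_greenHom hd h hz).const_add _).congr fun n => ?_)
  have hd' : (d : ℝ) ^ n ≠ 0 := by positivity
  rw [h1, norm_smul, norm_pow, Real.log_mul (pow_ne_zero _ (by simpa using hc))
    (norm_ne_zero_iff.2 (evalPair_iterate_ne_zero h hz n)), Real.log_pow]
  push_cast
  field_simp

end greenHom

/-! ### Green functions on pairs of points and their averages -/

section greenDiag

variable {K : Type*} [NormedField K] {d : ℕ} {U V : MvPolynomial (Fin 2) K} {C : ℝ}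

/-- The Green function in terms of homogeneous coordinates. -/
noncomputable def greenPair (d : ℕ) (U V : MvPolynomial (Fin 2) K) (x y : Fin 2 → K) : ℝ :=
  -Real.log ‖x 0 * y 1 - y 0 * x 1‖ + greenHom d U V x + greenHom d U V y -
    1 / ((d : ℝ) * ((d : ℝ) - 1)) * Real.log ‖homResultant d U V‖

lemma greenDiag_eq (d : ℕ) (U V : MvPolynomial (Fin 2) K) (P Q : P1 K) :
    greenDiag d U V P Q = greenPair d U V P.rep Q.rep := rfl

lemma wedge_ne_zero_of_ne {K : Type*} [Field K] {x y : Fin 2 → K} (hx : x ≠ 0) (hy : y ≠ 0)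
    (h : Projectivization.mk K x hx ≠ Projectivization.mk K y hy) :
    x 0 * y 1 - y 0 * x 1 ≠ 0 := by
  intro h0
  apply h
  rw [Projectivization.mk_eq_mk_iff']
  by_cases hy0 : y 0 = 0
  · have hy1 : y 1 ≠ 0 := fun hy1 => hy (by ext i; fin_cases i <;> simp [hy0, hy1])
    have hx0 : x 0 = 0 := by
      rw [hy0, zero_mul, sub_zero] at h0
      exact (mul_eq_zero.1 h0).resolve_right hy1
    refine ⟨x 1 / y 1, ?_⟩
    ext i
    fin_cases i
    · simp [hy0, hx0]
    · simp [hy1]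
  · refine ⟨x 0 / y 0, ?_⟩
    ext i
    fin_cases i
    · simp [hy0]
    · simp only [Pi.smul_apply, smul_eq_mul, Fin.mk_one]
      field_simp
      linear_combination h0

/-- Scaling `x` by `a` adds `log ‖a‖` to `Λ(x)` and to the logarithm of the determinant, so the two
cancel. -/
lemma greenDiag_mk (hd : 2 ≤ d) (hU : U.IsHomogeneous d) (hV : V.IsHomogeneous d)
    (h : LocalBound d U V C) {x y : Fin 2 → K} (hx : x ≠ 0) (hy : y ≠ 0)
    (hxy : x 0 * y 1 - y 0 * x 1 ≠ 0) :
    greenDiag d U V (Projectivization.mk K x hx) (Projectivization.mk K y hy) =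
      greenPair d U V x y := by
  obtain ⟨a, ha⟩ := Projectivization.exists_smul_eq_mk_rep K x hx
  obtain ⟨b, hb⟩ := Projectivization.exists_smul_eq_mk_rep K y hy
  have ha0 : (a : K) ≠ 0 := a.ne_zero
  have hb0 : (b : K) ≠ 0 := b.ne_zero
  have ha' : (Projectivization.mk K x hx).rep = (a : K) • x := ha.symm
  have hb' : (Projectivization.mk K y hy).rep = (b : K) • y := hb.symm
  rw [greenDiag_eq, ha', hb', greenPair, greenPair, greenHom_smul hd hU hV h ha0 hx,
    greenHom_smul hd hU hV h hb0 hy]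
  have : ((a : K) • x) 0 * ((b : K) • y) 1 - ((b : K) • y) 0 * ((a : K) • x) 1 =
      a * b * (x 0 * y 1 - y 0 * x 1) := by
    simp only [Pi.smul_apply, smul_eq_mul]
    ring
  rw [this, norm_mul, norm_mul, Real.log_mul (by simp [ha0, hb0]) (norm_ne_zero_iff.2 hxy),
    Real.log_mul (norm_ne_zero_iff.2 ha0) (norm_ne_zero_iff.2 hb0)]
  ring

lemma norm_wedge_le [IsUltrametricDist K] (x y : Fin 2 → K) :
    ‖x 0 * y 1 - y 0 * x 1‖ ≤ ‖x‖ * ‖y‖ := by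
  rw [sub_eq_add_neg]
  refine (IsUltrametricDist.norm_add_le_max _ _).trans (max_le ?_ ?_)
  · rw [norm_mul]
    exact mul_le_mul (norm_le_pi_norm x 0) (norm_le_pi_norm y 1) (norm_nonneg _) (norm_nonneg _)
  · rw [norm_neg, norm_mul, mul_comm]
    exact mul_le_mul (norm_le_pi_norm x 1) (norm_le_pi_norm y 0) (norm_nonneg _) (norm_nonneg _)

lemma greenHom_of_localBound_zero (hd : 2 ≤ d) (h : LocalBound d U V 0) {x : Fin 2 → K}
    (hx : x ≠ 0) : greenHom d U V x = Real.log ‖x‖ :=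
  sub_eq_zero.1 (abs_eq_zero.1 (le_antisymm (abs_greenHom_sub_le hd h hx) (abs_nonneg _)))

/-- The Green function is nonnegative in the case of good reduction. -/
lemma greenDiag_nonneg [IsUltrametricDist K] (hd : 2 ≤ d) (h : LocalBound d U V 0)
    (hres : ‖homResultant d U V‖ = 1) {P Q : P1 K} (hPQ : P ≠ Q) : 0 ≤ greenDiag d U V P Q := by
  have hw : P.rep 0 * Q.rep 1 - Q.rep 0 * P.rep 1 ≠ 0 :=
    wedge_ne_zero_of_ne P.rep_nonzero Q.rep_nonzero (by simpa using hPQ)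
  rw [greenDiag_eq, greenPair, hres, Real.log_one, mul_zero, sub_zero,
    greenHom_of_localBound_zero hd h P.rep_nonzero, greenHom_of_localBound_zero hd h Q.rep_nonzero]
  have := Real.log_le_log (norm_pos_iff.2 hw) (norm_wedge_le P.rep Q.rep)
  rw [Real.log_mul (norm_ne_zero_iff.2 P.rep_nonzero) (norm_ne_zero_iff.2 Q.rep_nonzero)] at this
  linarith

end greenDiag

/-! ### Averages over pairs of distinct points. -/

section average

lemma sum_offDiag_eq {α : Type*} [DecidableEq α] (s : Finset α) (f : α → α → ℝ) :
    ∑ p ∈ s.offDiag, f p.1 p.2 = ∑ i ∈ s, ∑ j ∈ s, f i j - ∑ i ∈ s, f i i := by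
  rw [← Finset.sum_product', ← Finset.diag_union_offDiag,
    Finset.sum_union (Finset.disjoint_diag_offDiag s), Finset.sum_diag]
  ring

lemma sum_offDiag_eq_two_mul {n : ℕ} (f : Fin n → Fin n → ℝ) (hf : ∀ i j, f i j = f j i) :
    ∑ p ∈ (Finset.univ : Finset (Fin n)).offDiag, f p.1 p.2 =
      2 * ∑ i, ∑ j ∈ Finset.Ioi i, f i j := by
  have h1 : ∀ i j : Fin n, f i j = (if i < j then f i j else 0) + (if j < i then f j i else 0) +
      (if i = j then f i j else 0) := by
    intro i j
    rcases lt_trichotomy i j with h | h | h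
    · simp [h, h.not_gt, h.ne]
    · simp [h]
    · simp [h, h.not_gt, h.ne', hf i j]
  have h2 : ∑ i, ∑ j ∈ Finset.Ioi i, f i j = ∑ i, ∑ j, if i < j then f i j else 0 := by
    refine Finset.sum_congr rfl fun i _ => ?_
    rw [← Finset.sum_filter]
    congr 1
    ext j
    simp
  rw [sum_offDiag_eq, h2]
  rw [Fintype.sum_congr _ _ fun i => Fintype.sum_congr _ _ (h1 i)]
  simp only [Finset.sum_add_distrib]
  rw [Finset.sum_comm (f := fun i j => if j < i then f j i else 0)]
  simp
  ring

/-- Averages over pairs of points are bounded below as soon as they are for configurations of some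
fixed cardinality. -/
lemma sum_offDiag_ge_of_card {α : Type*} [DecidableEq α] {f : α → α → ℝ} {n : ℕ} {ε : ℝ}
    (hn : 2 ≤ n) (h : ∀ s : Finset α, s.card = n →
      -ε * (n * (n - 1)) ≤ ∑ p ∈ s.offDiag, f p.1 p.2) (s : Finset α) (hs : n ≤ s.card) :
    -ε * (s.card * (s.card - 1)) ≤ ∑ p ∈ s.offDiag, f p.1 p.2 := by
  obtain ⟨k, hk⟩ := Nat.exists_eq_add_of_le hs
  induction k generalizing s with
  | zero =>
    rw [add_zero] at hk
    rw [hk]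
    exact h s hk
  | succ k ih =>
    have h1 : ∀ x ∈ s, -ε * ((n + k) * (n + k - 1)) ≤
        ∑ p ∈ (s.erase x).offDiag, f p.1 p.2 := by
      intro x hx
      have hc : (s.erase x).card = n + k := by rw [Finset.card_erase_of_mem hx, hk]; rfl
      have := ih (s.erase x) (by omega) hc
      rw [hc] at this
      exact_mod_cast this
    -- An ordered pair of distinct points survives the deletion of one point in `s.card - 2` cases.
    have h2 : ∑ x ∈ s, ∑ p ∈ (s.erase x).offDiag, f p.1 p.2 =
        ((s.card : ℝ) - 2) * ∑ p ∈ s.offDiag, f p.1 p.2 := by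
      have h3 : ∀ x ∈ s, ∑ p ∈ (s.erase x).offDiag, f p.1 p.2 =
          ∑ p ∈ s.offDiag, f p.1 p.2 - ∑ j ∈ s, f x j - ∑ j ∈ s, f j x + 2 * f x x := by
        intro x hx
        have h4 : ∀ g : α → ℝ, ∑ j ∈ s.erase x, g j = ∑ j ∈ s, g j - g x := fun g =>
          eq_sub_of_add_eq (Finset.sum_erase_add s g hx)
        rw [sum_offDiag_eq, sum_offDiag_eq]
        simp only [h4, Finset.sum_sub_distrib]
        ring
      rw [Finset.sum_congr rfl h3, Finset.sum_add_distrib, Finset.sum_sub_distrib,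
        Finset.sum_sub_distrib, Finset.sum_const, nsmul_eq_mul, ← Finset.mul_sum,
        Finset.sum_comm (f := fun x j => f j x), sum_offDiag_eq]
      ring
    have h5 := Finset.sum_le_sum h1
    rw [h2, Finset.sum_const, nsmul_eq_mul, hk] at h5
    rw [hk]
    push_cast at h5 ⊢
    have h6 : (0 : ℝ) < n + k - 1 := by
      have : (2 : ℝ) ≤ n := by exact_mod_cast hn
      have : (0 : ℝ) ≤ k := by positivity
      linarith
    refine le_of_mul_le_mul_left ?_ h6
    calc _ = _ := ?_
      _ ≤ _ := h5
      _ = _ := ?_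
    · ring
    · ring

end average

/-! ### Baker's lower bound. -/

section lowerBound

variable {K : Type*} [NormedField K] {d : ℕ} {U V : MvPolynomial (Fin 2) K} {C : ℝ}

/-- Take logarithms in the two evaluations of the determinant of the adapted forms at the points `z
i`: the exact one and the upper bound by rows. The error is of order `n k = n log n / log d`,
whereas there are about `n ^ 2` pairs. -/
lemma sum_greenPair_ge (hd : 2 ≤ d) (hU : U.IsHomogeneous d) (hV : V.IsHomogeneous d)
    (hres : homResultant d U V ≠ 0) (h : LocalBound d U V C)
    {n k : ℕ} (hn : n = d ^ k) (z : Fin n → Fin 2 → K) (hz : ∀ i, z i ≠ 0)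
    (hzz : ∀ i j, i ≠ j → z i 0 * z j 1 - z j 0 * z i 1 ≠ 0) :
    -(2 * d ^ k * k * (Real.log d + (d - 1) * C + |Real.log ‖homResultant d U V‖|)) ≤
      ∑ p ∈ (Finset.univ : Finset (Fin n)).offDiag, greenPair d U V (z p.1) (z p.2) := by
  have hforms := exists_adapted_forms (by omega) hU hV k
  rw [← hn] at hforms
  obtain ⟨g, hg, hle⟩ := hforms
  set R := Real.log ‖homResultant d U V‖ with hR
  set r := resExponent d k with hr
  have hC : 0 ≤ C := (abs_nonneg _).trans (h (z ⟨0, by rw [hn]; positivity⟩) (hz _)).2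
  have hd' : (2 : ℝ) ≤ d := by exact_mod_cast hd
  have hn' : (n : ℝ) = (d : ℝ) ^ k := by rw [hn]; push_cast; rfl
  -- the determinant of the values of the forms
  have hdet := hg.norm_det_eval z
  have hdet_le := norm_det_le (Matrix.of fun i j => g j (z i)) _ (fun i j => hle (z i) j)
  rw [hdet, Fintype.card_fin] at hdet_le
  have hres' : 0 < ‖homResultant d U V‖ := norm_pos_iff.2 hres
  have hwpos : ∀ i, ∀ j ∈ Finset.Ioi i, ‖z j 0 * z i 1 - z i 0 * z j 1‖ ≠ 0 := fun i j hj =>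
    norm_ne_zero_iff.2 (hzz j i (Finset.mem_Ioi.1 hj).ne')
  have hitpos : ∀ i l, ‖(evalPair U V)^[l] (z i)‖ ≠ 0 := fun i l =>
    norm_ne_zero_iff.2 (evalPair_iterate_ne_zero h (hz i) l)
  have hlog := Real.log_le_log (mul_pos (pow_pos hres' _)
    (Finset.prod_pos fun i _ => Finset.prod_pos fun j hj =>
      (norm_nonneg _).lt_of_ne' (hwpos i j hj))) hdet_le
  rw [Real.log_mul (pow_ne_zero _ hres'.ne')
    (Finset.prod_ne_zero_iff.2 fun i _ => Finset.prod_ne_zero_iff.2 (hwpos i)), Real.log_pow,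
    Real.log_mul (by positivity) (Finset.prod_ne_zero_iff.2 fun i _ =>
      Finset.prod_ne_zero_iff.2 fun l _ => pow_ne_zero _ (hitpos i l)),
    Real.log_prod (fun i _ => Finset.prod_ne_zero_iff.2 (hwpos i)),
    Finset.sum_congr rfl fun i _ => Real.log_prod (hwpos i),
    Real.log_prod (fun i _ => Finset.prod_ne_zero_iff.2 fun l _ => pow_ne_zero _ (hitpos i l))]
    at hlog
  -- Since `(d - 1) ∑_{l < k} d ^ l = n - 1`, each row gives `Λ(z i)` the coefficient with which it
  -- enters half the sum over pairs. These contributions cancel exactly.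
  have hrow : ∀ i, Real.log (∏ l ∈ Finset.range k, ‖(evalPair U V)^[l] (z i)‖ ^ (d - 1)) ≤
      (n - 1) * greenHom d U V (z i) + k * ((d - 1) * C) := by
    intro i
    rw [Real.log_prod fun l _ => pow_ne_zero _ (hitpos i l)]
    have h1 : ∀ l, Real.log (‖(evalPair U V)^[l] (z i)‖ ^ (d - 1)) ≤
        (d - 1) * greenHom d U V (z i) * d ^ l + (d - 1) * C := by
      intro l
      rw [Real.log_pow, Nat.cast_sub (by omega), Nat.cast_one]
      have h2 := (abs_le.1 (abs_log_iterate_sub_le hd h (hz i) l)).1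
      have h3 : (0 : ℝ) ≤ d - 1 := by linarith
      nlinarith [mul_le_mul_of_nonneg_left h2 h3]
    refine (Finset.sum_le_sum fun l _ => h1 l).trans (le_of_eq ?_)
    rw [Finset.sum_add_distrib, ← Finset.mul_sum, Finset.sum_const, Finset.card_range,
      nsmul_eq_mul, geom_sum_eq (by linarith), hn']
    have : (d : ℝ) - 1 ≠ 0 := by linarith
    field_simp
  have hsum := Finset.sum_le_sum fun i (_ : i ∈ Finset.univ) => hrow i
  rw [Finset.sum_add_distrib, ← Finset.mul_sum, Finset.sum_const, Finset.card_univ,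
    Fintype.card_fin, nsmul_eq_mul] at hsum
  have hfact : Real.log (n.factorial : ℝ) ≤ n * (k * Real.log d) := by
    have h1 : (n.factorial : ℝ) ≤ (n : ℝ) ^ n := by exact_mod_cast Nat.factorial_le_pow n
    have h2 := Real.log_le_log (by positivity) h1
    rw [Real.log_pow] at h2
    refine h2.trans (le_of_eq ?_)
    rw [hn', Real.log_pow]
  have hexp := resExponent_eq d k
  rw [← hr, ← hn'] at hexp
  -- the Green functions
  have hG : ∑ p ∈ (Finset.univ : Finset (Fin n)).offDiag, greenPair d U V (z p.1) (z p.2) =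
      -(2 * ∑ i, ∑ j ∈ Finset.Ioi i, Real.log ‖z j 0 * z i 1 - z i 0 * z j 1‖) +
        2 * (n - 1) * ∑ i, greenHom d U V (z i) -
        n * (n - 1) * (1 / ((d : ℝ) * ((d : ℝ) - 1)) * R) := by
    rw [← sum_offDiag_eq_two_mul (fun i j => Real.log ‖z j 0 * z i 1 - z i 0 * z j 1‖)
      (fun i j => by rw [← norm_neg]; ring_nf)]
    simp only [greenPair]
    rw [Finset.sum_sub_distrib, Finset.sum_add_distrib, Finset.sum_add_distrib, Finset.sum_neg_distrib]
    rw [sum_offDiag_eq Finset.univ (fun i j => greenHom d U V (z i)),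
      sum_offDiag_eq Finset.univ (fun i j => greenHom d U V (z j)),
      sum_offDiag_eq Finset.univ (fun i j => (1 / ((d : ℝ) * ((d : ℝ) - 1)) * R))]
    have hw : ∀ p : Fin n × Fin n, ‖z p.1 0 * z p.2 1 - z p.2 0 * z p.1 1‖ =
        ‖z p.2 0 * z p.1 1 - z p.1 0 * z p.2 1‖ := fun p => by
      rw [← norm_neg]; ring_nf
    simp only [hw, Finset.sum_const, Finset.card_univ, Fintype.card_fin, nsmul_eq_mul]
    rw [← Finset.mul_sum]
    ring
  rw [hG]
  have hRabs : -|R| ≤ R ∧ R ≤ |R| := ⟨neg_abs_le R, le_abs_self R⟩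
  -- Only the secondary term of `resExponent_eq` survives the subtraction of the normalizing
  -- constant.
  have hcoef : 2 * (r : ℝ) * R - n * (n - 1) * (1 / ((d : ℝ) * ((d : ℝ) - 1)) * R) =
      -(n * k / d * R) := by
    have h1 : (d : ℝ) - 1 ≠ 0 := by linarith
    have h2 : (d : ℝ) ≠ 0 := by linarith
    field_simp
    linear_combination R * hexp
  have hlast : (n : ℝ) * k / d * R ≤ n * k * |R| := by
    have h1 : (n : ℝ) * k / d ≤ n * k := div_le_self (by positivity) (by linarith)
    calc _ ≤ (n : ℝ) * k / d * |R| := by gcongr; exact hRabs.2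
      _ ≤ _ := by gcongr
  have hpos : 0 ≤ (n : ℝ) * k * |R| := by positivity
  rw [← hn']
  nlinarith

/-- **Baker's lower bound** for average values of the Green function. -/
lemma exists_sum_greenDiag_ge (hd : 2 ≤ d) (hU : U.IsHomogeneous d) (hV : V.IsHomogeneous d)
    (hres : homResultant d U V ≠ 0) {ε : ℝ} (hε : 0 < ε) :
    ∃ N : ℕ, ∀ s : Finset (P1 K), N ≤ s.card →
      -ε * (s.card * (s.card - 1)) ≤
        ∑ᶠ p ∈ (s : Set (P1 K)).offDiag, greenDiag d U V p.1 p.2 := by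
  classical
  obtain ⟨C, hC, h⟩ := exists_localBound (by omega) hU hV hres
  set B := Real.log d + (d - 1) * C + |Real.log ‖homResultant d U V‖| with hB
  have hd' : (2 : ℝ) ≤ d := by exact_mod_cast hd
  -- Possible because `k / d ^ k` tends to `0`. Multiplied by `d ^ k`, the inequality compares the
  -- error of `sum_greenPair_ge` with `ε n (n - 1)`.
  obtain ⟨k, hk1, hk⟩ : ∃ k : ℕ, 1 ≤ k ∧ 2 * k * B ≤ ε * ((d : ℝ) ^ k - 1) := by
    have h1 : Tendsto (fun k : ℕ => (k : ℝ) / (d : ℝ) ^ k) atTop (𝓝 0) := by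
      simpa using tendsto_pow_const_div_const_pow_of_one_lt 1 (by linarith : (1 : ℝ) < d)
    have h2 : Tendsto (fun k : ℕ => 1 / (d : ℝ) ^ k) atTop (𝓝 0) := by
      simpa using tendsto_pow_const_div_const_pow_of_one_lt 0 (by linarith : (1 : ℝ) < d)
    have h3 : Tendsto (fun k : ℕ => 2 * B * ((k : ℝ) / (d : ℝ) ^ k) + ε * (1 / (d : ℝ) ^ k))
        atTop (𝓝 0) := by
      simpa using (h1.const_mul (2 * B)).add (h2.const_mul ε)
    obtain ⟨k, hk, hk1⟩ := ((h3.eventually_lt_const hε).and (eventually_ge_atTop 1)).exists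
    refine ⟨k, hk1, ?_⟩
    have hp : (0 : ℝ) < (d : ℝ) ^ k := by positivity
    have := mul_lt_mul_of_pos_right hk hp
    field_simp at this
    linarith
  refine ⟨d ^ k, fun s hs => ?_⟩
  rw [← Finset.coe_offDiag, finsum_mem_coe_finset]
  refine sum_offDiag_ge_of_card (f := greenDiag d U V) (n := d ^ k) ?_ (fun s hs => ?_) s hs
  · exact hd.trans (Nat.le_self_pow (by omega) d)
  · let e : Fin (d ^ k) ≃ s := (finCongr hs.symm).trans s.equivFin.symm
    have h1 := sum_greenPair_ge hd hU hV hres h rfl (fun i => (e i : P1 K).rep)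
      (fun i => (e i : P1 K).rep_nonzero) fun i j hij =>
        wedge_ne_zero_of_ne (Projectivization.rep_nonzero _) (Projectivization.rep_nonzero _) (by
          simpa [Projectivization.mk_rep] using fun h => hij (e.injective (Subtype.ext h)))
    have h2 : ∑ p ∈ (Finset.univ : Finset (Fin (d ^ k))).offDiag,
        greenPair d U V (e p.1 : P1 K).rep (e p.2 : P1 K).rep =
          ∑ p ∈ s.offDiag, greenDiag d U V p.1 p.2 := by
      refine Finset.sum_bij (fun p _ => ((e p.1 : P1 K), (e p.2 : P1 K))) ?_ ?_ ?_ ?_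
      · intro p hp
        simp only [Finset.mem_offDiag, Finset.mem_univ, true_and] at hp
        exact Finset.mem_offDiag.2 ⟨(e p.1).2, (e p.2).2, fun h => hp (e.injective (Subtype.ext h))⟩
      · rintro ⟨a, b⟩ _ ⟨a', b'⟩ _ h
        simp only [Prod.mk.injEq] at h
        rw [e.injective (Subtype.ext h.1), e.injective (Subtype.ext h.2)]
      · rintro ⟨a, b⟩ hab
        obtain ⟨ha, hb, hne⟩ := Finset.mem_offDiag.1 hab
        refine ⟨(e.symm ⟨a, ha⟩, e.symm ⟨b, hb⟩), ?_, by simp⟩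
        simpa using hne
      · intro p _
        rfl
    rw [← h2]
    refine le_trans ?_ h1
    have h3 := mul_le_mul_of_nonneg_left hk (by positivity : (0 : ℝ) ≤ (d : ℝ) ^ k)
    push_cast
    rw [← hB]
    linarith

end lowerBound

/-! ### Base change, nonvanishing of the resultant and good reduction -/

section map

variable {K L : Type*} [Field K] [Field L] (σ : K →+* L) {d : ℕ} {U V : MvPolynomial (Fin 2) K}

lemma dehom_map (U : MvPolynomial (Fin 2) K) : dehom (U.map σ) = (dehom U).map σ := by
  rw [dehom, dehom, MvPolynomial.aeval_def, MvPolynomial.aeval_def, MvPolynomial.eval₂_map,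
    ← Polynomial.coe_mapRingHom, MvPolynomial.eval₂_comp_left]
  congr 1
  · ext
    simp
  · ext i
    fin_cases i <;> simp

lemma homResultant_map (d : ℕ) (U V : MvPolynomial (Fin 2) K) :
    homResultant d (U.map σ) (V.map σ) = σ (homResultant d U V) := by
  rw [homResultant_eq, homResultant_eq, dehom_map, dehom_map, Polynomial.resultant_map_map]

lemma evalPair_map (U V : MvPolynomial (Fin 2) K) (x : Fin 2 → K) :
    evalPair (U.map σ) (V.map σ) (fun i => σ (x i)) = fun i => σ (evalPair U V x i) := by
  ext i
  fin_cases i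
  · exact (MvPolynomial.map_eval _ _ _).symm
  · exact (MvPolynomial.map_eval _ _ _).symm

lemma evalPair_map_iterate (U V : MvPolynomial (Fin 2) K) (x : Fin 2 → K) (n : ℕ) :
    (evalPair (U.map σ) (V.map σ))^[n] (fun i => σ (x i)) =
      fun i => σ ((evalPair U V)^[n] x i) := by
  induction n with
  | zero => rfl
  | succ n ih => rw [Function.iterate_succ_apply', ih, evalPair_map, Function.iterate_succ_apply']

/-- As `p` has exact degree `d`, the formal resultant is the true one up to a power of the leading
coefficient of `p`, and a common factor would have a root. -/
lemma resultant_ne_zero_of_left {p q : Polynomial K} [IsAlgClosed K] (hp : p.natDegree = d)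
    (hd : 0 < d) (hq : q.natDegree ≤ d) (h : ∀ r, p.eval r = 0 → q.eval r ≠ 0) :
    Polynomial.resultant p q d d ≠ 0 := by
  obtain ⟨k, hk⟩ := Nat.exists_eq_add_of_le hq
  have hp0 : p ≠ 0 := fun h0 => by simp [h0] at hp; omega
  have h1 : Polynomial.resultant p q d d =
      p.coeff d ^ k * Polynomial.resultant p q d q.natDegree := by
    conv_lhs => rw [hk]
    rw [Polynomial.resultant_add_right_deg _ _ _ _ _ le_rfl, ← hk]
  rw [h1]
  refine mul_ne_zero (pow_ne_zero _ ?_) ?_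
  · rw [← hp]
    simpa using hp0
  · conv_lhs => rw [← hp]
    rw [Ne, Polynomial.resultant_eq_zero_iff]
    rintro ⟨-, hc⟩
    classical
    obtain ⟨r, hr⟩ := IsAlgClosed.exists_root (EuclideanDomain.gcd p q) (fun h0 => hc (by
      rw [← EuclideanDomain.gcd_isUnit_iff]
      exact Polynomial.isUnit_iff_degree_eq_zero.2 h0))
    exact h r (Polynomial.IsRoot.dvd hr (EuclideanDomain.gcd_dvd_left p q))
      (Polynomial.IsRoot.dvd hr (EuclideanDomain.gcd_dvd_right p q))

lemma homResultant_ne_zero [IsAlgClosed K] (hd : 0 < d) (hU : U.IsHomogeneous d)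
    (hV : V.IsHomogeneous d) (h : ∀ x : Fin 2 → K, MvPolynomial.eval x U = 0 →
      MvPolynomial.eval x V = 0 → x = 0) : homResultant d U V ≠ 0 := by
  have h1 : ∀ r (U : MvPolynomial (Fin 2) K), (dehom U).eval r = MvPolynomial.eval ![r, 1] U := by
    intro r U
    rw [dehom, ← Polynomial.coe_evalRingHom, MvPolynomial.aeval_def, MvPolynomial.eval₂_comp_left,
      MvPolynomial.eval, MvPolynomial.eval₂Hom]
    simp only [RingHom.coe_mk, MonoidHom.coe_mk, OneHom.coe_mk]
    congr 1
    · ext; simp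
    · ext i
      fin_cases i <;> simp
  have hroot : ∀ r, (dehom U).eval r = 0 → (dehom V).eval r ≠ 0 := fun r hr hr' => by
    have := congrFun (h ![r, 1] (by rw [← h1, hr]) (by rw [← h1, hr'])) 1
    simp at this
  rw [homResultant_eq]
  rcases (natDegree_dehom_le hU).eq_or_lt with hUd | hUd
  · exact resultant_ne_zero_of_left hUd hd (natDegree_dehom_le hV) hroot
  · rcases (natDegree_dehom_le hV).eq_or_lt with hVd | hVd
    · rw [Polynomial.resultant_comm]
      exact mul_ne_zero (pow_ne_zero _ (by simp)) (resultant_ne_zero_of_left hVd hd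
        (natDegree_dehom_le hU) fun r hr hr' => hroot r hr' hr)
    -- If both degrees drop, `[1 : 0]` is a common zero of the two forms.
    · exfalso
      have h2 : ∀ W : MvPolynomial (Fin 2) K, W.IsHomogeneous d → (dehom W).natDegree < d →
          MvPolynomial.eval ![1, 0] W = 0 := by
        intro W hW hlt
        rw [← formEval_dehom hW, formEval_eq_sum, Finset.sum_range_succ,
          Polynomial.coeff_eq_zero_of_natDegree_lt hlt, zero_mul, add_zero]
        refine Finset.sum_eq_zero fun i hi => ?_
        rw [Finset.mem_range] at hi
        simp [(Nat.sub_pos_of_lt hi).ne']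
      have := congrFun (h ![1, 0] (h2 U hU hUd) (h2 V hV hVd)) 0
      simp at this

end map

/-! ### Good reduction at almost all places. -/

section goodReduction

variable {F : Type*} [Field F] [NumberField F] {d : ℕ} {U V : MvPolynomial (Fin 2) F}

/-- The pair `(U, V)` has good reduction at all but finitely many places. -/
lemma eventually_good_reduction (hd : 0 < d) (hU : U.IsHomogeneous d) (hV : V.IsHomogeneous d)
    (hres : homResultant d U V ≠ 0) :
    ∀ᶠ q : RatPlace in cofinite, IsUltrametricDist q.C ∧ ∀ σ : F →+* q.C,
      LocalBound d (U.map σ) (V.map σ) 0 ∧ ‖homResultant d (U.map σ) (V.map σ)‖ = 1 := by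
  have h1 : ∀ᶠ q : RatPlace in cofinite, IsUltrametricDist q.C :=
    RatPlace.eventually_cofinite_of_finite ∅ Set.finite_empty fun p _ => inferInstance
  have h2 : ∀ p : Polynomial F, ∀ᶠ q : RatPlace in cofinite, ∀ (σ : F →+* q.C) i,
      ‖(p.map σ).coeff i‖ ≤ 1 := by
    intro p
    have := (Filter.eventually_all_finset p.support).2 fun i _ =>
      eventually_norm_embedding_le_one (p.coeff i)
    filter_upwards [this] with q hq σ i
    rw [Polynomial.coeff_map]
    by_cases hi : i ∈ p.support
    · exact hq i hi σ
    · simp [Polynomial.notMem_support_iff.1 hi]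
  filter_upwards [h1, h2 (dehom U), h2 (dehom V), eventually_norm_embedding_eq_one hres]
    with q hq hqU hqV hqr
  refine ⟨hq, fun σ => ?_⟩
  have hr : ‖homResultant d (U.map σ) (V.map σ)‖ = 1 := by rw [homResultant_map, hqr]
  exact ⟨localBound_zero hd (hU.map σ) (hV.map σ) (by rw [dehom_map]; exact hqU σ)
    (by rw [dehom_map]; exact hqV σ) hr, hr⟩

lemma LocalBound.mono {K : Type*} [NormedField K] {U V : MvPolynomial (Fin 2) K} {C C' : ℝ}
    (h : LocalBound d U V C) (hC : C ≤ C') : LocalBound d U V C' := fun z hz =>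
  ⟨(h z hz).1, (h z hz).2.trans hC⟩

/-- The constants vanish for almost all `q`, so they have a finite sum, which will bound the
difference of global heights. -/
lemma exists_localBounds (hd : 0 < d) (hU : U.IsHomogeneous d) (hV : V.IsHomogeneous d)
    (hres : homResultant d U V ≠ 0) :
    ∃ c : RatPlace → ℝ, (∀ᶠ q in cofinite, c q = 0) ∧
      ∀ (q : RatPlace) (σ : F →+* q.C), LocalBound d (U.map σ) (V.map σ) (c q) := by
  classical
  have h : ∀ (q : RatPlace) (σ : F →+* q.C), ∃ C, 0 ≤ C ∧ LocalBound d (U.map σ) (V.map σ) C :=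
    fun q σ => exists_localBound hd (hU.map σ) (hV.map σ) (by
      rw [homResultant_map]
      simpa using hres)
  choose C hC0 hC using h
  -- Off the good places, a sum of nonnegative constants dominates each of them.
  refine ⟨fun q => if ∀ σ : F →+* q.C, LocalBound d (U.map σ) (V.map σ) 0 then 0 else
    ∑ σ : F →+* q.C, C q σ, ?_, fun q σ => ?_⟩
  · filter_upwards [eventually_good_reduction hd hU hV hres] with q hq
    rw [if_pos fun σ => (hq.2 σ).1]
  · dsimp only
    split_ifs with hq
    · exact hq σ
    · exact (hC q σ).mono (Finset.single_le_sum (fun σ _ => hC0 q σ) (Finset.mem_univ σ))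

end goodReduction

/-! ### The absolute height in terms of embeddings -/

section height

lemma embSum_comp {K L : Type*} [Field K] [NumberField K] [Field L] [NumberField L] (j : K →+* L)
    (φ : (q : RatPlace) → (K →+* q.C) → ℝ) :
    embSum L (fun q ρ => φ q (ρ.comp j)) / Module.finrank ℚ L =
      embSum K φ / Module.finrank ℚ K := by
  let := j.toAlgebra
  have h1 : embSum L (fun q ρ => φ q (ρ.comp j)) = Module.finrank K L * embSum K φ :=
    embSum_comp_algebraMap
  have h2 : (Module.finrank ℚ K : ℝ) ≠ 0 := by exact_mod_cast Module.finrank_pos.ne'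
  have h3 : (Module.finrank K L : ℝ) ≠ 0 := by exact_mod_cast Module.finrank_pos.ne'
  rw [h1, ← Module.finrank_mul_finrank ℚ K L]
  push_cast
  field_simp

/-- The absolute height of a pair of elements of a number field. -/
noncomputable def pairHeight {L : Type*} [Field L] [NumberField L] (x : Fin 2 → L) : ℝ :=
  embSum L (fun _ ρ => Real.log ‖fun i => ρ (x i)‖) / Module.finrank ℚ L

lemma pairHeight_comp {K L : Type*} [Field K] [NumberField K] [Field L] [NumberField L]
    (j : K →+* L) (x : Fin 2 → K) : pairHeight (fun i => j (x i)) = pairHeight x :=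
  embSum_comp j fun _ ρ => Real.log ‖fun i => ρ (x i)‖

lemma pairHeight_smul {L : Type*} [Field L] [NumberField L] {c : L} (hc : c ≠ 0) {x : Fin 2 → L}
    (hx : x ≠ 0) : pairHeight (c • x) = pairHeight x := by
  rw [pairHeight, pairHeight]
  congr 1
  have h : ∀ (q : RatPlace) (ρ : L →+* q.C), Real.log ‖fun i => ρ ((c • x) i)‖ =
      Real.log ‖ρ c‖ + Real.log ‖fun i => ρ (x i)‖ := by
    intro q ρ
    have h1 : (fun i => ρ ((c • x) i)) = ρ c • fun i => ρ (x i) := by ext i; simp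
    have h2 : (fun i => ρ (x i)) ≠ 0 := fun h0 => hx (by
      ext i
      simpa using congrFun h0 i)
    rw [h1, norm_smul, Real.log_mul (by simpa using hc) (norm_ne_zero_iff.2 h2)]
  simp only [h]
  rw [embSum_add (almostZero_log_norm c) (almostZero_log_norm_pair hx), embSum_log_norm, zero_add]

variable {Qbar : Type*} [Field Qbar] [CharZero Qbar] [Algebra.IsAlgebraic ℚ Qbar]

/-- `height` is computed over the field generated by the chosen representative. In a compositum with
the image of `L` the two pairs of coordinates are proportional, and the product formula removes the
factor. -/
lemma height_mk {L : Type*} [Field L] [NumberField L] (j : L →+* Qbar) {x : Fin 2 → L}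
    (hx : x ≠ 0) (hjx : (fun i => j (x i)) ≠ 0) :
    height (Projectivization.mk Qbar (fun i => j (x i)) hjx) = pairHeight x := by
  set P := Projectivization.mk Qbar (fun i => j (x i)) hjx with hP
  let K : IntermediateField ℚ Qbar := IntermediateField.adjoin ℚ (Set.range P.rep)
  have : FiniteDimensional ℚ K :=
    IntermediateField.finiteDimensional_adjoin fun x _ => Algebra.IsIntegral.isIntegral x
  have : NumberField K := {}
  let y : Fin 2 → K := fun i => ⟨P.rep i, IntermediateField.subset_adjoin ℚ _ ⟨i, rfl⟩⟩
  have hy : y ≠ 0 := fun h => P.rep_nonzero (by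
    ext i
    exact congrArg Subtype.val (congrFun h i))
  have h1 : height P = pairHeight y := by
    rw [pairHeight, ← logHeight_eq_embSum hy]
    rfl
  let j' : L →ₐ[ℚ] Qbar := j.toRatAlgHom
  let M : IntermediateField ℚ Qbar := j'.fieldRange ⊔ K
  have : FiniteDimensional ℚ j'.fieldRange :=
    Module.Finite.range j'.toLinearMap
  have : FiniteDimensional ℚ M := IntermediateField.finiteDimensional_sup _ _
  have : NumberField M := {}
  let iK : K →+* M := (IntermediateField.inclusion (le_sup_right : K ≤ M)).toRingHom
  let iL : L →+* M := ((IntermediateField.inclusion (le_sup_left : j'.fieldRange ≤ M)).toRingHom).comp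
    j'.rangeRestrict.toRingHom
  have hiK : ∀ a, (iK a : Qbar) = a := fun a => rfl
  have hiL : ∀ a, (iL a : Qbar) = j a := fun a => rfl
  obtain ⟨c, hc⟩ := Projectivization.exists_smul_eq_mk_rep Qbar (fun i => j (x i)) hjx
  obtain ⟨i₀, hi₀⟩ := Function.ne_iff.1 hx
  have hcr : ∀ i, (c : Qbar) * j (x i) = P.rep i := fun i => congrFun hc i
  have hji : iL (x i₀) ≠ 0 := by simpa using hi₀
  have hjj : j (x i₀) ≠ 0 := by simpa using hi₀
  let c' : M := iK (y i₀) / iL (x i₀)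
  have hc'c : (c' : Qbar) = c := by
    change (P.rep i₀ / j (x i₀) : Qbar) = c
    rw [← hcr, mul_div_cancel_right₀ _ hjj]
  have hc' : c' ≠ 0 := fun h => c.ne_zero (by rw [← hc'c, h]; rfl)
  have hxy : (fun i => iK (y i)) = c' • fun i => iL (x i) := by
    ext i
    change P.rep i = (c' : Qbar) * j (x i)
    rw [hc'c, hcr]
  rw [h1, ← pairHeight_comp iK, hxy, pairHeight_smul hc', pairHeight_comp]
  intro h
  exact hji (congrFun h i₀)

end height

/-! ### The normalized height -/

section canonical

variable {F : Type*} [Field F] {L : Type*} [Field L] [Algebra F L] {d : ℕ}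

/-- The function `Λ` at the image, under an embedding `ρ` in a valued field, of a pair `x`. -/
noncomputable def localGreen {C : Type*} [NormedField C] (d : ℕ) (U V : MvPolynomial (Fin 2) F)
    (ρ : L →+* C) (x : Fin 2 → L) : ℝ :=
  greenHom d (U.map (ρ.comp (algebraMap F L))) (V.map (ρ.comp (algebraMap F L))) fun i => ρ (x i)

lemma embed_ne_zero {C : Type*} [Field C] (ρ : L →+* C) {x : Fin 2 → L} (hx : x ≠ 0) :
    (fun i => ρ (x i)) ≠ 0 := fun h0 => hx (by
  ext i
  simpa using congrFun h0 i)

lemma almostZero_localGreen [NumberField F] [NumberField L] {U V : MvPolynomial (Fin 2) F}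
    (hd : 2 ≤ d) (hU : U.IsHomogeneous d)
    (hV : V.IsHomogeneous d) (hres : homResultant d U V ≠ 0) {x : Fin 2 → L} (hx : x ≠ 0) :
    AlmostZero fun q (ρ : L →+* q.C) => localGreen d U V ρ x := by
  filter_upwards [eventually_good_reduction (by omega) hU hV hres, almostZero_log_norm_pair hx]
    with q h1 h2 ρ
  rw [localGreen, greenHom_of_localBound_zero hd (h1.2 _).1 (embed_ne_zero ρ hx), h2]

variable {Qbar : Type*} [Field Qbar] [Algebra F Qbar] (f : Endo F Qbar d)

lemma Endo.homResultant_ne_zero [IsAlgClosed Qbar] (hd : 0 < d) : homResultant d f.U f.V ≠ 0 := by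
  have := ArithDyn.homResultant_ne_zero (U := f.U.map (algebraMap F Qbar))
    (V := f.V.map (algebraMap F Qbar)) hd (f.homogeneous_U.map _) (f.homogeneous_V.map _)
    fun x h1 h2 => f.eq_zero_of_common_zero x
      (by rwa [MvPolynomial.eval_map, ← MvPolynomial.aeval_def] at h1)
      (by rwa [MvPolynomial.eval_map, ← MvPolynomial.aeval_def] at h2)
  rw [homResultant_map] at this
  exact fun h => this (by rw [h, map_zero])

lemma Endo.evalPair_ne_zero {x : Fin 2 → Qbar} (hx : x ≠ 0) :
    evalPair (f.U.map (algebraMap F Qbar)) (f.V.map (algebraMap F Qbar)) x ≠ 0 := fun h =>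
  hx (f.eq_zero_of_common_zero _
      (by simpa [evalPair, MvPolynomial.eval_map, MvPolynomial.aeval_def] using congrFun h 0)
      (by simpa [evalPair, MvPolynomial.eval_map, MvPolynomial.aeval_def] using congrFun h 1))

lemma Endo.toFun_mk {x : Fin 2 → Qbar} (hx : x ≠ 0) :
    f.toFun (Projectivization.mk Qbar x hx) = Projectivization.mk Qbar _ (f.evalPair_ne_zero hx) := by
  obtain ⟨a, ha⟩ := Projectivization.exists_smul_eq_mk_rep Qbar x hx
  rw [Endo.toFun, Projectivization.mk_eq_mk_iff']
  refine ⟨(a : Qbar) ^ d, ?_⟩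
  rw [← evalPair_smul (f.homogeneous_U.map _) (f.homogeneous_V.map _), ← ha]
  rfl

variable {f} in
lemma Endo.iterate_evalPair_ne_zero (j : L →ₐ[F] Qbar) {x : Fin 2 → L} (hx : x ≠ 0) (n : ℕ) :
    (evalPair (f.U.map (algebraMap F L)) (f.V.map (algebraMap F L)))^[n] x ≠ 0 := by
  induction n with
  | zero => exact hx
  | succ n ih =>
    rw [Function.iterate_succ_apply']
    intro h
    have h1 := f.evalPair_ne_zero (embed_ne_zero (j : L →+* Qbar) ih)
    rw [← j.comp_algebraMap, ← MvPolynomial.map_map, ← MvPolynomial.map_map, evalPair_map, h] at h1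
    exact h1 (by ext; simp)

lemma Endo.iterate_mk (j : L →ₐ[F] Qbar) {x : Fin 2 → L} (hx : x ≠ 0) (n : ℕ) :
    f.toFun^[n] (Projectivization.mk Qbar _ (embed_ne_zero (j : L →+* Qbar) hx)) =
      Projectivization.mk Qbar _ (embed_ne_zero (j : L →+* Qbar)
        (Endo.iterate_evalPair_ne_zero (f := f) j hx n)) := by
  induction n with
  | zero => rfl
  | succ n ih =>
    rw [Function.iterate_succ_apply', ih, f.toFun_mk]
    congr 1
    rw [← j.comp_algebraMap, ← MvPolynomial.map_map, ← MvPolynomial.map_map, evalPair_map,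
      Function.iterate_succ_apply']

variable [NumberField F] [CharZero Qbar] [Algebra.IsAlgebraic ℚ Qbar] [IsAlgClosed Qbar]

/-- The sum over all embeddings of the homogeneous Green functions. -/
noncomputable def greenHeight [NumberField L] (d : ℕ) (U V : MvPolynomial (Fin 2) F)
    (x : Fin 2 → L) : ℝ :=
  embSum L (fun _ ρ => localGreen d U V ρ x) / Module.finrank ℚ L

variable [NumberField L]

/-- The sum over all embeddings of the local bounds. The resulting constant depends neither on `x`
and `n` nor on the number field `L`. -/
lemma abs_pairHeight_iterate_sub_le {U V : MvPolynomial (Fin 2) F} (hd : 2 ≤ d)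
    (hU : U.IsHomogeneous d) (hV : V.IsHomogeneous d) (hres : homResultant d U V ≠ 0)
    {c : RatPlace → ℝ} (hc0 : ∀ᶠ q in cofinite, c q = 0)
    (hc : ∀ (q : RatPlace) (σ : F →+* q.C), LocalBound d (U.map σ) (V.map σ) (c q))
    {x : Fin 2 → L} (hx : x ≠ 0) (n : ℕ)
    (hxn : (evalPair (U.map (algebraMap F L)) (V.map (algebraMap F L)))^[n] x ≠ 0) :
    |pairHeight ((evalPair (U.map (algebraMap F L)) (V.map (algebraMap F L)))^[n] x) -
      d ^ n * greenHeight d U V x| ≤ ∑ᶠ q, c q := by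
  have hL : (0 : ℝ) < Module.finrank ℚ L := by exact_mod_cast Module.finrank_pos
  have h0 : AlmostZero fun q (_ : L →+* q.C) => c q := by
    filter_upwards [hc0] with q hq _ using hq
  have hg : AlmostZero fun q (ρ : L →+* q.C) => d ^ n * localGreen d U V ρ x :=
    (almostZero_localGreen hd hU hV hres hx).const_mul _
  have hl := almostZero_log_norm_pair hxn
  have h1 : ∀ (q : RatPlace) (ρ : L →+* q.C), |d ^ n * localGreen d U V ρ x -
      Real.log ‖fun i => ρ ((evalPair (U.map (algebraMap F L)) (V.map (algebraMap F L)))^[n] x i)‖|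
        ≤ c q := by
    intro q ρ
    have := abs_log_iterate_sub_le hd (hc q (ρ.comp (algebraMap F L))) (embed_ne_zero ρ hx) n
    rwa [← MvPolynomial.map_map, ← MvPolynomial.map_map, evalPair_map_iterate,
      MvPolynomial.map_map, MvPolynomial.map_map] at this
  have h2 := embSum_mono hg (hl.add h0) fun q ρ => by linarith [(abs_le.1 (h1 q ρ)).2]
  have h3 := embSum_mono hl (hg.add h0) fun q ρ => by linarith [(abs_le.1 (h1 q ρ)).1]
  rw [embSum_add hl h0, embSum_const_mul, embSum_const] at h2
  rw [embSum_add hg h0, embSum_const_mul, embSum_const] at h3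
  rw [pairHeight, greenHeight, ← mul_div_assoc, ← sub_div, abs_div, abs_of_pos hL, div_le_iff₀ hL,
    abs_le]
  constructor <;> linarith

lemma Endo.exists_height_iterate_bound (hd : 2 ≤ d) :
    ∃ B : ℝ, ∀ {L : Type _} [Field L] [NumberField L] [Algebra F L] (j : L →ₐ[F] Qbar)
      {x : Fin 2 → L} (hx : x ≠ 0) (n : ℕ),
      |height (f.toFun^[n] (Projectivization.mk Qbar _ (embed_ne_zero (j : L →+* Qbar) hx))) -
        d ^ n * greenHeight d f.U f.V x| ≤ B := by
  have hres := f.homResultant_ne_zero (by omega : 0 < d)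
  obtain ⟨c, hc0, hc⟩ := exists_localBounds (by omega) f.homogeneous_U f.homogeneous_V hres
  refine ⟨∑ᶠ q, c q, fun j x hx n => ?_⟩
  rw [f.iterate_mk j hx, height_mk _ (Endo.iterate_evalPair_ne_zero j hx n)]
  exact abs_pairHeight_iterate_sub_le hd f.homogeneous_U f.homogeneous_V hres hc0 hc hx n
    (Endo.iterate_evalPair_ne_zero j hx n)

lemma tendsto_div_pow_of_abs_sub_le (hd : 2 ≤ d) {a : ℕ → ℝ} {l B : ℝ}
    (h : ∀ n, |a n - d ^ n * l| ≤ B) : Tendsto (fun n => a n / (d : ℝ) ^ n) atTop (𝓝 l) := by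
  have hd' : (1 : ℝ) < d := by exact_mod_cast hd
  have h1 : Tendsto (fun n : ℕ => B / (d : ℝ) ^ n) atTop (𝓝 0) := by
    simpa [div_eq_mul_inv] using (tendsto_pow_const_div_const_pow_of_one_lt 0 hd').const_mul B
  rw [tendsto_iff_norm_sub_tendsto_zero]
  refine squeeze_zero (fun n => norm_nonneg _) (fun n => ?_) h1
  have hp : (0 : ℝ) < (d : ℝ) ^ n := by positivity
  rw [Real.norm_eq_abs, le_div_iff₀ hp]
  calc _ = |(a n / (d : ℝ) ^ n - l) * d ^ n| := by rw [abs_mul, abs_of_pos hp]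
    _ = |a n - d ^ n * l| := by congr 1; field_simp
    _ ≤ B := h n

lemma Endo.tendsto_height (hd : 2 ≤ d) (j : L →ₐ[F] Qbar) {x : Fin 2 → L} (hx : x ≠ 0) :
    Tendsto (fun n => height (f.toFun^[n] (Projectivization.mk Qbar _
      (embed_ne_zero (j : L →+* Qbar) hx))) / (d : ℝ) ^ n) atTop (𝓝 (greenHeight d f.U f.V x)) := by
  obtain ⟨B, hB⟩ := f.exists_height_iterate_bound hd
  exact tendsto_div_pow_of_abs_sub_le hd fun n => hB j hx n

lemma Endo.normalizedHeight_mk (hd : 2 ≤ d) (j : L →ₐ[F] Qbar) {x : Fin 2 → L} (hx : x ≠ 0) :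
    f.normalizedHeight (Projectivization.mk Qbar _ (embed_ne_zero (j : L →+* Qbar) hx)) =
      greenHeight d f.U f.V x :=
  (f.tendsto_height hd j hx).limUnder_eq

omit [NumberField L] [IsAlgClosed Qbar] in
/-- Every finite set of points is defined over a number field. -/
lemma exists_numberField (s : Finset (P1 Qbar)) :
    ∃ L : IntermediateField F Qbar, NumberField L ∧ ∀ P ∈ s, ∃ x : Fin 2 → L,
      ∀ i, (x i : Qbar) = P.rep i := by
  classical
  have : Algebra.IsAlgebraic F Qbar := Algebra.IsAlgebraic.tower_top (K := ℚ) F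
  let L : IntermediateField F Qbar := IntermediateField.adjoin F
    ((s ×ˢ (Finset.univ : Finset (Fin 2))).image fun p => p.1.rep p.2 : Finset Qbar)
  have hfin : FiniteDimensional F L :=
    IntermediateField.finiteDimensional_adjoin fun x _ => Algebra.IsIntegral.isIntegral x
  refine ⟨L, ?_, fun P hP => ⟨fun i => ⟨P.rep i, IntermediateField.subset_adjoin F _ ?_⟩,
    fun i => rfl⟩⟩
  · have : FiniteDimensional ℚ L := Module.Finite.trans F L
    exact {}
  · rw [Finset.coe_image]
    exact ⟨(P, i), by simpa using hP, rfl⟩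

omit [NumberField L] [IsAlgClosed Qbar] in
lemma exists_eq_mk (P : P1 Qbar) :
    ∃ (L : IntermediateField F Qbar) (_ : NumberField L) (x : Fin 2 → L) (hx : x ≠ 0),
      P = Projectivization.mk Qbar _ (embed_ne_zero (L.val : L →+* Qbar) hx) := by
  obtain ⟨L, hL, h⟩ := exists_numberField (F := F) {P}
  obtain ⟨x, hx⟩ := h P (Finset.mem_singleton_self P)
  have hx' : (fun i => (L.val : L →+* Qbar) (x i)) = P.rep := funext hx
  refine ⟨L, hL, x, fun h => P.rep_nonzero ?_, ?_⟩
  · rw [← hx', h]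
    ext; simp
  · conv_lhs => rw [← P.mk_rep]
    simp only [hx']

lemma Endo.exists_height_bound (hd : 2 ≤ d) : ∃ B : ℝ, ∀ P (n : ℕ),
    |height (f.toFun^[n] P) - d ^ n * f.normalizedHeight P| ≤ B := by
  obtain ⟨B, hB⟩ := f.exists_height_iterate_bound hd
  refine ⟨B, fun P n => ?_⟩
  obtain ⟨L, hL, x, hx, rfl⟩ := exists_eq_mk (F := F) P
  rw [f.normalizedHeight_mk hd L.val hx]
  exact hB L.val hx n

lemma Endo.isNormalizedHeight (hd : 2 ≤ d) : f.IsNormalizedHeight f.normalizedHeight := by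
  obtain ⟨B, hB⟩ := f.exists_height_bound hd
  refine ⟨⟨B, fun P => ?_⟩, fun P => ?_⟩
  -- The uniform bound at `n = 0` is the boundedness of the difference with `height`.
  · have := hB P 0
    rw [abs_sub_comm]
    simpa using this
  · have h1 := tendsto_div_pow_of_abs_sub_le hd (hB (f.toFun P))
    have h2 := ((tendsto_div_pow_of_abs_sub_le hd (hB P)).comp
      (tendsto_add_atTop_nat 1)).const_mul (d : ℝ)
    refine tendsto_nhds_unique h1 (h2.congr fun n => ?_)
    have hd' : (d : ℝ) ≠ 0 := by positivity
    simp only [Function.comp_apply, Function.iterate_succ_apply, pow_succ]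
    field_simp

omit [NumberField L] [NumberField F] [IsAlgClosed Qbar] in
lemma Endo.eq_normalizedHeight (hd : 2 ≤ d) {g : P1 Qbar → ℝ} (hg : f.IsNormalizedHeight g) :
    g = f.normalizedHeight := by
  obtain ⟨⟨B, hB⟩, hf⟩ := hg
  funext P
  have h1 : ∀ n, g (f.toFun^[n] P) = d ^ n * g P := by
    intro n
    induction n with
    | zero => simp
    | succ n ih => rw [Function.iterate_succ_apply', hf, ih, pow_succ]; ring
  refine (tendsto_div_pow_of_abs_sub_le hd (B := B) fun n => ?_).limUnder_eq.symm
  rw [← h1, abs_sub_comm]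
  exact hB _

end canonical

/-! ### Conjugates and Green functions of Galois orbits -/

section conjugates

lemma P1.map_mk {K L : Type*} [Field K] [Field L] (σ : K →+* L) {x : Fin 2 → K} (hx : x ≠ 0) :
    P1.map σ (Projectivization.mk K x hx) = Projectivization.mk L _ (embed_ne_zero σ hx) := rfl

lemma P1.map_map {K L M : Type*} [Field K] [Field L] [Field M] (σ : K →+* L) (τ : L →+* M)
    (P : P1 K) : P1.map τ (P1.map σ P) = P1.map (τ.comp σ) P := by
  induction P using Projectivization.ind with
  | h x hx => rfl

lemma P1.map_injective {K L : Type*} [Field K] [Field L] (σ : K →+* L) :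
    Function.Injective (P1.map σ) := by
  intro P Q h
  induction P using Projectivization.ind with
  | h x hx =>
    induction Q using Projectivization.ind with
    | h y hy =>
      by_contra hne
      refine wedge_ne_zero_of_ne hx hy hne (σ.injective ?_)
      obtain ⟨a, ha⟩ := (Projectivization.mk_eq_mk_iff' _ _ _ _ _).1 h
      have h0 : a * σ (y 0) = σ (x 0) := congrFun ha 0
      have h1 : a * σ (y 1) = σ (x 1) := congrFun ha 1
      rw [map_sub, map_mul, map_mul, map_zero, ← h0, ← h1]
      ring

variable {F : Type*} [Field F] [NumberField F] {Qbar : Type*} [Field Qbar] [Algebra F Qbar]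
  [CharZero Qbar] [Algebra.IsAlgebraic ℚ Qbar]

omit [NumberField F] [CharZero Qbar] [Algebra.IsAlgebraic ℚ Qbar] in
lemma mem_conjugates_self (P : P1 Qbar) : P ∈ conjugates F P := by
  refine ⟨AlgEquiv.refl, ?_⟩
  induction P using Projectivization.ind with
  | h x hx => rfl

omit [NumberField F] [CharZero Qbar] [Algebra.IsAlgebraic ℚ Qbar] in
lemma map_mem_conjugates (g : Qbar ≃ₐ[F] Qbar) {P Q : P1 Qbar} (hQ : Q ∈ conjugates F P) :
    P1.map (g : Qbar →+* Qbar) Q ∈ conjugates F P := by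
  obtain ⟨h, rfl⟩ := hQ
  exact ⟨h.trans g, by rw [P1.map_map]; rfl⟩

/-- A conjugate depends only on the restriction of the automorphism to a number field over which `P`
is defined. -/
lemma finite_conjugates (P : P1 Qbar) : (conjugates F P).Finite := by
  obtain ⟨L, hL, x, hx, rfl⟩ := exists_eq_mk (F := F) P
  have : FiniteDimensional F L := Module.Finite.right ℚ F L
  refine (Set.finite_range fun h : L →ₐ[F] Qbar =>
    Projectivization.mk Qbar _ (embed_ne_zero (h : L →+* Qbar) hx)).subset ?_
  rintro _ ⟨g, rfl⟩
  exact ⟨(g : Qbar →ₐ[F] Qbar).comp L.val, rfl⟩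

variable [IsAlgClosed Qbar]

lemma isGalois_of_isAlgClosed : IsGalois F Qbar := by
  have : Algebra.IsAlgebraic F Qbar := Algebra.IsAlgebraic.tower_top (K := ℚ) F
  have : IsAlgClosure F Qbar := ⟨inferInstance, inferInstance⟩
  have : Normal F Qbar := IsAlgClosure.normal F Qbar
  exact {}

/-- Points of `ℙ¹` with affine coordinate `x`, and the point at infinity. -/
lemma P1.exists_eq {K : Type*} [Field K] (P : P1 K) :
    P = Projectivization.mk K ![1, 0] (by simp) ∨
      ∃ x : K, P = Projectivization.mk K ![x, 1] (by simp) := by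
  induction P using Projectivization.ind with
  | h y hy =>
    by_cases h1 : y 1 = 0
    · left
      have h0 : y 0 ≠ 0 := fun h0 => hy (by ext i; fin_cases i <;> simp [h0, h1])
      rw [Projectivization.mk_eq_mk_iff']
      exact ⟨y 0, by ext i; fin_cases i <;> simp [h1]⟩
    · right
      refine ⟨y 0 / y 1, ?_⟩
      rw [Projectivization.mk_eq_mk_iff']
      exact ⟨y 1, by ext i; fin_cases i <;> simp [mul_div_cancel₀ _ h1]⟩

lemma P1.mk_inj {K : Type*} [Field K] {x y : K}
    (h : Projectivization.mk K ![x, 1] (by simp) = Projectivization.mk K ![y, 1] (by simp)) :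
    x = y := by
  obtain ⟨a, ha⟩ := (Projectivization.mk_eq_mk_iff' _ _ _ _ _).1 h
  have h0 := congrFun ha 0
  have h1 := congrFun ha 1
  simp only [Pi.smul_apply, Matrix.cons_val_zero, Matrix.cons_val_one, smul_eq_mul, mul_one] at h0 h1
  rw [← h0, h1, one_mul]

lemma P1.map_affine {K L : Type*} [Field K] [Field L] (σ : K →+* L) (x : K) :
    P1.map σ (Projectivization.mk K ![x, 1] (by simp)) =
      Projectivization.mk L ![σ x, 1] (by simp) := by
  rw [P1.map_mk]
  congr 1
  ext i
  fin_cases i <;> simp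

lemma P1.map_infinity {K L : Type*} [Field K] [Field L] (σ : K →+* L) :
    P1.map σ (Projectivization.mk K ![1, 0] (by simp)) =
      Projectivization.mk L ![1, 0] (by simp) := by
  rw [P1.map_mk]
  congr 1
  ext i
  fin_cases i <;> simp

/-- The affine coordinate is determined by the point, so it is fixed by the Galois group and lies in
`F`. -/
lemma mem_range_of_ncard_le_one {P : P1 Qbar} (h : (conjugates F P).ncard ≤ 1) :
    P ∈ Set.range (P1.map (algebraMap F Qbar)) := by
  have hfix : ∀ g : Qbar ≃ₐ[F] Qbar, P1.map (g : Qbar →+* Qbar) P = P := fun g =>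
    (Set.ncard_le_one (finite_conjugates P)).1 h _ (map_mem_conjugates g (mem_conjugates_self P)) _
      (mem_conjugates_self P)
  rcases P.exists_eq with rfl | ⟨x, rfl⟩
  · exact ⟨_, P1.map_infinity _⟩
  · have := isGalois_of_isAlgClosed (F := F) (Qbar := Qbar)
    obtain ⟨y, rfl⟩ := (InfiniteGalois.mem_range_algebraMap_iff_fixed x).2 fun g => by
      have := hfix g
      rw [P1.map_affine] at this
      exact P1.mk_inj this
    exact ⟨_, P1.map_affine _ _⟩

omit [IsAlgClosed Qbar] [NumberField F] [CharZero Qbar] [Algebra.IsAlgebraic ℚ Qbar] in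
lemma ncard_conjugates_of_mem_range {P : P1 Qbar} (h : P ∈ Set.range (P1.map (algebraMap F Qbar))) :
    (conjugates F P).ncard ≤ 1 := by
  obtain ⟨Q, rfl⟩ := h
  have : conjugates F (P1.map (algebraMap F Qbar) Q) ⊆ {P1.map (algebraMap F Qbar) Q} := by
    rintro _ ⟨g, rfl⟩
    dsimp only
    rw [P1.map_map, Set.mem_singleton_iff]
    congr 1
    ext x
    simp
  exact (Set.ncard_le_ncard this).trans (by simp)

end conjugates

/-! ### Sums of Green functions over finite sets of algebraic points. -/

section greenSum

variable {F : Type*} [Field F] {L : Type*} [Field L] [Algebra F L] {C : Type*} [NormedField C]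
  {d : ℕ} {U V : MvPolynomial (Fin 2) F}

/-- The Green function of the images of two pairs under an embedding in a valued field. -/
noncomputable def localPair (d : ℕ) (U V : MvPolynomial (Fin 2) F) (ρ : L →+* C)
    (x y : Fin 2 → L) : ℝ :=
  -Real.log ‖ρ (x 0 * y 1 - y 0 * x 1)‖ + localGreen d U V ρ x + localGreen d U V ρ y -
    1 / ((d : ℝ) * ((d : ℝ) - 1)) * Real.log ‖ρ (algebraMap F L (homResultant d U V))‖

lemma localPair_eq (ρ : L →+* C) (x y : Fin 2 → L) : localPair d U V ρ x y =
    greenPair d (U.map (ρ.comp (algebraMap F L))) (V.map (ρ.comp (algebraMap F L)))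
      (fun i => ρ (x i)) fun i => ρ (y i) := by
  rw [localPair, greenPair, homResultant_map, RingHom.comp_apply, map_sub, map_mul, map_mul]
  rfl

/-- The iterates are computed in `L`; the embedding enters only through the norms of their
coordinates. -/
lemma localGreen_congr {ρ ρ' : L →+* C} (h : ∀ x, ‖ρ' x‖ = ‖ρ x‖) (x : Fin 2 → L) :
    localGreen d U V ρ' x = localGreen d U V ρ x := by
  rw [localGreen, localGreen, greenHom, greenHom]
  simp only [← MvPolynomial.map_map, evalPair_map_iterate, h]

lemma localPair_congr {ρ ρ' : L →+* C} (h : ∀ x, ‖ρ' x‖ = ‖ρ x‖) (x y : Fin 2 → L) :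
    localPair d U V ρ' x y = localPair d U V ρ x y := by
  rw [localPair, localPair, localGreen_congr h, localGreen_congr h, h, h]

lemma localPair_comp {M : Type*} [Field M] [Algebra F M] (j : L →ₐ[F] M) (ρ : M →+* C)
    (x y : Fin 2 → L) : localPair d U V ρ (fun i => j (x i)) (fun i => j (y i)) =
      localPair d U V (ρ.comp (j : L →+* M)) x y := by
  rw [localPair_eq, localPair_eq, RingHom.comp_assoc, j.comp_algebraMap]
  rfl

lemma greenDiag_map (hd : 2 ≤ d) (hU : U.IsHomogeneous d) (hV : V.IsHomogeneous d)
    (hres : homResultant d U V ≠ 0) (ρ : L →+* C) {P Q : P1 L} (hPQ : P ≠ Q) :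
    greenDiag d (U.map (ρ.comp (algebraMap F L))) (V.map (ρ.comp (algebraMap F L)))
      (P1.map ρ P) (P1.map ρ Q) = localPair d U V ρ P.rep Q.rep := by
  obtain ⟨B, -, hB⟩ := exists_localBound (U := U.map (ρ.comp (algebraMap F L)))
    (V := V.map (ρ.comp (algebraMap F L))) (by omega) (hU.map _) (hV.map _) (by
      rw [homResultant_map]
      simpa using hres)
  have hw : P.rep 0 * Q.rep 1 - Q.rep 0 * P.rep 1 ≠ 0 :=
    wedge_ne_zero_of_ne P.rep_nonzero Q.rep_nonzero (by simpa using hPQ)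
  rw [localPair_eq, ← greenDiag_mk hd (hU.map _) (hV.map _) hB (embed_ne_zero ρ P.rep_nonzero)
    (embed_ne_zero ρ Q.rep_nonzero) (by
      rw [← map_mul, ← map_mul, ← map_sub]
      exact (map_ne_zero ρ).2 hw), ← P1.map_mk ρ P.rep_nonzero, ← P1.map_mk ρ Q.rep_nonzero,
    P.mk_rep, Q.mk_rep]

/-- The sum of the Green function over the pairs of distinct elements of a finite set. -/
noncomputable def greenSum [DecidableEq (P1 L)] (d : ℕ) (U V : MvPolynomial (Fin 2) F)
    (ρ : L →+* C) (s : Finset (P1 L)) : ℝ :=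
  ∑ p ∈ s.offDiag, greenDiag d (U.map (ρ.comp (algebraMap F L))) (V.map (ρ.comp (algebraMap F L)))
      (P1.map ρ p.1) (P1.map ρ p.2)

variable [DecidableEq (P1 L)]

lemma greenSum_eq (hd : 2 ≤ d) (hU : U.IsHomogeneous d) (hV : V.IsHomogeneous d)
    (hres : homResultant d U V ≠ 0) (ρ : L →+* C) (s : Finset (P1 L)) :
    greenSum d U V ρ s = ∑ p ∈ s.offDiag, localPair d U V ρ p.1.rep p.2.rep :=
  Finset.sum_congr rfl fun _ hp => greenDiag_map hd hU hV hres ρ (Finset.mem_offDiag.1 hp).2.2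

/-- The automorphism fixes the coefficients of the forms and permutes the pairs. -/
lemma greenSum_comp_algEquiv (ρ : L →+* C) (g : L ≃ₐ[F] L) {s : Finset (P1 L)}
    (hs : ∀ P ∈ s, P1.map (g : L →+* L) P ∈ s) :
    greenSum d U V (ρ.comp (g : L →+* L)) s = greenSum d U V ρ s := by
  have hg : (ρ.comp (g : L →+* L)).comp (algebraMap F L) = ρ.comp (algebraMap F L) := by
    ext x
    simp
  have himg : s.image (P1.map (g : L →+* L)) = s :=
    Finset.eq_of_subset_of_card_le (Finset.image_subset_iff.2 hs)
      (Finset.card_image_of_injective _ (P1.map_injective _)).ge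
  rw [greenSum, greenSum, hg]
  refine Finset.sum_bij (fun p _ => (P1.map (g : L →+* L) p.1, P1.map (g : L →+* L) p.2))
    (fun p hp => ?_) (fun p _ p' _ h => ?_) (fun p hp => ?_) fun p hp => ?_
  · obtain ⟨h1, h2, h3⟩ := Finset.mem_offDiag.1 hp
    exact Finset.mem_offDiag.2 ⟨hs _ h1, hs _ h2, fun h => h3 (P1.map_injective _ h)⟩
  · rw [Prod.mk.injEq] at h
    exact Prod.ext (P1.map_injective _ h.1) (P1.map_injective _ h.2)
  · obtain ⟨h1, h2, h3⟩ := Finset.mem_offDiag.1 hp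
    rw [← himg] at h1 h2
    obtain ⟨a, ha, ha'⟩ := Finset.mem_image.1 h1
    obtain ⟨b, hb, hb'⟩ := Finset.mem_image.1 h2
    refine ⟨(a, b), Finset.mem_offDiag.2 ⟨ha, hb, ?_⟩, by rw [ha', hb']⟩
    intro (hab : a = b)
    rw [hab] at ha'
    exact h3 (ha'.symm.trans hb')
  · rw [P1.map_map, P1.map_map]

end greenSum

/-! ### Independence of the chosen embedding of `Qbar`. -/

section independence

variable {F : Type*} [Field F] [NumberField F] {Qbar : Type*} [Field Qbar] [Algebra F Qbar]
  [CharZero Qbar] [Algebra.IsAlgebraic ℚ Qbar] [IsAlgClosed Qbar] [DecidableEq (P1 Qbar)]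
  {d : ℕ} {U V : MvPolynomial (Fin 2) F}

omit [DecidableEq (P1 Qbar)] in
lemma exists_comp_algEquiv_eq {C : Type*} [Field C] (τ τ' : Qbar →+* C)
    (h : ∀ x, τ (algebraMap F Qbar x) = τ' (algebraMap F Qbar x)) :
    ∃ g : Qbar ≃ₐ[F] Qbar, τ' = τ.comp (g : Qbar →+* Qbar) := by
  have := isGalois_of_isAlgClosed (F := F) (Qbar := Qbar)
  let := τ.toAlgebra
  let := (τ.comp (algebraMap F Qbar)).toAlgebra
  have : IsScalarTower F Qbar C := .of_algebraMap_eq fun x => rfl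
  let τ₁ : Qbar →ₐ[F] C := { τ' with commutes' := fun x => (h x).symm }
  refine ⟨Normal.algHomEquivAut F C Qbar τ₁, ?_⟩
  have h1 := (Normal.algHomEquivAut F C Qbar).symm_apply_apply τ₁
  ext x
  exact (DFunLike.congr_fun h1 x).symm

/-- The sum of the Green function over a Galois invariant set depends only on the absolute value
induced on the ground field. -/
lemma greenSum_eq_of_norm_eq (hd : 2 ≤ d) (hU : U.IsHomogeneous d) (hV : V.IsHomogeneous d)
    (hres : homResultant d U V ≠ 0) {q : RatPlace} (τ τ' : Qbar →+* q.C)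
    (h : ∀ x : F, ‖τ (algebraMap F Qbar x)‖ = ‖τ' (algebraMap F Qbar x)‖) {s : Finset (P1 Qbar)}
    (hs : ∀ (g : Qbar ≃ₐ[F] Qbar), ∀ P ∈ s, P1.map (g : Qbar →+* Qbar) P ∈ s) :
    greenSum d U V τ s = greenSum d U V τ' s := by
  -- First an isometric change makes the two embeddings agree on `F`; then they differ by an
  -- automorphism of `Qbar` over `F`, which preserves `s`.
  obtain ⟨τ₁, h1, h2⟩ := exists_isometric_embedding q (τ'.comp (algebraMap F Qbar)) τ h
  obtain ⟨g, rfl⟩ := exists_comp_algEquiv_eq τ₁ τ' h1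
  rw [greenSum_comp_algEquiv _ g (hs g), greenSum_eq hd hU hV hres, greenSum_eq hd hU hV hres]
  exact Finset.sum_congr rfl fun p _ => (localPair_congr h2 _ _).symm

end independence

/-! ### Sums over the places of a number field -/

section places

variable {F : Type*} [Field F] [NumberField F]

/-- The place induced by an embedding in `ℂ_p`. -/
noncomputable def placeOf (p : Σ q : RatPlace, F →+* q.C) : Place F where
  abv := embAbv p.2
  under := p.1
  extends_abv r := by
    rw [← RatPlace.norm_ratCast]
    change ‖p.2 (algebraMap ℚ F r)‖ = _
    simp

lemma Place.eq_of_abv_eq {v w : Place F} (h : v.under = w.under) (h' : ∀ x, v.abv x = w.abv x) :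
    v = w := by
  cases v
  cases w
  obtain rfl : _ = _ := h
  congr
  exact AbsoluteValue.ext h'

lemma finite_places_of_finite {S : Set RatPlace} (hS : S.Finite)
    (hne : ∀ v : Place F, ∃ σ : F →+* v.C, ∀ x, ‖σ x‖ = v.abv x) :
    {v : Place F | v.under ∈ S}.Finite := by
  classical
  refine ((hS.toFinset.sigma fun _ => Finset.univ).image placeOf).finite_toSet.subset fun v hv => ?_
  obtain ⟨σ, hσ⟩ := hne v
  rw [Finset.mem_coe, Finset.mem_image]
  exact ⟨⟨v.under, σ⟩, by simpa using hv, Place.eq_of_abv_eq rfl hσ⟩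

/-- A sum over embeddings, of a function which depends only on the induced place, as a sum over
places. -/
lemma finsum_place_eq_embSum {D : (q : RatPlace) → (F →+* q.C) → ℝ} (hD : AlmostZero D)
    {w : Place F → ℝ} (hne : ∀ v : Place F, ∃ σ : F →+* v.C, ∀ x, ‖σ x‖ = v.abv x)
    (hw : ∀ (v : Place F) (σ : F →+* v.C), (∀ x, ‖σ x‖ = v.abv x) → D v.under σ = w v) :
    (Function.support fun v : Place F => (v.ε : ℝ) * w v).Finite ∧
      ∑ᶠ v : Place F, (v.ε : ℝ) * w v = embSum F D := by
  classical
  have hsupp : (Function.support fun v : Place F => (v.ε : ℝ) * w v) ⊆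
      {v : Place F | v.under ∈ {q : RatPlace | ¬ ∀ σ, D q σ = 0}} := by
    intro v hv h0
    obtain ⟨σ, hσ⟩ := hne v
    exact hv (by dsimp only; rw [← hw v σ hσ, h0, mul_zero])
  have hfin := finite_places_of_finite (F := F) (S := {q : RatPlace | ¬ ∀ σ, D q σ = 0}) hD hne
  refine ⟨hfin.subset hsupp, ?_⟩
  let S : Finset RatPlace := Set.Finite.toFinset hD
  let T : Finset (Σ q : RatPlace, F →+* q.C) := S.sigma fun _ => Finset.univ
  have hS : ∀ q, q ∉ S → ∀ σ : F →+* q.C, D q σ = 0 := by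
    intro q hq
    by_contra h
    exact hq ((Set.Finite.mem_toFinset hD).2 h)
  rw [finsum_eq_sum_of_support_subset (s := T.image placeOf) _ fun v hv => ?_]
  · have h1 : embSum F D = ∑ p ∈ T, D p.1 p.2 := by
      rw [Finset.sum_sigma, embSum]
      refine finsum_eq_sum_of_support_subset _ fun q hq => ?_
      by_contra h
      exact hq (Finset.sum_eq_zero fun σ _ => hS q h σ)
    rw [h1, ← Finset.sum_fiberwise_of_maps_to (t := T.image placeOf) (g := placeOf)
      fun p hp => Finset.mem_image_of_mem _ hp]
    refine Finset.sum_congr rfl fun v hv => ?_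
    obtain ⟨p₀, hp₀, rfl⟩ := Finset.mem_image.1 hv
    have h2 : ∀ p ∈ T.filter (placeOf · = placeOf p₀), D p.1 p.2 = w (placeOf p₀) := by
      intro p hp
      rw [← (Finset.mem_filter.1 hp).2]
      exact hw (placeOf p) p.2 fun x => rfl
    rw [Finset.sum_congr rfl h2, Finset.sum_const, nsmul_eq_mul]
    congr 2
    -- The fibre of `placeOf` over a place consists of the embeddings counted by `ε`.
    rw [Place.ε, Nat.card_eq_fintype_card, ← Finset.card_univ]
    refine Finset.card_bij (fun σ _ => ⟨p₀.1, σ.1⟩) (fun σ _ => ?_) (fun σ _ σ' _ h => ?_)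
      fun p hp => ?_
    · rw [Finset.mem_filter]
      refine ⟨?_, Place.eq_of_abv_eq rfl σ.2⟩
      have := (Finset.mem_sigma.1 hp₀).1
      exact Finset.mem_sigma.2 ⟨this, Finset.mem_univ _⟩
    · exact Subtype.ext (eq_of_heq (Sigma.mk.inj_iff.1 h).2)
    · obtain ⟨h3, h4⟩ := Finset.mem_filter.1 hp
      obtain ⟨q, σ⟩ := p
      obtain ⟨q₀, σ₀⟩ := p₀
      obtain rfl : q = q₀ := congrArg Place.under h4
      exact ⟨⟨σ, fun x => congrArg (fun v : Place F => v.abv x) h4⟩, Finset.mem_univ _, rfl⟩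
  · obtain ⟨σ, hσ⟩ := hne v
    refine Finset.mem_coe.2 (Finset.mem_image.2 ⟨⟨v.under, σ⟩, ?_, Place.eq_of_abv_eq rfl hσ⟩)
    exact Finset.mem_sigma.2 ⟨(Set.Finite.mem_toFinset hD).2 (hsupp hv), Finset.mem_univ _⟩

end places

/-! ### The normalized height as a sum of discrepancies -/

section descent

variable {F : Type*} [Field F] [NumberField F] {L : Type*} [Field L] [NumberField L] [Algebra F L]
  {d : ℕ} {U V : MvPolynomial (Fin 2) F}

/-- The product formula kills the determinant and the resultant; the two local Green functions sum
to the heights. -/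
lemma localPair_sum (hd : 2 ≤ d) (hU : U.IsHomogeneous d) (hV : V.IsHomogeneous d)
    (hres : homResultant d U V ≠ 0) {x y : Fin 2 → L} (hx : x ≠ 0) (hy : y ≠ 0) :
    AlmostZero (fun q (ρ : L →+* q.C) => localPair d U V ρ x y) ∧
      embSum L (fun _ ρ => localPair d U V ρ x y) =
        Module.finrank ℚ L * (greenHeight d U V x + greenHeight d U V y) := by
  have h0 : (Module.finrank ℚ L : ℝ) ≠ 0 := by exact_mod_cast Module.finrank_pos.ne'
  have h1 := (almostZero_log_norm (x 0 * y 1 - y 0 * x 1)).const_mul (-1)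
  have h2 := almostZero_localGreen (L := L) hd hU hV hres hx
  have h3 := almostZero_localGreen (L := L) hd hU hV hres hy
  have h4 := (almostZero_log_norm (algebraMap F L (homResultant d U V))).const_mul
    (-(1 / ((d : ℝ) * ((d : ℝ) - 1))))
  have h5 : (fun (q : RatPlace) (ρ : L →+* q.C) => localPair d U V ρ x y) = fun q ρ =>
      -1 * Real.log ‖ρ (x 0 * y 1 - y 0 * x 1)‖ + localGreen d U V ρ x + localGreen d U V ρ y +
        -(1 / ((d : ℝ) * ((d : ℝ) - 1))) *
          Real.log ‖ρ (algebraMap F L (homResultant d U V))‖ := by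
    funext q ρ
    rw [localPair]
    ring
  rw [h5]
  refine ⟨((h1.add h2).add h3).add h4, ?_⟩
  rw [embSum_add ((h1.add h2).add h3) h4, embSum_add (h1.add h2) h3, embSum_add h1 h2,
    embSum_const_mul, embSum_const_mul, embSum_log_norm, embSum_log_norm, greenHeight, greenHeight]
  field_simp
  ring

variable {Qbar : Type*} [Field Qbar] [Algebra F Qbar]
  [CharZero Qbar] [Algebra.IsAlgebraic ℚ Qbar] [IsAlgClosed Qbar] (f : Endo F Qbar d)

omit [NumberField L] in
lemma exists_extension {M : Type*} [Field M] [Algebra L M] [Algebra.IsAlgebraic L M] {C : Type*}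
    [Field C] [IsAlgClosed C] (σ : L →+* C) : ∃ τ : M →+* C, τ.comp (algebraMap L M) = σ := by
  let := σ.toAlgebra
  exact ⟨(IsAlgClosed.lift : M →ₐ[L] C), AlgHom.comp_algebraMap _⟩

lemma Endo.normalizedHeight_conjugate (hd : 2 ≤ d) {P Q : P1 Qbar} (hQ : Q ∈ conjugates F P) :
    f.normalizedHeight Q = f.normalizedHeight P := by
  obtain ⟨g, rfl⟩ := hQ
  obtain ⟨L, hL, x, hx, rfl⟩ := exists_eq_mk (F := F) P
  rw [f.normalizedHeight_mk hd L.val hx]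
  -- A conjugate point has the same coordinates in `L`, seen through another embedding of `L`, on
  -- which `greenHeight` does not depend.
  exact f.normalizedHeight_mk hd ((g : Qbar →ₐ[F] Qbar).comp L.val) hx

/-- Each embedding of `F` is extended to `Qbar` arbitrarily; Galois invariance of `s` makes the sum
independent of the extension. It can therefore be evaluated over a number field `L` containing the
coordinates, and comparing the normalized sums over `L` and `F` gives the value. -/
lemma Endo.exists_greenSum_descent [DecidableEq (P1 Qbar)] (hd : 2 ≤ d) {s : Finset (P1 Qbar)}
    (hs : ∀ (g : Qbar ≃ₐ[F] Qbar), ∀ P ∈ s, P1.map (g : Qbar →+* Qbar) P ∈ s) :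
    ∃ D : (q : RatPlace) → (F →+* q.C) → ℝ,
      (∀ (q : RatPlace) (σ : F →+* q.C) (τ : Qbar →+* q.C),
        (∀ x, ‖τ (algebraMap F Qbar x)‖ = ‖σ x‖) → D q σ = greenSum d f.U f.V τ s) ∧
      AlmostZero D ∧ embSum F D = Module.finrank ℚ F *
        ∑ p ∈ s.offDiag, (f.normalizedHeight p.1 + f.normalizedHeight p.2) := by
  have hU := f.homogeneous_U
  have hV := f.homogeneous_V
  have hres := f.homResultant_ne_zero (by omega)
  have : Algebra.IsAlgebraic F Qbar := Algebra.IsAlgebraic.tower_top (K := ℚ) F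
  choose E hE using fun (q : RatPlace) (σ : F →+* q.C) => exists_extension (M := Qbar) σ
  have hD : ∀ (q : RatPlace) (σ : F →+* q.C) (τ : Qbar →+* q.C),
      (∀ x, ‖τ (algebraMap F Qbar x)‖ = ‖σ x‖) →
        greenSum d f.U f.V (E q σ) s = greenSum d f.U f.V τ s := fun q σ τ h =>
    greenSum_eq_of_norm_eq hd hU hV hres _ _ (fun x => by
      rw [h, ← RingHom.comp_apply, hE]) hs
  obtain ⟨L, hL, ha⟩ := exists_numberField (F := F) s
  have ha' : ∀ P : P1 Qbar, ∃ x : Fin 2 → L, x ≠ 0 ∧ (P ∈ s → (fun i => L.val (x i)) = P.rep) := by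
    intro P
    by_cases hP : P ∈ s
    · obtain ⟨x, hx⟩ := ha P hP
      have hx' : (fun i => L.val (x i)) = P.rep := funext hx
      refine ⟨x, fun h => P.rep_nonzero ?_, fun _ => hx'⟩
      rw [← hx', h]
      ext; simp
    · exact ⟨1, one_ne_zero, fun h => absurd h hP⟩
  choose a ha0 ha using ha'
  have : Algebra.IsAlgebraic L Qbar := Algebra.IsAlgebraic.tower_top (K := ℚ) L
  have hLF : ∀ (q : RatPlace) (τ : Qbar →+* q.C), greenSum d f.U f.V τ s =
      ∑ p ∈ s.offDiag, localPair d f.U f.V (τ.comp (L.val : L →+* Qbar)) (a p.1) (a p.2) := by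
    intro q τ
    rw [greenSum_eq hd hU hV hres]
    refine Finset.sum_congr rfl fun p hp => ?_
    obtain ⟨h1, h2, -⟩ := Finset.mem_offDiag.1 hp
    rw [← ha _ h1, ← ha _ h2, localPair_comp]
  have hsum := fun p : P1 Qbar × P1 Qbar =>
    localPair_sum (L := L) hd hU hV hres (ha0 p.1) (ha0 p.2)
  have hAZ := AlmostZero.sum s.offDiag fun p _ => (hsum p).1
  refine ⟨fun q σ => greenSum d f.U f.V (E q σ) s, hD, ?_, ?_⟩
  · filter_upwards [hAZ] with q hq σ
    rw [hLF]
    exact hq _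
  · have h1 := embSum_comp (algebraMap F L) fun q σ => greenSum d f.U f.V (E q σ) s
    have h2 : ∀ (q : RatPlace) (ρ : L →+* q.C),
        greenSum d f.U f.V (E q (ρ.comp (algebraMap F L))) s =
          ∑ p ∈ s.offDiag, localPair d f.U f.V ρ (a p.1) (a p.2) := by
      intro q ρ
      obtain ⟨τ, hτ⟩ := exists_extension (M := Qbar) ρ
      rw [hD q _ τ fun x => ?_, hLF q τ]
      · exact Finset.sum_congr rfl fun p _ => by rw [← hτ]; rfl
      · rw [← hτ]
        rfl
    simp only [h2] at h1
    rw [embSum_sum _ fun p _ => (hsum p).1, Finset.sum_congr rfl fun p _ => (hsum p).2,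
      ← Finset.mul_sum] at h1
    have hF0 : (Module.finrank ℚ F : ℝ) ≠ 0 := by exact_mod_cast Module.finrank_pos.ne'
    have hL0 : (Module.finrank ℚ L : ℝ) ≠ 0 := by exact_mod_cast Module.finrank_pos.ne'
    rw [mul_div_cancel_left₀ _ hL0, eq_div_iff hF0] at h1
    rw [← h1, mul_comm]
    congr 1
    refine Finset.sum_congr rfl fun p hp => ?_
    obtain ⟨hp1, hp2, -⟩ := Finset.mem_offDiag.1 hp
    have h3 : ∀ P ∈ s, f.normalizedHeight P = greenHeight d f.U f.V (a P) := by
      intro P hP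
      rw [← f.normalizedHeight_mk hd L.val (ha0 P)]
      congr 1
      conv_lhs => rw [← P.mk_rep]
      simp only [← ha P hP]
      rfl
    rw [h3 _ hp1, h3 _ hp2]

omit [IsAlgClosed Qbar] in
/-- The discrepancy as an average over the pairs of distinct conjugates. -/
lemma Endo.discrepancy_eq [DecidableEq (P1 Qbar)] {v : Place F} (τ : v.Embedding Qbar)
    (P : P1 Qbar) :
    f.discrepancy τ P = 1 / (((finite_conjugates (F := F) P).toFinset.card : ℝ) *
      (((finite_conjugates (F := F) P).toFinset.card : ℝ) - 1)) *
        greenSum d f.U f.V τ.1 (finite_conjugates (F := F) P).toFinset := by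
  have h : conjugates F P = ((finite_conjugates (F := F) P).toFinset : Set (P1 Qbar)) := by simp
  rw [Endo.discrepancy, ← Set.ncard_eq_toFinset_card _ (finite_conjugates P)]
  congr 1
  conv_lhs => rw [h, ← Finset.coe_offDiag, finsum_mem_coe_finset]
  rfl

/-- The normalized height in terms of the discrepancies at all the places. -/
lemma Endo.sum_discrepancy (hd : 2 ≤ d) (τ : (v : Place F) → v.Embedding Qbar) {P : P1 Qbar}
    (hP : 2 ≤ (conjugates F P).ncard) :
    (Function.support fun v : Place F => (v.ε : ℝ) * f.discrepancy (τ v) P).Finite ∧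
      ∑ᶠ v : Place F, (v.ε : ℝ) * f.discrepancy (τ v) P =
        2 * Module.finrank ℚ F * f.normalizedHeight P := by
  classical
  set s := (finite_conjugates (F := F) P).toFinset with hs
  have hcard : 2 ≤ s.card := by rwa [hs, ← Set.ncard_eq_toFinset_card _ (finite_conjugates P)]
  have hstab : ∀ (g : Qbar ≃ₐ[F] Qbar), ∀ Q ∈ s, P1.map (g : Qbar →+* Qbar) Q ∈ s := fun g Q hQ =>
    (Set.Finite.mem_toFinset _).2 (map_mem_conjugates g ((Set.Finite.mem_toFinset _).1 hQ))
  obtain ⟨D, hD, hD0, hsum⟩ := f.exists_greenSum_descent hd hstab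
  set c : ℝ := 1 / ((s.card : ℝ) * ((s.card : ℝ) - 1)) with hc
  have h1 := finsum_place_eq_embSum (hD0.const_mul c) (w := fun v => f.discrepancy (τ v) P)
    (fun v => ⟨(τ v).1.comp (algebraMap F Qbar), (τ v).2⟩) fun v σ hσ => by
      rw [f.discrepancy_eq, hD v.under σ (τ v).1 fun x => by rw [(τ v).2, hσ]]
  refine ⟨h1.1, h1.2.trans ?_⟩
  rw [embSum_const_mul, hsum]
  have h2 : ∀ Q ∈ s, f.normalizedHeight Q = f.normalizedHeight P := fun Q hQ =>
    f.normalizedHeight_conjugate hd ((Set.Finite.mem_toFinset _).1 hQ)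
  -- All conjugates have the same height, and the number of pairs cancels the normalization of the
  -- discrepancy.
  have h3 : ∑ p ∈ s.offDiag, (f.normalizedHeight p.1 + f.normalizedHeight p.2) =
      (s.card * (s.card - 1)) * (2 * f.normalizedHeight P) := by
    rw [Finset.sum_congr rfl fun p hp => by
      rw [h2 _ (Finset.mem_offDiag.1 hp).1, h2 _ (Finset.mem_offDiag.1 hp).2.1], Finset.sum_const,
      Finset.offDiag_card, nsmul_eq_mul, Nat.cast_sub (Nat.le_mul_self _)]
    push_cast
    ring
  have h4 : (2 : ℝ) ≤ s.card := by exact_mod_cast hcard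
  have h5 : (s.card : ℝ) - 1 ≠ 0 := by linarith
  rw [h3, hc]
  field_simp

end descent

/-! ### Northcott's theorem -/

section coefficients

variable {k : Type*} [NormedField k]

/-- Multiplication by `X - r` multiplies a bound for the coefficients by at most `A * max ‖r‖ 1`. -/
lemma norm_coeff_prod_le {A : ℝ} (hA : 1 ≤ A) (h : ∀ a b : k, ‖a + b‖ ≤ A * max ‖a‖ ‖b‖)
    (s : Finset k) (i : ℕ) :
    ‖(∏ r ∈ s, (Polynomial.X - Polynomial.C r)).coeff i‖ ≤ ∏ r ∈ s, (A * max ‖r‖ 1) := by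
  classical
  induction s using Finset.induction_on generalizing i with
  | empty =>
    rw [Finset.prod_empty, Finset.prod_empty, Polynomial.coeff_one]
    split_ifs <;> simp
  | insert r s hr ih =>
    have h0 : 0 ≤ ∏ r ∈ s, (A * max ‖r‖ 1) := (norm_nonneg _).trans (ih 0)
    have hm : 1 ≤ max ‖r‖ 1 := le_max_right _ _
    rw [Finset.prod_insert hr, Finset.prod_insert hr, sub_mul, Polynomial.coeff_sub,
      Polynomial.coeff_C_mul, sub_eq_add_neg, mul_assoc]
    refine (h _ _).trans (mul_le_mul_of_nonneg_left (max_le ?_ ?_) (by linarith))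
    · cases i with
      | zero =>
        rw [Polynomial.coeff_X_mul_zero, norm_zero]
        exact mul_nonneg (by linarith) h0
      | succ i =>
        rw [Polynomial.coeff_X_mul]
        exact (ih i).trans (le_mul_of_one_le_left h0 hm)
    · rw [norm_neg, norm_mul]
      exact mul_le_mul (le_max_left _ _) (ih i) (norm_nonneg _) (by linarith)

lemma log_norm_coeff_prod_le {A : ℝ} (hA : 1 ≤ A) (h : ∀ a b : k, ‖a + b‖ ≤ A * max ‖a‖ ‖b‖)
    (s : Finset k) (i : ℕ) :
    Real.log (max ‖(∏ r ∈ s, (Polynomial.X - Polynomial.C r)).coeff i‖ 1) ≤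
      ∑ r ∈ s, Real.log (max ‖r‖ 1) + s.card * Real.log A := by
  have hm : ∀ r : k, 1 ≤ max ‖r‖ 1 := fun r => le_max_right _ _
  have h1 : ∀ r ∈ s, A * max ‖r‖ 1 ≠ 0 := fun r _ =>
    (mul_pos (by linarith) (by linarith [hm r])).ne'
  have h2 := Real.log_le_log (zero_lt_one.trans_le (le_max_right _ _))
    (max_le (norm_coeff_prod_le hA h s i)
      (Finset.one_le_prod fun r _ => one_le_mul_of_one_le_of_one_le hA (hm r)))
  rw [Real.log_prod h1] at h2
  refine h2.trans (le_of_eq ?_)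
  rw [Finset.sum_congr rfl fun r _ => Real.log_mul (by linarith) (by linarith [hm r]),
    Finset.sum_add_distrib, Finset.sum_const, nsmul_eq_mul, add_comm]

end coefficients

section northcott

/-- The constant in the triangle inequality `|a + b| ≤ A max(|a|, |b|)` over `ℂ_p`. -/
noncomputable def RatPlace.triangleConst : RatPlace → ℝ
  | .infinite => 2
  | .finite _ => 1

lemma RatPlace.one_le_triangleConst (q : RatPlace) : 1 ≤ q.triangleConst := by
  cases q <;> norm_num [triangleConst]

lemma RatPlace.norm_add_le (q : RatPlace) (a b : q.C) :
    ‖a + b‖ ≤ q.triangleConst * max ‖a‖ ‖b‖ := by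
  cases q with
  | infinite =>
    refine (_root_.norm_add_le a b).trans ?_
    rw [triangleConst]
    linarith [le_max_left ‖a‖ ‖b‖, le_max_right ‖a‖ ‖b‖]
  | finite p =>
    rw [triangleConst, one_mul]
    exact IsUltrametricDist.norm_add_le_max a b

lemma RatPlace.eventually_triangleConst : ∀ᶠ q : RatPlace in cofinite, q.triangleConst = 1 :=
  eventually_cofinite_of_finite ∅ Set.finite_empty fun _ _ => rfl

lemma RatPlace.finsum_triangleConst : ∑ᶠ q : RatPlace, Real.log q.triangleConst = Real.log 2 := by
  refine finsum_eq_single _ RatPlace.infinite fun q hq => ?_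
  cases q with
  | infinite => exact absurd rfl hq
  | finite p => exact Real.log_one

variable {K : Type*} [Field K] [NumberField K]

/-- The roots in `ℂ_p` are simple and are images of `α` under embeddings. As all terms are
nonnegative, the sum over roots may be enlarged to one over all embeddings. -/
lemma log_norm_coeff_minpoly_le (α : K) (q : RatPlace) (i : ℕ) :
    Real.log (max ‖algebraMap ℚ q.C ((minpoly ℚ α).coeff i)‖ 1) ≤
      ∑ σ : K →+* q.C, Real.log (max ‖σ α‖ 1) +
        (minpoly ℚ α).natDegree * Real.log q.triangleConst := by
  classical
  have hint : IsIntegral ℚ α := Algebra.IsIntegral.isIntegral α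
  set p := (minpoly ℚ α).map (algebraMap ℚ q.C) with hp
  have hsplit : p.Splits := IsAlgClosed.splits p
  have hnodup : p.roots.Nodup :=
    Polynomial.nodup_roots ((minpoly.irreducible hint).separable.map)
  have hprod : p = ∏ r ∈ p.roots.toFinset, (Polynomial.X - Polynomial.C r) := by
    conv_lhs => rw [hsplit.eq_prod_roots_of_monic ((minpoly.monic hint).map _)]
    rw [Finset.prod, Multiset.toFinset_val, hnodup.dedup]
  have hcard : (p.roots.toFinset.card : ℝ) ≤ (minpoly ℚ α).natDegree := by
    have := (Multiset.toFinset_card_le p.roots).trans p.card_roots'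
    rw [hp, Polynomial.natDegree_map] at this
    exact_mod_cast this
  have hlog : ∀ r : q.C, 0 ≤ Real.log (max ‖r‖ 1) := fun r => Real.log_nonneg (le_max_right _ _)
  rw [← Polynomial.coeff_map, ← hp]
  conv_lhs => rw [hprod]
  refine (log_norm_coeff_prod_le q.one_le_triangleConst q.norm_add_le _ i).trans ?_
  refine add_le_add ?_ (mul_le_mul_of_nonneg_right hcard
    (Real.log_nonneg q.one_le_triangleConst))
  have hroot : ∀ r ∈ p.roots.toFinset, ∃ σ : K →+* q.C, σ α = r := by
    intro r hr
    have h1 : r ∈ (minpoly ℚ α).rootSet q.C := by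
      rw [Polynomial.mem_rootSet']
      rw [Multiset.mem_toFinset, Polynomial.mem_roots'] at hr
      exact ⟨hr.1, by rw [Polynomial.aeval_def, ← Polynomial.eval_map]; exact hr.2⟩
    rw [← NumberField.Embeddings.range_eval_eq_rootSet_minpoly K q.C α] at h1
    exact h1
  choose! E hE using hroot
  calc ∑ r ∈ p.roots.toFinset, Real.log (max ‖r‖ 1)
      = ∑ r ∈ p.roots.toFinset, Real.log (max ‖E r α‖ 1) :=
        Finset.sum_congr rfl fun r hr => by rw [hE r hr]
    _ = ∑ σ ∈ p.roots.toFinset.image E, Real.log (max ‖σ α‖ 1) := by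
        rw [Finset.sum_image fun r hr r' hr' h => by rw [← hE r hr, ← hE r' hr', h]]
    _ ≤ _ := Finset.sum_le_univ_sum_of_nonneg fun σ => hlog _

lemma log_norm_affine {L : Type*} [Field L] {C : Type*} [NormedField C] (σ : L →+* C) (x : L) :
    Real.log ‖fun i => σ ((![x, 1] : Fin 2 → L) i)‖ = Real.log (max ‖σ x‖ 1) := by
  rw [norm_fin_two]
  simp

lemma affine_ne_zero {L : Type*} [Field L] (x : L) : (![x, 1] : Fin 2 → L) ≠ 0 := fun h => by
  simpa using congrFun h 1

/-- The local bounds are summed over the places of `ℚ`; only the infinite one contributes `log 2`.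
-/
lemma logHeight₁_coeff_minpoly_le (α : K) (i : ℕ) :
    Height.logHeight₁ ((minpoly ℚ α).coeff i) ≤
      Module.finrank ℚ K * pairHeight ![α, 1] + (minpoly ℚ α).natDegree * Real.log 2 := by
  have hK : (Module.finrank ℚ K : ℝ) ≠ 0 := by exact_mod_cast Module.finrank_pos.ne'
  set c := (minpoly ℚ α).coeff i with hc
  have h1 : Height.logHeight₁ c = Height.logHeight ![c, 1] :=
    Height.logHeight₁_eq_logHeight c
  have h2 := almostZero_log_norm_pair (affine_ne_zero α)
  have h3 := almostZero_log_norm_pair (affine_ne_zero c)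
  have h4 : AlmostZero fun (q : RatPlace) (_ : ℚ →+* q.C) =>
      ∑ σ : K →+* q.C, Real.log ‖fun i => σ ((![α, 1] : Fin 2 → K) i)‖ := by
    filter_upwards [h2] with q hq _
    exact Finset.sum_eq_zero fun σ _ => hq σ
  have h5 : AlmostZero fun (q : RatPlace) (_ : ℚ →+* q.C) =>
      (minpoly ℚ α).natDegree * Real.log q.triangleConst := by
    filter_upwards [RatPlace.eventually_triangleConst] with q hq _
    rw [hq, Real.log_one, mul_zero]
  rw [h1, logHeight_eq_embSum (affine_ne_zero c)]
  refine (embSum_mono h3 (h4.add h5) fun q σ => ?_).trans (le_of_eq ?_)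
  · simp only [log_norm_affine]
    rw [Subsingleton.elim σ (algebraMap ℚ q.C)]
    exact log_norm_coeff_minpoly_le α q i
  · rw [embSum_add h4 h5, embSum_const_mul, embSum_const, embSum_const,
      RatPlace.finsum_triangleConst, pairHeight, mul_div_cancel₀ _ hK, Module.finrank_self,
      Nat.cast_one, one_mul, one_mul]
    rfl

variable {F : Type*} [Field F] [NumberField F] {Qbar : Type*} [Field Qbar] [Algebra F Qbar]
  [CharZero Qbar] [Algebra.IsAlgebraic ℚ Qbar] [IsAlgClosed Qbar]

-- The degree over `ℚ` is at most `[F : ℚ] [F(x) : F]`. By separability `[F(x) : F]` is the number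
-- of roots of the minimal polynomial over `F`, which are the conjugates of `x`.
open scoped IntermediateField in
lemma natDegree_minpoly_le_ncard_conjugates (x : Qbar) : (minpoly ℚ x).natDegree ≤
    Module.finrank ℚ F * (conjugates F (Projectivization.mk Qbar ![x, 1] (by simp))).ncard := by
  classical
  have := isGalois_of_isAlgClosed (F := F) (Qbar := Qbar)
  have hint : IsIntegral F x := Algebra.IsIntegral.isIntegral x
  have : FiniteDimensional F F⟮x⟯ := IntermediateField.adjoin.finiteDimensional hint
  have : FiniteDimensional ℚ F⟮x⟯ := Module.Finite.trans F F⟮x⟯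
  have h1 : (minpoly ℚ x).natDegree ≤ Module.finrank ℚ F⟮x⟯ := by
    have := minpoly.natDegree_le (A := ℚ) (IntermediateField.AdjoinSimple.gen F x)
    rwa [← minpoly.algebraMap_eq (B' := Qbar) (algebraMap F⟮x⟯ Qbar).injective,
      IntermediateField.AdjoinSimple.algebraMap_gen] at this
  rw [← Module.finrank_mul_finrank ℚ F F⟮x⟯, IntermediateField.adjoin.finrank hint] at h1
  refine h1.trans (Nat.mul_le_mul_left _ ?_)
  have h2 : (minpoly F x).natDegree = ((minpoly F x).rootSet Qbar).ncard := by
    rw [← Polynomial.card_rootSet_eq_natDegree (K := Qbar)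
      (IsGalois.separable F x) (IsAlgClosed.splits _), Set.ncard_eq_toFinset_card',
      Set.toFinset_card]
  rw [h2]
  refine Set.ncard_le_ncard_of_injOn (fun y => Projectivization.mk Qbar ![y, 1] (by simp))
    (fun y hy => ?_) (fun y _ y' _ h => P1.mk_inj h) (finite_conjugates _)
  obtain ⟨g, rfl⟩ := minpoly.exists_algEquiv_of_root' hint.isAlgebraic
    (Polynomial.mem_rootSet.1 hy).2
  exact ⟨g, P1.map_affine _ _⟩

/-- **Northcott's theorem**. -/
lemma finite_setOf_height_le (N : ℕ) (B : ℝ) :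
    {P : P1 Qbar | (conjugates F P).ncard ≤ N ∧ height P ≤ B}.Finite := by
  classical
  set M := Module.finrank ℚ F * N with hM
  -- The coefficients of minimal polynomials have bounded height, and Northcott over `ℚ` applies to
  -- them. `max B 0` allows the degree to be replaced by the larger `M`.
  have hfin : {c : ℚ | Height.logHeight₁ c ≤ M * max B 0 + M * Real.log 2}.Finite :=
    Northcott.finite_le _
  have := Polynomial.bUnion_roots_finite (algebraMap ℚ Qbar) M hfin
  refine ((this.image fun x => Projectivization.mk Qbar ![x, 1] (by simp)).insert
    (Projectivization.mk Qbar ![1, 0] (by simp))).subset ?_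
  rintro P ⟨hN, hB⟩
  rcases P1.exists_eq P with rfl | ⟨x, rfl⟩
  · exact Set.mem_insert _ _
  · refine Set.mem_insert_of_mem _ (Set.mem_image_of_mem _ ?_)
    have hint : IsIntegral ℚ x := Algebra.IsIntegral.isIntegral x
    have hdeg : (minpoly ℚ x).natDegree ≤ M :=
      (natDegree_minpoly_le_ncard_conjugates x).trans (Nat.mul_le_mul_left _ hN)
    simp only [Set.mem_iUnion, Finset.mem_coe, Multiset.mem_toFinset]
    refine ⟨minpoly ℚ x, ⟨hdeg, fun i => ?_⟩, ?_⟩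
    · let K := IntermediateField.adjoin ℚ {x}
      have : FiniteDimensional ℚ K := IntermediateField.adjoin.finiteDimensional hint
      have : NumberField K := {}
      let α : K := IntermediateField.AdjoinSimple.gen ℚ x
      have hα : minpoly ℚ α = minpoly ℚ x := by
        rw [← minpoly.algebraMap_eq (B' := Qbar) (algebraMap K Qbar).injective,
          IntermediateField.AdjoinSimple.algebraMap_gen]
      have hrank : Module.finrank ℚ K = (minpoly ℚ x).natDegree :=
        IntermediateField.adjoin.finrank hint
      have hne : (![α, 1] : Fin 2 → K) ≠ 0 := fun h => by simpa using congrFun h 1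
      have hh := height_mk (algebraMap K Qbar) hne (embed_ne_zero _ hne)
      have hx : (fun i => algebraMap K Qbar ((![α, 1] : Fin 2 → K) i)) = ![x, 1] := by
        ext i
        fin_cases i
        · exact IntermediateField.AdjoinSimple.algebraMap_gen ℚ x
        · simp
      simp only [hx] at hh
      rw [hh] at hB
      have h1 := logHeight₁_coeff_minpoly_le α i
      rw [hα, hrank] at h1
      refine h1.trans ?_
      have hdeg' : ((minpoly ℚ x).natDegree : ℝ) ≤ M := by exact_mod_cast hdeg
      have hl : 0 ≤ Real.log 2 := Real.log_nonneg (by norm_num)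
      exact add_le_add ((mul_le_mul_of_nonneg_left (hB.trans (le_max_left _ _))
        (Nat.cast_nonneg _)).trans (mul_le_mul_of_nonneg_right hdeg' (le_max_right _ _)))
        (mul_le_mul_of_nonneg_right hdeg' hl)
    · rw [Polynomial.mem_roots (Polynomial.map_ne_zero (minpoly.ne_zero hint)),
        Polynomial.IsRoot, Polynomial.eval_map, ← Polynomial.aeval_def]
      exact minpoly.aeval ℚ x

end northcott

/-! ### Equidistribution: the discrepancies of points of small height -/

section equidistribution

variable {F : Type*} [Field F] [NumberField F] {Qbar : Type*} [Field Qbar] [Algebra F Qbar]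
  [CharZero Qbar] [Algebra.IsAlgebraic ℚ Qbar] [IsAlgClosed Qbar] {d : ℕ} (f : Endo F Qbar d)

/-- The degrees of pairwise distinct points of small height tend to infinity. -/
lemma Endo.eventually_le_ncard (hd : 2 ≤ d) {P : ℕ → P1 Qbar} (hP : Function.Injective P)
    (h : Tendsto (fun n => f.normalizedHeight (P n)) atTop (𝓝 0)) (N : ℕ) :
    ∀ᶠ n in atTop, N ≤ (conjugates F (P n)).ncard := by
  obtain ⟨⟨B, hB⟩, -⟩ := f.isNormalizedHeight hd
  -- Once the normalized height is below `1`, the Weil height is below `1 + B`.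
  have hfin := finite_setOf_height_le (F := F) (Qbar := Qbar) N (1 + B)
  have h1 := hP.tendsto_cofinite.eventually hfin.compl_mem_cofinite
  rw [Nat.cofinite_eq_atTop] at h1
  filter_upwards [h1, h.eventually_lt_const one_pos] with n hn hlt
  by_contra! hlt'
  exact hn ⟨hlt'.le, by linarith [(abs_le.1 (hB (P n))).1]⟩

omit [CharZero Qbar] [Algebra.IsAlgebraic ℚ Qbar] [IsAlgClosed Qbar] in
lemma Endo.greenSum_image [DecidableEq (P1 Qbar)] {v : Place F} (τ : v.Embedding Qbar)
    [DecidableEq (P1 v.C)] (s : Finset (P1 Qbar)) :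
    ∑ᶠ p ∈ ((s.image (P1.map τ.1) : Finset (P1 v.C)) : Set (P1 v.C)).offDiag,
      greenDiag d (f.U.map (τ.1.comp (algebraMap F Qbar)))
        (f.V.map (τ.1.comp (algebraMap F Qbar))) p.1 p.2 = greenSum d f.U f.V τ.1 s := by
  rw [← Finset.coe_offDiag, finsum_mem_coe_finset, greenSum]
  symm
  have hinj := P1.map_injective τ.1
  refine Finset.sum_bij (fun p _ => (P1.map τ.1 p.1, P1.map τ.1 p.2)) (fun p hp => ?_)
    (fun p _ p' _ h => ?_) (fun p hp => ?_) fun p _ => rfl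
  · obtain ⟨h1, h2, h3⟩ := Finset.mem_offDiag.1 hp
    exact Finset.mem_offDiag.2 ⟨Finset.mem_image_of_mem _ h1, Finset.mem_image_of_mem _ h2,
      fun h => h3 (hinj h)⟩
  · rw [Prod.mk.injEq] at h
    exact Prod.ext (hinj h.1) (hinj h.2)
  · obtain ⟨h1, h2, h3⟩ := Finset.mem_offDiag.1 hp
    obtain ⟨a, ha, ha'⟩ := Finset.mem_image.1 h1
    obtain ⟨b, hb, hb'⟩ := Finset.mem_image.1 h2
    refine ⟨(a, b), Finset.mem_offDiag.2 ⟨ha, hb, ?_⟩, by rw [ha', hb']⟩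
    intro (hab : a = b)
    rw [hab] at ha'
    exact h3 (ha'.symm.trans hb')

/-- The discrepancies of points of large degree are bounded below by small constants. -/
lemma Endo.exists_discrepancy_ge (hd : 2 ≤ d) {v : Place F} (τ : v.Embedding Qbar) {ε : ℝ}
    (hε : 0 < ε) : ∃ N : ℕ, ∀ P : P1 Qbar, N ≤ (conjugates F P).ncard →
      -ε ≤ f.discrepancy τ P := by
  classical
  have hres := f.homResultant_ne_zero (by omega)
  obtain ⟨N, hN⟩ := exists_sum_greenDiag_ge (K := v.C)
    (U := f.U.map (τ.1.comp (algebraMap F Qbar))) (V := f.V.map (τ.1.comp (algebraMap F Qbar))) hd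
    (f.homogeneous_U.map _) (f.homogeneous_V.map _) (by
      rw [homResultant_map]
      exact (map_ne_zero _).2 hres) hε
  -- At least two conjugates are required for a positive number of pairs.
  refine ⟨max N 2, fun P hP => ?_⟩
  rw [Set.ncard_eq_toFinset_card _ (finite_conjugates P)] at hP
  set s := (finite_conjugates (F := F) P).toFinset with hs
  have h1 := hN (s.image (P1.map τ.1)) (by
    rw [Finset.card_image_of_injective _ (P1.map_injective _)]
    exact (le_max_left _ _).trans hP)
  rw [Finset.card_image_of_injective _ (P1.map_injective _), f.greenSum_image] at h1
  have h2 : (2 : ℝ) ≤ s.card := by exact_mod_cast (le_max_right _ _).trans hP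
  have h3 : (0 : ℝ) < s.card * (s.card - 1) := mul_pos (by linarith) (by linarith)
  rw [f.discrepancy_eq, one_div, ← div_eq_inv_mul, le_div_iff₀ h3]
  exact h1

/-- The discrepancies at places of good reduction are nonnegative. -/
lemma Endo.eventually_discrepancy_nonneg (hd : 2 ≤ d) : ∀ᶠ q : RatPlace in cofinite,
    ∀ (v : Place F) (τ : v.Embedding Qbar) (P : P1 Qbar), v.under = q →
      0 ≤ f.discrepancy τ P := by
  classical
  filter_upwards [eventually_good_reduction (by omega) f.homogeneous_U f.homogeneous_V
    (f.homResultant_ne_zero (by omega))] with q hq v τ P hv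
  subst hv
  have := hq.1
  rw [f.discrepancy_eq]
  refine mul_nonneg (one_div_nonneg.2 ?_) (Finset.sum_nonneg fun p hp => ?_)
  · rcases (finite_conjugates (F := F) P).toFinset.card.eq_zero_or_pos with h | h
    · simp [h]
    · have : (1 : ℝ) ≤ (finite_conjugates (F := F) P).toFinset.card := by exact_mod_cast h
      exact mul_nonneg (by linarith) (by linarith)
  · exact greenDiag_nonneg hd (hq.2 _).1 (hq.2 _).2 fun h =>
      (Finset.mem_offDiag.1 hp).2.2 (P1.map_injective _ h)

-- Allows an upper bound for `ε_v D_v` to be passed on to `D_v` when the latter is positive.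
omit [CharZero Qbar] [Algebra.IsAlgebraic ℚ Qbar] [IsAlgClosed Qbar] in
lemma Place.one_le_ε {v : Place F} (τ : v.Embedding Qbar) : 1 ≤ v.ε := by
  have : Nonempty {σ : F →+* v.C // ∀ x : F, ‖σ x‖ = v.abv x} :=
    ⟨⟨τ.1.comp (algebraMap F Qbar), τ.2⟩⟩
  exact Nat.card_pos

/-- **Equidistribution of points of small height**, in terms of discrepancies. -/
lemma Endo.tendsto_discrepancy (hd : 2 ≤ d) (τ : (v : Place F) → v.Embedding Qbar)
    {P : ℕ → P1 Qbar} (hP : Function.Injective P)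
    (h : Tendsto (fun n => f.normalizedHeight (P n)) atTop (𝓝 0)) (v₀ : Place F) :
    Tendsto (fun n => f.discrepancy (τ v₀) (P n)) atTop (𝓝 0) := by
  classical
  -- The places where a discrepancy may be negative form a finite set that does not depend on `n`.
  have hbad := finite_places_of_finite (F := F) (f.eventually_discrepancy_nonneg hd)
    fun v => ⟨(τ v).1.comp (algebraMap F Qbar), (τ v).2⟩
  set T := hbad.toFinset with hT
  have hgood : ∀ v ∉ T, ∀ Q, 0 ≤ f.discrepancy (τ v) Q := by
    intro v hv Q
    by_contra hlt
    exact hv ((Set.Finite.mem_toFinset _).2 fun h => hlt (h v (τ v) Q rfl))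
  have hlow : ∀ δ : ℝ, 0 < δ → ∀ v, ∀ᶠ n in atTop, -δ ≤ f.discrepancy (τ v) (P n) := by
    intro δ hδ v
    obtain ⟨N, hN⟩ := f.exists_discrepancy_ge hd (τ v) hδ
    filter_upwards [f.eventually_le_ncard hd hP h N] with n hn using hN _ hn
  rw [Metric.tendsto_nhds]
  intro ε hε
  have hE : (0 : ℝ) ≤ ∑ v ∈ T, (v.ε : ℝ) := Finset.sum_nonneg fun v _ => Nat.cast_nonneg _
  -- With this choice the places in `T` contribute more than `-ε / 2` in total; the summand `1`
  -- avoids a division by zero.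
  set δ := ε / (2 * (1 + ∑ v ∈ T, (v.ε : ℝ))) with hδ
  have hδ0 : 0 < δ := by positivity
  have hδE : δ * ∑ v ∈ T, (v.ε : ℝ) < ε / 2 := by
    have : δ * (1 + ∑ v ∈ T, (v.ε : ℝ)) = ε / 2 := by rw [hδ]; field_simp
    linarith
  have hsmall : Tendsto (fun n => 2 * Module.finrank ℚ F * f.normalizedHeight (P n)) atTop
      (𝓝 0) := by simpa using h.const_mul (2 * Module.finrank ℚ F : ℝ)
  filter_upwards [(Filter.eventually_all_finset T).2 fun v _ => hlow δ hδ0 v,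
    hlow (ε / 2) (half_pos hε) v₀, hsmall.eventually_lt_const (half_pos hε),
    f.eventually_le_ncard hd hP h 2] with n h1 h2 h3 h4
  rw [Real.dist_0_eq_abs, abs_lt]
  refine ⟨by linarith, ?_⟩
  obtain ⟨hfin, hsum⟩ := f.sum_discrepancy hd τ h4
  set w := fun v : Place F => (v.ε : ℝ) * f.discrepancy (τ v) (P n) with hw
  -- A finite set carrying the whole sum; it varies with `n`, but only its elements in `T` can
  -- contribute negatively.
  set S := insert v₀ (hfin.toFinset ∪ T) with hS
  rw [finsum_eq_sum_of_support_subset (s := S) _ fun v hv => by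
    rw [hS]
    simp only [Finset.coe_insert, Finset.coe_union, Set.Finite.coe_toFinset]
    exact Or.inr (Or.inl hv), ← Finset.add_sum_erase S w (Finset.mem_insert_self _ _)] at hsum
  have h5 : -(ε / 2) < ∑ v ∈ S.erase v₀, w v := by
    calc -(ε / 2) < ∑ v ∈ T, -δ * (v.ε : ℝ) := by
          rw [← Finset.mul_sum]
          linarith
      _ ≤ ∑ v ∈ S.erase v₀, if v ∈ T then -δ * (v.ε : ℝ) else 0 := by
          rw [← Finset.sum_filter]
          have hsub : (S.erase v₀).filter (· ∈ T) ⊆ T := fun v hv => (Finset.mem_filter.1 hv).2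
          rw [← Finset.sum_sdiff hsub]
          have : ∑ v ∈ T \ (S.erase v₀).filter (· ∈ T), -δ * (v.ε : ℝ) ≤ 0 :=
            Finset.sum_nonpos fun v _ =>
              mul_nonpos_of_nonpos_of_nonneg (by linarith) (Nat.cast_nonneg _)
          linarith
      _ ≤ ∑ v ∈ S.erase v₀, w v := by
          refine Finset.sum_le_sum fun v _ => ?_
          split_ifs with hv
          · rw [mul_comm]
            exact mul_le_mul_of_nonneg_left (h1 v hv) (Nat.cast_nonneg _)
          · exact mul_nonneg (Nat.cast_nonneg _) (hgood v hv _)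
  -- The total is below `ε / 2` and the other places give more than `-ε / 2`, so the term at `v₀` is
  -- below `ε`.
  by_contra! hge
  have h6 : f.discrepancy (τ v₀) (P n) ≤ w v₀ :=
    le_mul_of_one_le_left (hε.le.trans hge) (by exact_mod_cast Place.one_le_ε (τ v₀))
  linarith

end equidistribution
end ArithDyn

theorem mainTheorem9 {F : Type*} [Field F] [NumberField F]
    {Qbar : Type*} [Field Qbar] [CharZero Qbar] [IsAlgClosure ℚ Qbar] [Algebra F Qbar]
    {d : ℕ} (hd : 2 ≤ d) (f : ArithDyn.Endo F Qbar d)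
    (τ : (v : ArithDyn.Place F) → v.Embedding Qbar) :
    haveI : Algebra.IsAlgebraic ℚ Qbar := IsAlgClosure.isAlgebraic
    (f.IsNormalizedHeight f.normalizedHeight ∧
      ∀ hhat : ArithDyn.P1 Qbar → ℝ, f.IsNormalizedHeight hhat → hhat = f.normalizedHeight) ∧
    (∀ P : ArithDyn.P1 Qbar, P ∉ Set.range (ArithDyn.P1.map (algebraMap F Qbar)) →
      (Function.support fun v : ArithDyn.Place F => (v.ε : ℝ) * f.discrepancy (τ v) P).Finite ∧
      f.normalizedHeight P =
        1 / (Module.finrank ℚ F : ℝ) *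
          (1 / 2 * ∑ᶠ v : ArithDyn.Place F, (v.ε : ℝ) * f.discrepancy (τ v) P)) ∧
    (∀ P : ℕ → ArithDyn.P1 Qbar, Function.Injective P →
      Tendsto (fun n => f.normalizedHeight (P n)) atTop (𝓝 0) →
      (∀ᶠ n in atTop, P n ∉ Set.range (ArithDyn.P1.map (algebraMap F Qbar))) ∧
      ∀ v : ArithDyn.Place F,
        Tendsto (fun n => f.discrepancy (τ v) (P n)) atTop (𝓝 0)) := by
  have : Algebra.IsAlgebraic ℚ Qbar := IsAlgClosure.isAlgebraic
  have : IsAlgClosed Qbar := IsAlgClosure.isAlgClosed ℚ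
  refine ⟨⟨f.isNormalizedHeight hd, fun g hg => f.eq_normalizedHeight hd hg⟩, fun P hP => ?_,
    fun P hP h => ⟨?_, f.tendsto_discrepancy hd τ hP h⟩⟩
  · obtain ⟨hfin, hsum⟩ := f.sum_discrepancy hd τ (P := P) (by
      by_contra! hlt
      exact hP (ArithDyn.mem_range_of_ncard_le_one (by omega)))
    refine ⟨hfin, ?_⟩
    have hF : (Module.finrank ℚ F : ℝ) ≠ 0 := by exact_mod_cast Module.finrank_pos.ne'
    rw [hsum]
    field_simp
  · filter_upwards [f.eventually_le_ncard hd hP h 2] with n hn hr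
    have := ArithDyn.ncard_conjugates_of_mem_range hr
    omega
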